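/- **Theorem 1.4 (LDP and convergence for the empirical measures).** *Setting.* Let $d\ge 1$, let $W\subset\mathbb R^d$ be compact with $o=0\in W$, let $\mathcal M(V)$ be the set of finite Borel measures on $V$ with the weak topology, and let $\mu\in\mathcal M(W)$ be absolutely continuous with respect to Lebesgue measure with $\mu(W)>0$. Let $(N(\lambda))_{\lambda\ge 0}$ be a homogeneous Poisson process with intensity $\mu(W)$, and, independently of it, let $X_1,X_2,\dots$ be i.i.d. with law $\mu/\mu(W)$. Put $I^\lambda=\{1,\dots,N(\lambda)\}$, $X^\lambda=(X_i)_{i\in I^\lambda}$ and $L_\lambda=\frac1\lambda\sum_{i\in I^\lambda}\delta_{X_i}$. Fix $k_{\max}\in\mathbb N$, $k_{\max}\ge1$. A configuration is a family $s=(s^i)_{i\in I^\lambda}$, where $s^i$ consists of a number of hops $s^i_{-1}\in\{1,\dots,k_{\max}\}$ and of points $s^i_0=X_i$, $s^i_1,\dots,s^i_{s^i_{-1}-1}\in X^\lambda$, followed by $s^i_{s^i_{-1}}=o$. For each $k\in\{1,\dots,k_{\max}\}$ let $f_k\colon\mathcal M(W)\times W^k\to\mathbb R$ be continuous and bounded from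 below, and let $\eta\colon\mathbb N_0\to\mathbb R$ be bounded from below with $\eta(m)/m\to\infty$ as $m\to\infty$. Put $$m_i(s)=\sum_{j\in I^\lambda}\sum_{l=1}^{s^j_{-1}-1}\mathbf 1\{s^j_l=s^i_0\},\qquad \mathfrak S(s)=\sum_{i\in I^\lambda} f_{s^i_{-1}}\big(L_\lambda,s^i_0,\dots,s^i_{s^i_{-1}-1}\big),\qquad \mathfrak M(s)=\sum_{i\in I^\lambda}\eta(m_i(s)).$$ For $\gamma,\beta\ge0$ let $\mathrm P^{\gamma,\beta}_{\lambda,X^\lambda}$ be the probability measure on configurations $s$ proportional to $$\Big(\prod_{i\in I^\lambda}N(\lambda)^{-(s^i_{-1}-1)}\Big)\,e^{-\gamma\mathfrak S(s)-\beta\mathfrak M(s)};$$ for $\gamma=\beta=0$ it is the normalized a priori measure. Let $S$ denote a configuration with this distribution. Let $$R_{\lambda,k}(s)=\frac1\lambda\sum_{i\in I^\lambda:\,s^i_{-1}=k}\delta_{(s^i_0,\dots,s^i_{k-1})},\qquad P_{\lambda,m}(s)=\frac1\lambda\sum_{i\in I^\lambda:\,m_i(s)=m}\delta_{X_i},$$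 $$\Psi_\lambda(s)=\big((R_{\lambda,k}(s))_{k=1}^{k_{\max}},(P_{\lambda,m}(s))_{m\ge 0}\big)\in\mathcal A:=\Big(\prod_{k=1}^{k_{\max}}\mathcal M(W^k)\Big)\times\mathcal M(W)^{\mathbb N_0},$$ where $\mathcal A$ carries the product topology. *Limiting functionals.* Write $\pi_l\nu_k$, $0\le l\le k-1$, for the marginals of $\nu_k\in\mathcal M(W^k)$. A tuple $\Psi=((\nu_k)_{k},(\mu_m)_{m})\in\mathcal A$ is *admissible* if $$\sum_{k=1}^{k_{\max}}\pi_0\nu_k=\mu,\qquad \sum_{m\ge0}\mu_m=\mu,\qquad M:=\sum_{m\ge0}m\mu_m=\sum_{k=1}^{k_{\max}}\sum_{l=1}^{k-1}\pi_l\nu_k .$$ For finite measures put $\mathcal H(\nu\mid\tilde\nu)=\int\log\frac{d\nu}{d\tilde\nu}\,d\nu-\nu(V)+\tilde\nu(V)$ if $\nu\ll\tilde\nu$, and $+\infty$ otherwise. Let $c_m=e^{-1/(e\mu(W))}(e\mu(W))^{-m}/m!$. For admissible $\Psi$ define $$\mathrm I(\Psi)=\sum_{k=1}^{k_{\max}}\mathcal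 H\big(\nu_k\mid\mu\otimes M^{\otimes(k-1)}\big)+\sum_{m\ge0}\mathcal H(\mu_m\mid c_m\mu)+\mu(W)\Big(1-\sum_{k=1}^{k_{\max}}M(W)^{k-1}\Big)-\frac1e$$ (with the convention $0^0=1$), which takes values in $(-\infty,\infty]$, and $$\mathrm S(\Psi)=\sum_{k=1}^{k_{\max}}\int_{W^k}f_k(\mu,\cdot)\,d\nu_k,\qquad \mathrm M(\Psi)=\sum_{m\ge0}\eta(m)\mu_m(W)\in(-\infty,\infty].$$ Let $J(\Psi)=\mathrm I(\Psi)+\mu(W)\log k_{\max}$ for admissible $\Psi$, and $J(\Psi)=\infty$ for all other $\Psi\in\mathcal A$. *Statement.* Almost surely with respect to $(X^\lambda)_{\lambda>0}$, both of the following hold. (i) As $\lambda\to\infty$, the distribution of $\Psi_\lambda(S)$ under $\mathrm P^{0,0}_{\lambda,X^\lambda}$ satisfies a large deviation principle on $\mathcal A$ with scale $\lambda$ and rate function $J$. That is, $J$ is nonnegative and lower semicontinuous, and for every closed $F\subset\mathcal A$ and every open $G\subset\mathcal A$, $$\limsup_{\lambda\to\infty}\frac1\lambda\log\mathrm P^{0,0}_{\lambda,X^\lambda}(\Psi_\lambda(S)\in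 F)\le-\inf_F J,\qquad \liminf_{\lambda\to\infty}\frac1\lambda\log\mathrm P^{0,0}_{\lambda,X^\lambda}(\Psi_\lambda(S)\in G)\ge-\inf_G J .$$ (ii) For all $\gamma,\beta\in(0,\infty)$, the distribution of $\Psi_\lambda(S)$ under $\mathrm P^{\gamma,\beta}_{\lambda,X^\lambda}$ converges, as $\lambda\to\infty$, towards the set of minimizers of $\mathrm I+\gamma\mathrm S+\beta\mathrm M$ over all admissible $\Psi$: for every open $U\subset\mathcal A$ that contains this set, $\mathrm P^{\gamma,\beta}_{\lambda,X^\lambda}(\Psi_\lambda(S)\notin U)\to0$. -/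

import Mathlib

open MeasureTheory ProbabilityTheory Filter Topology
open scoped NNReal ENNReal

namespace MultihopGibbs

noncomputable section

/-! ### The users -/

/-- `N` is a homogeneous Poisson process on `[0, ∞)` with intensity `r` under `P`: it starts at `0`,
has independent Poisson distributed increments, and almost surely nondecreasing and
right-continuous paths. -/
structure IsPoissonProcess {Ω : Type*} [MeasurableSpace Ω] (P : Measure Ω) (r : ℝ≥0)
    (N : ℝ≥0 → Ω → ℕ) : Prop where
  measurable : ∀ t, Measurable (N t)
  zero : ∀ᵐ ω ∂P, N 0 ω = 0
  indep : HasIndepIncrements N P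
  law : ∀ s t, s ≤ t → P.map (fun ω => N t ω - N s ω) = poissonMeasure (r * (t - s))
  paths : ∀ᵐ ω ∂P, Monotone (fun t => N t ω) ∧
    ∀ t, ContinuousWithinAt (fun s => N s ω) (Set.Ici t) t

/-- The users `X₀, X₁, …, X_{N(λ)-1}`: `N` is a homogeneous Poisson process with intensity `μ(V)`,
and `X` is an independent i.i.d. sequence with law `μ / μ(V)`. In particular
`{X_i : i < N(λ)}` is a Poisson point process with intensity measure `λ μ`. -/
structure IsUserProcess {Ω V : Type*} [MeasurableSpace Ω] [MeasurableSpace V] (P : Measure Ω)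
    (μ : FiniteMeasure V) (N : ℝ≥0 → Ω → ℕ) (X : ℕ → Ω → V) : Prop where
  poisson : IsPoissonProcess P μ.mass N
  measurable : ∀ i, Measurable (X i)
  law : ∀ i, P.map (X i) = ((μ : Measure V) Set.univ)⁻¹ • (μ : Measure V)
  indep : iIndepFun X P
  indep_count : IndepFun (fun ω i => X i ω) (fun ω t => N t ω) P

/-! ### Trajectories

Indices: `k : Fin kmax` stands for trajectories with `k + 1` hops, so that it ranges over the hop
numbers `1, …, kmax`. Such a trajectory visits its starting user, then `k` relays, and then the
base station `o`. Users are labelled by `Fin n`, where `n` is the number of users. -/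

/-- The number of hops minus one, together with the labels of the successive relays. -/
abbrev Trajectory (n kmax : ℕ) : Type := Σ k : Fin kmax, (Fin k → Fin n)

/-- One trajectory for every user. -/
abbrev Config (n kmax : ℕ) : Type := Fin n → Trajectory n kmax

section Model

variable {V : Type*} [TopologicalSpace V] [SecondCountableTopology V] [MeasurableSpace V]
  [BorelSpace V]

/-- The Dirac measure at `x`. -/
def dirac {S : Type*} [MeasurableSpace S] (x : S) : FiniteMeasure S :=
  ⟨Measure.dirac x, inferInstance⟩

/-- The locations `(s₀ⁱ, …, s_{k}ⁱ)` of the starting user `i` and of the `k` relays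
of the trajectory `t`. -/
def path (x : ℕ → V) {n kmax : ℕ} (i : Fin n) (t : Trajectory n kmax) : Fin (t.1 + 1) → V :=
  Fin.cons (x i) (fun l => x (t.2 l))

/-- The normalized empirical measure of the users. -/
def userMeasure (lam : ℝ≥0) (x : ℕ → V) (n : ℕ) : FiniteMeasure V :=
  lam⁻¹ • ∑ i : Fin n, dirac (x i)

/-- The empirical measures of the trajectories with a given number of hops. The `k`-th coordinate
of the `i`-th summand is the Dirac measure at the path of user `i` if this path has `k + 1` hops,
and zero otherwise. -/
def trajMeasure (lam : ℝ≥0) (x : ℕ → V) {n kmax : ℕ} (s : Config n kmax) :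
    ∀ k : Fin kmax, FiniteMeasure (Fin (k + 1) → V) :=
  fun k => lam⁻¹ • ∑ i : Fin n,
    Pi.single (M := fun k : Fin kmax => FiniteMeasure (Fin (k + 1) → V))
      (s i).1 (dirac (path x i (s i))) k

open Classical in
/-- The number `m_i(s)` of incoming hops at the user `i`: the number of pairs of a user `j` and
an index `l` of a relay of its trajectory such that this relay is located at `X_i`. -/
def incoming (x : ℕ → V) {n kmax : ℕ} (s : Config n kmax) (i : Fin n) : ℕ :=
  ∑ j : Fin n, ∑ l : Fin (s j).1, if x ((s j).2 l) = x i then 1 else 0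

open Classical in
/-- The empirical measure of the users that receive exactly `m` incoming hops. -/
def hopMeasure (lam : ℝ≥0) (x : ℕ → V) {n kmax : ℕ} (s : Config n kmax) (m : ℕ) :
    FiniteMeasure V :=
  lam⁻¹ • ∑ i : Fin n, if incoming x s i = m then dirac (x i) else 0

/-- The space of all pairs of a tuple `(ν_k)_k` of measures on `V^k`, `k = 1, …, kmax`, and a
sequence `(μ_m)_m` of measures on `V`, with the product of the topologies of weak convergence. -/
abbrev Setting (V : Type*) [MeasurableSpace V] (kmax : ℕ) : Type _ :=
  (∀ k : Fin kmax, FiniteMeasure (Fin (k + 1) → V)) × (ℕ → FiniteMeasure V)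

/-- The tuple `Ψ_λ(s)` of all empirical measures. -/
def empirical (lam : ℝ≥0) (x : ℕ → V) {n kmax : ℕ} (s : Config n kmax) : Setting V kmax :=
  (trajMeasure lam x s, hopMeasure lam x s)

/-! ### The Gibbs measure -/

/-- The exponent `𝔖(s)`. -/
def interference {kmax : ℕ} (f : ∀ k : Fin kmax, FiniteMeasure V × (Fin (k + 1) → V) → ℝ)
    (lam : ℝ≥0) (x : ℕ → V) {n : ℕ} (s : Config n kmax) : ℝ :=
  ∑ i : Fin n, f (s i).1 (userMeasure lam x n, path x i (s i))

/-- The exponent `𝔐(s)`. -/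
def congestion (η : ℕ → ℝ) (x : ℕ → V) {n kmax : ℕ} (s : Config n kmax) : ℝ :=
  ∑ i : Fin n, η (incoming x s i)

/-- The unnormalized Gibbs weight of a configuration: the a priori weight `∏ᵢ n^{-(kᵢ - 1)}`,
where `kᵢ` is the number of hops of the trajectory of user `i`, times the exponential weight. -/
def gibbsWeight {kmax : ℕ} (f : ∀ k : Fin kmax, FiniteMeasure V × (Fin (k + 1) → V) → ℝ)
    (η : ℕ → ℝ) (γ β : ℝ) (lam : ℝ≥0) (x : ℕ → V) {n : ℕ} (s : Config n kmax) : ℝ :=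
  (∏ i : Fin n, 1 / (n : ℝ) ^ ((s i).1 : ℕ)) *
    Real.exp (-γ * interference f lam x s - β * congestion η x s)

/-- The partition function. -/
def partitionFunction {kmax : ℕ} (f : ∀ k : Fin kmax, FiniteMeasure V × (Fin (k + 1) → V) → ℝ)
    (η : ℕ → ℝ) (γ β : ℝ) (lam : ℝ≥0) (x : ℕ → V) (n : ℕ) : ℝ :=
  ∑ s : Config n kmax, gibbsWeight f η γ β lam x s

open Classical in
/-- The distribution of `Ψ_λ(S)` when `S` has the Gibbs distribution with parameters `γ, β`:
the probability that `Ψ_λ(S)` lies in `B`. -/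
def empiricalLaw {kmax : ℕ} (f : ∀ k : Fin kmax, FiniteMeasure V × (Fin (k + 1) → V) → ℝ)
    (η : ℕ → ℝ) (γ β : ℝ) (lam : ℝ≥0) (x : ℕ → V) (n : ℕ) (B : Set (Setting V kmax)) : ℝ≥0∞ :=
  ENNReal.ofReal (∑ s : Config n kmax, if empirical lam x s ∈ B then
    gibbsWeight f η γ β lam x s / partitionFunction f η γ β lam x n else 0)

/-! ### The limiting objects -/

/-- The measure `M = ∑ₘ m μₘ`. -/
def relayMeasure {kmax : ℕ} (Ψ : Setting V kmax) : Measure V :=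
  Measure.sum fun m : ℕ => (m : ℝ≥0∞) • (Ψ.2 m : Measure V)

/-- Admissible trajectory settings. -/
structure IsAdmissible {kmax : ℕ} (μ : FiniteMeasure V) (Ψ : Setting V kmax) : Prop where
  start : ∑ k : Fin kmax, (Ψ.1 k : Measure (Fin (k + 1) → V)).map (fun y => y 0) = (μ : Measure V)
  users : Measure.sum (fun m : ℕ => (Ψ.2 m : Measure V)) = (μ : Measure V)
  relays : relayMeasure Ψ = ∑ k : Fin kmax, ∑ l : Fin k,
    (Ψ.1 k : Measure (Fin (k + 1) → V)).map (fun y => y l.succ)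

/-- The weights of the Poisson distribution with parameter `1 / (e w)`. -/
def poissonWeight (w : ℝ) (m : ℕ) : ℝ :=
  Real.exp (-(1 / (Real.exp 1 * w))) * (1 / (Real.exp 1 * w)) ^ m / (m.factorial : ℝ)

/-- The measure `μ ⊗ M^{⊗ k}` on `V^{k+1}`. -/
def referenceMeasure {kmax : ℕ} (μ : FiniteMeasure V) (Ψ : Setting V kmax) (k : ℕ) :
    Measure (Fin (k + 1) → V) :=
  Measure.pi (Fin.cons (μ : Measure V) (fun _ => relayMeasure Ψ))

/-- The entropy `I(Ψ)`. Here `InformationTheory.klDiv ν ν'` is `∫ log (dν/dν') dν - ν(V) + ν'(V)`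
if the density exists, and `∞` otherwise. -/
def entropy {kmax : ℕ} (μ : FiniteMeasure V) (Ψ : Setting V kmax) : EReal :=
  ((∑ k : Fin kmax, InformationTheory.klDiv (Ψ.1 k : Measure (Fin (k + 1) → V))
        (referenceMeasure μ Ψ k) : ℝ≥0∞) : EReal)
    + ((∑' m : ℕ, InformationTheory.klDiv (Ψ.2 m : Measure V)
        (ENNReal.ofReal (poissonWeight (μ.mass : ℝ) m) • (μ : Measure V)) : ℝ≥0∞) : EReal)
    + (((μ.mass : ℝ) * (1 - ∑ k : Fin kmax, (relayMeasure Ψ).real Set.univ ^ (k : ℕ))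
        - 1 / Real.exp 1 : ℝ) : EReal)

open Classical in
/-- The rate function `I + μ(V) log kmax`, set to `∞` off the admissible settings. -/
def rate {kmax : ℕ} (μ : FiniteMeasure V) (Ψ : Setting V kmax) : EReal :=
  if IsAdmissible μ Ψ then entropy μ Ψ + (((μ.mass : ℝ) * Real.log kmax : ℝ) : EReal) else ⊤

/-- `S(Ψ) = ∑ₖ ∫ f_k(μ, ·) dν_k`. -/
def limitInterference {kmax : ℕ} (f : ∀ k : Fin kmax, FiniteMeasure V × (Fin (k + 1) → V) → ℝ)
    (μ : FiniteMeasure V) (Ψ : Setting V kmax) : ℝ :=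
  ∑ k : Fin kmax, ∫ y, f k (μ, y) ∂(Ψ.1 k : Measure (Fin (k + 1) → V))

/-- `M(Ψ) = ∑ₘ η(m) μₘ(V)`, written as the sum over the positive parts of `η` minus the sum over
the negative parts. The latter is finite if `η` is bounded from below and `∑ₘ μₘ` is finite. -/
def limitCongestion {kmax : ℕ} (η : ℕ → ℝ) (Ψ : Setting V kmax) : EReal :=
  ((∑' m : ℕ, ENNReal.ofReal (η m) * (Ψ.2 m : Measure V) Set.univ : ℝ≥0∞) : EReal)
    - ((∑' m : ℕ, ENNReal.ofReal (-η m) * (Ψ.2 m : Measure V) Set.univ : ℝ≥0∞) : EReal)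

/-- The functional `I + γ S + β M` of the variational formula. -/
def freeEnergy {kmax : ℕ} (f : ∀ k : Fin kmax, FiniteMeasure V × (Fin (k + 1) → V) → ℝ)
    (η : ℕ → ℝ) (γ β : ℝ) (μ : FiniteMeasure V) (Ψ : Setting V kmax) : EReal :=
  entropy μ Ψ + ((γ * limitInterference f μ Ψ : ℝ) : EReal) + (β : EReal) * limitCongestion η Ψ

/-- The minimizers of `I + γ S + β M` over the admissible trajectory settings. -/
def minimizers {kmax : ℕ} (f : ∀ k : Fin kmax, FiniteMeasure V × (Fin (k + 1) → V) → ℝ)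
    (η : ℕ → ℝ) (γ β : ℝ) (μ : FiniteMeasure V) : Set (Setting V kmax) :=
  {Ψ | IsAdmissible μ Ψ ∧
    ∀ Φ, IsAdmissible μ Φ → freeEnergy f η γ β μ Ψ ≤ freeEnergy f η γ β μ Φ}

end Model

/-! ### Modes of convergence -/

/-- Large deviation principle for `λ → ∞` with scale `λ` and rate function `J`, for the
distributions `Q λ`, where `Q λ B` is the probability of `B`. -/
structure SatisfiesLDP {E : Type*} [TopologicalSpace E] (Q : ℝ≥0 → Set E → ℝ≥0∞)
    (J : E → EReal) : Prop where
  nonneg : ∀ Ψ, 0 ≤ J Ψ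
  lsc : LowerSemicontinuous J
  upper : ∀ F : Set E, IsClosed F →
    limsup (fun lam : ℝ≥0 => ((1 / (lam : ℝ) : ℝ) : EReal) * ENNReal.log (Q lam F)) atTop
      ≤ -(⨅ Ψ ∈ F, J Ψ)
  lower : ∀ G : Set E, IsOpen G →
    -(⨅ Ψ ∈ G, J Ψ)
      ≤ liminf (fun lam : ℝ≥0 => ((1 / (lam : ℝ) : ℝ) : EReal) * ENNReal.log (Q lam G)) atTop

/-- The distributions `Q λ` converge towards the set `A` as `λ → ∞`: for every open neighbourhood
of `A`, the probability of not being in it vanishes. -/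
def ConvergesToSet {E : Type*} [TopologicalSpace E] (Q : ℝ≥0 → Set E → ℝ≥0∞) (A : Set E) : Prop :=
  ∀ U : Set E, IsOpen U → A ⊆ U → Tendsto (fun lam => Q lam Uᶜ) atTop (𝓝 0)

end

end MultihopGibbs

set_option linter.unusedSectionVars false

open MeasureTheory ProbabilityTheory Filter Topology
open scoped NNReal ENNReal

namespace MultihopGibbs

noncomputable section

open Classical in
/-- The labellings `F` that lift `σ` along `c` and take each value `u` exactly `m u` times. -/
def liftsWithFibers {S U A : Type*} [Fintype S] [Fintype U] (σ : S → A) (c : U → A) (m : U → ℕ) :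
    Finset (S → U) :=
  {F | c ∘ F = σ ∧ ∀ u, (Finset.univ.filter fun s => F s = u).card = m u}

open Classical in
theorem liftsWithFibers_nonempty {S U A : Type*} [Fintype S] [Fintype U] (σ : S → A) (c : U → A)
    (m : U → ℕ)
    (h : ∀ a, ∑ u with c u = a, m u = (Finset.univ.filter fun s => σ s = a).card) :
    (liftsWithFibers σ c m).Nonempty := by
  have key : ∀ a, Nonempty ({s // σ s = a} ≃ {y : Σ u, Fin (m u) // c y.1 = a}) := by
    intro a
    refine ⟨Fintype.equivOfCardEq ?_⟩
    rw [Fintype.card_subtype, ← h a, Fintype.card_subtype]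
    have : (Finset.univ.filter fun y : Σ u, Fin (m u) => c y.1 = a) =
        (Finset.univ.filter fun u => c u = a).sigma fun u => (Finset.univ : Finset (Fin (m u))) := by
      ext y; simp
    rw [this, Finset.card_sigma]
    simp
  let E : S ≃ Σ u, Fin (m u) :=
    Equiv.ofFiberEquiv (f := σ) (g := fun y : Σ u, Fin (m u) => c y.1) fun a => (key a).some
  have hE : ∀ s, c (E s).1 = σ s := fun s =>
    Equiv.ofFiberEquiv_map (f := σ) (g := fun y : Σ u, Fin (m u) => c y.1)
      (fun a => (key a).some) s
  refine ⟨fun s => (E s).1, ?_⟩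
  simp only [liftsWithFibers, Finset.mem_filter, Finset.mem_univ, true_and]
  refine ⟨funext hE, fun u => ?_⟩
  have h1 : (Finset.univ.filter fun s => (E s).1 = u).card =
      (Finset.univ.filter fun y : Σ u, Fin (m u) => y.1 = u).card := by
    refine Finset.card_equiv E ?_
    intro s; simp
  have h2 : (Finset.univ.filter fun y : Σ u, Fin (m u) => y.1 = u) =
      ({u} : Finset U).sigma fun u => (Finset.univ : Finset (Fin (m u))) := by
    ext y; simp
  rw [h1, h2, Finset.card_sigma]
  simp

open Classical in
theorem card_liftsWithFibers {S U A : Type*} [Fintype S] [Fintype U] [Fintype A]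
    (σ : S → A) (c : U → A) (m : U → ℕ)
    (h : ∀ a, ∑ u with c u = a, m u = (Finset.univ.filter fun s => σ s = a).card) :
    (liftsWithFibers σ c m).card * ∏ u, (m u).factorial =
      ∏ a, (Finset.univ.filter fun s => σ s = a).card.factorial := by
  obtain ⟨H, hH⟩ := liftsWithFibers_nonempty σ c m h
  have hH' := hH
  simp only [liftsWithFibers, Finset.mem_filter, Finset.mem_univ, true_and] at hH'
  obtain ⟨hσ, hm⟩ := hH'
  have hG := DomMulAct.stabilizer_card σ
  have hS := DomMulAct.stabilizer_card H
  simp only [Fintype.card_subtype, hm] at hG hS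
  rw [← hG, ← hS]
  symm
  rw [Finset.card_eq_sum_card_fiberwise (f := fun π : Equiv.Perm S => H ∘ π)
    (t := liftsWithFibers σ c m)]
  · rw [Finset.sum_const_nat]
    intro F hF
    simp only [liftsWithFibers, Finset.mem_filter, Finset.mem_univ, true_and] at hF
    have : ∀ u, Nonempty ({s // F s = u} ≃ {s // H s = u}) := fun u =>
      ⟨Fintype.equivOfCardEq (by rw [Fintype.card_subtype, Fintype.card_subtype, hm, hF.2])⟩
    let e : Equiv.Perm S := Equiv.ofFiberEquiv (f := F) (g := H) fun u => (this u).some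
    have he : ∀ s, H (e s) = F s := Equiv.ofFiberEquiv_map (f := F) (g := H) _
    refine Finset.card_equiv (Equiv.mulRight e⁻¹) ?_
    intro π
    simp only [Finset.mem_filter, Finset.mem_univ, true_and, Equiv.coe_mulRight, Equiv.Perm.coe_mul]
    constructor
    · rintro ⟨-, h2⟩
      funext s
      have := congrFun h2 (e⁻¹ s)
      simp only [Function.comp_apply] at this ⊢
      rw [this, ← he]; simp
    · intro h2
      have h3 : H ∘ π = F := by
        funext s
        have h4 : H (π (e.symm (e s))) = H (e s) := congrFun h2 (e s)
        rw [e.symm_apply_apply, he] at h4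
        exact h4
      exact ⟨by rw [← hσ, Function.comp_assoc, h3, hF.1, hσ], h3⟩
  · intro π hπ
    simp only [Finset.coe_filter, Finset.mem_univ, true_and, Set.mem_ofPred_eq] at hπ
    simp only [liftsWithFibers, Finset.coe_filter, Finset.mem_univ, true_and, Set.mem_ofPred_eq]
    refine ⟨by rw [← Function.comp_assoc, hσ, hπ], fun u => ?_⟩
    rw [← hm u]
    refine Finset.card_equiv π ?_
    intro s; simp

end

end MultihopGibbs

namespace MultihopGibbs

noncomputable section

/-- The number of hops minus one, together with the labels of the relays. -/
abbrev LabelPath (A : Type*) (kmax : ℕ) : Type _ := Σ k : Fin kmax, (Fin k → A)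

/-- The trajectory obtained by labelling all relays. -/
def relabel {B A : Type*} {kmax : ℕ} (c : B → A) (t : LabelPath B kmax) : LabelPath A kmax :=
  ⟨t.1, c ∘ t.2⟩

open Classical in
/-- The number of relays with a given label. -/
def occ {A : Type*} {kmax : ℕ} (t : LabelPath A kmax) (a : A) : ℕ :=
  (Finset.univ.filter fun l => t.2 l = a).card

/-- The total number of relays with a given label. -/
def hits {B A : Type*} {kmax : ℕ} [Fintype B] (s : B → LabelPath A kmax) (a : A) : ℕ :=
  ∑ j, occ (s j) a

/-- The relay slots of a family of trajectories. -/
abbrev Slot {B A : Type*} {kmax : ℕ} (t : B → LabelPath A kmax) : Type _ := Σ j : B, Fin (t j).1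

/-- The label of a relay slot. -/
def slotLabel {B A : Type*} {kmax : ℕ} (t : B → LabelPath A kmax) (y : Slot t) : A := (t y.1).2 y.2

theorem card_slotLabel {B A : Type*} {kmax : ℕ} [Fintype B] (t : B → LabelPath A kmax) (a : A)
    [DecidablePred fun y => slotLabel t y = a] :
    (Finset.univ.filter fun y => slotLabel t y = a).card = hits t a := by
  rw [Finset.card_filter, Fintype.sum_sigma, hits]
  refine Finset.sum_congr rfl fun j _ => ?_
  rw [occ, Finset.card_filter]
  refine Finset.sum_congr rfl fun l _ => ?_
  by_cases h : (t j).2 l = a <;> simp [h, slotLabel]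

open Classical in
theorem sum_occ {A : Type*} [Fintype A] {kmax : ℕ} (t : LabelPath A kmax) :
    ∑ a, occ t a = t.1 := by
  simp only [occ]
  rw [← Finset.card_eq_sum_card_fiberwise (f := t.2) (t := Finset.univ) (by simp)]
  simp

theorem occ_eq_sum {A : Type*} [DecidableEq A] {kmax : ℕ} (t : LabelPath A kmax) (a : A) :
    occ t a = ∑ l, if t.2 l = a then 1 else 0 := by
  rw [occ, Finset.card_filter]
  exact Finset.sum_congr rfl fun l _ => by congr

theorem occ_relabel {B A : Type*} [Fintype B] [DecidableEq A] {kmax : ℕ} (c : B → A)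
    (t : LabelPath B kmax) (a : A) :
    occ (relabel c t) a = ∑ u with c u = a, occ t u := by
  classical
  simp only [occ_eq_sum]
  rw [Finset.sum_comm]
  refine Finset.sum_congr rfl fun l _ => ?_
  simp [relabel]
  rfl

theorem hits_relabel {B A : Type*} [Fintype B] [DecidableEq A] {kmax : ℕ} (c : B → A)
    (s : B → LabelPath B kmax) (a : A) :
    hits (fun j => relabel c (s j)) a = ∑ u with c u = a, hits s u := by
  simp only [hits, occ_relabel]
  exact Finset.sum_comm

open Classical in
theorem card_relabel_hits {B A : Type*} [Fintype B] [DecidableEq B] [Fintype A] {kmax : ℕ} (c : B → A)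
    (t : B → LabelPath A kmax) (m : B → ℕ) :
    (Finset.univ.filter fun s : B → LabelPath B kmax =>
      (fun j => relabel c (s j)) = t ∧ hits s = m).card = (liftsWithFibers (slotLabel t) c m).card := by
  symm
  refine Finset.card_bij (fun H _ j => ⟨(t j).1, fun l => H ⟨j, l⟩⟩) ?_ ?_ ?_
  · intro H hH
    simp only [liftsWithFibers, Finset.mem_filter, Finset.mem_univ, true_and] at hH ⊢
    constructor
    · funext j
      have : c ∘ (fun l => H ⟨j, l⟩) = (t j).2 := by
        funext l
        exact congrFun hH.1 ⟨j, l⟩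
      simp only [relabel, this]
    · funext u
      refine Eq.trans (card_slotLabel _ u).symm (Eq.trans ?_ (hH.2 u))
      congr!
  · intro H _ H' _ h
    funext y
    have := congrFun h y.1
    simp only [Sigma.mk.injEq, heq_eq_eq, true_and] at this
    exact congrFun this y.2
  · intro s hs
    simp only [Finset.mem_filter, Finset.mem_univ, true_and] at hs
    obtain ⟨rfl, rfl⟩ := hs
    refine ⟨fun y => (s y.1).2 y.2, ?_, rfl⟩
    simp only [liftsWithFibers, Finset.mem_filter, Finset.mem_univ, true_and]
    refine ⟨rfl, fun u => ?_⟩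
    exact card_slotLabel s u

open Classical in
theorem card_relabel_hits_mul {B A : Type*} [Fintype B] [DecidableEq B] [Fintype A] {kmax : ℕ} (c : B → A)
    (t : B → LabelPath A kmax) (m : B → ℕ) (h : ∀ a, ∑ u with c u = a, m u = hits t a) :
    (Finset.univ.filter fun s : B → LabelPath B kmax =>
      (fun j => relabel c (s j)) = t ∧ hits s = m).card * ∏ u, (m u).factorial =
      ∏ a, (hits t a).factorial := by
  rw [card_relabel_hits, card_liftsWithFibers]
  · simp only [card_slotLabel]
  · simpa only [card_slotLabel] using h

open Classical in
theorem card_relabel_hits_mul_le {B A : Type*} [Fintype B] [DecidableEq B] [Fintype A] {kmax : ℕ} (c : B → A)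
    (t : B → LabelPath A kmax) (m : B → ℕ) :
    (Finset.univ.filter fun s : B → LabelPath B kmax =>
      (fun j => relabel c (s j)) = t ∧ hits s = m).card * ∏ u, (m u).factorial ≤
      ∏ a, (hits t a).factorial := by
  by_cases h : ∀ a, ∑ u with c u = a, m u = hits t a
  · exact (card_relabel_hits_mul c t m h).le
  · rw [Finset.card_eq_zero.2]
    · simp
    · rw [Finset.filter_eq_empty_iff]
      rintro s - ⟨rfl, rfl⟩
      exact h fun a => (hits_relabel c s a).symm

/-- The exchangeable coupling of independent labelled trajectories and independent numbers of
incoming hops is a subprobability on configurations. -/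
theorem sum_prod_hits_le_one {B A : Type*} [Fintype B] [Fintype A] {kmax : ℕ} (c : B → A)
    (p : B → LabelPath A kmax → ℝ) (q : B → ℕ → ℝ)
    (hp0 : ∀ j t, 0 ≤ p j t) (hp : ∀ j, ∑ t, p j t ≤ 1)
    (hq0 : ∀ u m, 0 ≤ q u m) (hq : ∀ u M, ∑ m ∈ Finset.range M, q u m ≤ 1)
    [DecidableEq B] :
    ∑ s : B → LabelPath B kmax, (∏ j, p j (relabel c (s j))) *
      (∏ u, q u (hits s u) * (hits s u).factorial) /
        ∏ a, ((hits (fun j => relabel c (s j)) a).factorial : ℝ) ≤ 1 := by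
  classical
  obtain ⟨M, hM⟩ : ∃ M : ℕ, ∀ (s : B → LabelPath B kmax) u, hits s u < M := by
    refine ⟨(Finset.univ.sup fun y : (B → LabelPath B kmax) × B => hits y.1 y.2) + 1,
      fun s u => Nat.lt_succ_of_le ?_⟩
    exact Finset.le_sup (f := fun y : (B → LabelPath B kmax) × B => hits y.1 y.2)
      (Finset.mem_univ (s, u))
  rw [← Finset.sum_fiberwise_of_maps_to (t := (Finset.univ : Finset (B → LabelPath A kmax)) ×ˢ
    Fintype.piFinset fun _ : B => Finset.range M)
    (g := fun s => ((fun j => relabel c (s j)), hits s))]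
  swap
  · intro s _
    simp [hM]
  calc _ ≤ ∑ y ∈ (Finset.univ : Finset (B → LabelPath A kmax)) ×ˢ
        (Fintype.piFinset fun _ : B => Finset.range M), (∏ j, p j (y.1 j)) * ∏ u, q u (y.2 u) := by
        refine Finset.sum_le_sum fun y _ => ?_
        have h0 : 0 < ∏ a, ((hits y.1 a).factorial : ℝ) :=
          Finset.prod_pos fun a _ => by positivity
        rw [Finset.sum_congr rfl (g := fun _ => (∏ j, p j (y.1 j)) *
          (∏ u, q u (y.2 u) * (y.2 u).factorial) / ∏ a, ((hits y.1 a).factorial : ℝ))]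
        · rw [Finset.sum_const, nsmul_eq_mul, Finset.prod_mul_distrib, ← mul_div_assoc,
            div_le_iff₀ h0]
          have := card_relabel_hits_mul_le c y.1 y.2
          have h2 : (((Finset.univ.filter fun s : B → LabelPath B kmax =>
            (fun j => relabel c (s j)) = y.1 ∧ hits s = y.2).card : ℝ) *
            ∏ u, ((y.2 u).factorial : ℝ)) ≤ ∏ a, ((hits y.1 a).factorial : ℝ) := by
            exact_mod_cast this
          have h3 : 0 ≤ (∏ j, p j (y.1 j)) * ∏ u, q u (y.2 u) :=
            mul_nonneg (Finset.prod_nonneg fun j _ => hp0 _ _)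
              (Finset.prod_nonneg fun j _ => hq0 _ _)
          have h4 := mul_le_mul_of_nonneg_left h2 h3
          simp only [Prod.ext_iff] at h4 ⊢
          convert h4 using 1
          ring
        · intro s hs
          simp only [Finset.mem_filter, Finset.mem_univ, true_and] at hs
          rw [← hs]
    _ = (∏ j, ∑ t, p j t) * ∏ u, ∑ m ∈ Finset.range M, q u m := by
        rw [Finset.prod_univ_sum, Finset.prod_univ_sum, Finset.sum_product, Finset.sum_mul_sum,
          Fintype.piFinset_univ]
    _ ≤ 1 := by
        refine mul_le_one₀ (Finset.prod_le_one (fun j _ => Finset.sum_nonneg fun t _ => hp0 _ _)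
          fun j _ => hp j) (Finset.prod_nonneg fun j _ => Finset.sum_nonneg fun t _ => hq0 _ _)
          (Finset.prod_le_one (fun j _ => Finset.sum_nonneg fun t _ => hq0 _ _) fun j _ => hq j _)

end

end MultihopGibbs

namespace MultihopGibbs

noncomputable section

open Classical in
/-- The configurations with prescribed numbers `R` of labelled trajectories and prescribed
numbers `Q` of users with given label and given number of incoming hops. -/
def typeClass {B A : Type*} [Fintype B] [DecidableEq B] {kmax K : ℕ} (c : B → A)
    (R : A × LabelPath A kmax → ℕ) (Q : A × Fin (K + 1) → ℕ) : Finset (B → LabelPath B kmax) :=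
  {s | (∀ y, (Finset.univ.filter fun j => (c j, relabel c (s j)) = y).card = R y) ∧
    (∀ y, (Finset.univ.filter fun u => c u = y.1 ∧ hits s u = y.2).card = Q y) ∧
    ∀ u, hits s u ≤ K}

open Classical in
@[to_additive]
theorem prod_comp_of_card_fiber {B Y M : Type*} [Fintype B] [Fintype Y] [CommMonoid M]
    (F : B → Y) (R : Y → ℕ)
    (h : ∀ y, (Finset.univ.filter fun j => F j = y).card = R y) (g : Y → M) :
    ∏ j, g (F j) = ∏ y, g y ^ R y := by
  rw [← Finset.prod_fiberwise (s := Finset.univ) (g := F)]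
  refine Finset.prod_congr rfl fun y _ => ?_
  rw [Finset.prod_congr rfl (g := fun _ => g y) fun j hj => by
    rw [(Finset.mem_filter.1 hj).2], Finset.prod_const, ← h]

open Classical in
theorem sum_fst_eq {A Y : Type*} [Fintype A] [Fintype Y] (R : A × Y → ℕ) (a : A) :
    ∑ y with Prod.fst y = a, R y = ∑ t, R (a, t) := by
  rw [Finset.sum_filter, Fintype.sum_prod_type]
  rw [Finset.sum_eq_single a]
  · simp
  · intro b _ hb
    simp [hb]
  · simp

open Classical in
theorem card_typeClass {B A : Type*} [Fintype B] [DecidableEq B] [Fintype A] {kmax K : ℕ}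
    (c : B → A) (R : A × LabelPath A kmax → ℕ) (Q : A × Fin (K + 1) → ℕ)
    (hR : ∀ a, ∑ t, R (a, t) = (Finset.univ.filter fun u => c u = a).card)
    (hQ : ∀ a, ∑ m, Q (a, m) = (Finset.univ.filter fun u => c u = a).card)
    (hT : ∀ a, ∑ m, Q (a, m) * (m : ℕ) = ∑ y, R y * occ y.2 a) :
    (∏ a, (Finset.univ.filter fun u => c u = a).card.factorial) *
      (∏ a, (Finset.univ.filter fun u => c u = a).card.factorial) *
      (∏ a, (∑ y, R y * occ y.2 a).factorial) ≤
    (typeClass c R Q).card * (∏ y, (R y).factorial) * (∏ y, (Q y).factorial) *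
      ∏ y : A × Fin (K + 1), (y.2 : ℕ).factorial ^ Q y := by
  have h1 := card_liftsWithFibers c (Prod.fst : A × LabelPath A kmax → A) R (fun a => by
    rw [← hR a, ← sum_fst_eq])
  have h2 := card_liftsWithFibers c (Prod.fst : A × Fin (K + 1) → A) Q (fun a => by
    rw [← hQ a, ← sum_fst_eq])
  set FR := liftsWithFibers c (Prod.fst : A × LabelPath A kmax → A) R
  set FQ := liftsWithFibers c (Prod.fst : A × Fin (K + 1) → A) Q
  let X : (B → A × LabelPath A kmax) × (B → A × Fin (K + 1)) → Finset (B → LabelPath B kmax) :=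
    fun y => Finset.univ.filter fun s =>
      (fun j => relabel c (s j)) = (fun j => (y.1 j).2) ∧ hits s = fun u => ((y.2 u).2 : ℕ)
  have hX : ∀ y ∈ FR ×ˢ FQ, (X y).card * ∏ y : A × Fin (K + 1), (y.2 : ℕ).factorial ^ Q y =
      ∏ a, (∑ y, R y * occ y.2 a).factorial := by
    rintro ⟨F, G⟩ hy
    simp only [FR, FQ, liftsWithFibers, Finset.mem_product, Finset.mem_filter, Finset.mem_univ,
      true_and] at hy
    obtain ⟨⟨hF1, hF2⟩, hG1, hG2⟩ := hy
    have e1 : ∀ a, hits (fun j => (F j).2) a = ∑ y, R y * occ y.2 a := by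
      intro a
      rw [hits, sum_comp_of_card_fiber F R hF2 fun y => occ y.2 a]
      rfl
    have e2 : ∏ u, ((G u).2 : ℕ).factorial = ∏ y : A × Fin (K + 1), (y.2 : ℕ).factorial ^ Q y :=
      prod_comp_of_card_fiber G Q hG2 fun y => (y.2 : ℕ).factorial
    have e3 : ∀ a, ∑ u with c u = a, ((G u).2 : ℕ) = hits (fun j => (F j).2) a := by
      intro a
      rw [e1, ← hT, Finset.sum_filter, ← hG1]
      simp only [Function.comp_apply]
      rw [sum_comp_of_card_fiber G Q hG2 fun y => if y.1 = a then (y.2 : ℕ) else 0,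
        Fintype.sum_prod_type, Finset.sum_eq_single a]
      · simp
      · intro b _ hb
        simp [hb]
      · simp
    have := card_relabel_hits_mul c (fun j => (F j).2) (fun u => ((G u).2 : ℕ)) e3
    rw [e2] at this
    simp only [e1] at this
    exact this
  have hdisj : (↑(FR ×ˢ FQ) : Set _).PairwiseDisjoint X := by
    rintro ⟨F, G⟩ hy ⟨F', G'⟩ hy' hne
    simp only [FR, FQ, liftsWithFibers, Finset.coe_product, Set.mem_prod, Finset.mem_coe,
      Finset.mem_filter, Finset.mem_univ, true_and] at hy hy'
    rw [Function.onFun, Finset.disjoint_left]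
    intro s hs hs'
    simp only [X, Finset.mem_filter, Finset.mem_univ, true_and] at hs hs'
    refine hne (Prod.ext (funext fun j => Prod.ext ?_ ?_) (funext fun j => Prod.ext ?_ ?_))
    · exact (congrFun hy.1.1 j).trans (congrFun hy'.1.1 j).symm
    · exact (congrFun (hs.1.symm.trans hs'.1) j)
    · exact (congrFun hy.2.1 j).trans (congrFun hy'.2.1 j).symm
    · exact Fin.ext (congrFun (hs.2.symm.trans hs'.2) j)
  have hsub : (FR ×ˢ FQ).biUnion X ⊆ typeClass c R Q := by
    intro s hs
    rw [Finset.mem_biUnion] at hs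
    obtain ⟨⟨F, G⟩, hy, hs⟩ := hs
    simp only [FR, FQ, liftsWithFibers, Finset.mem_product, Finset.mem_filter, Finset.mem_univ,
      true_and] at hy
    simp only [X, Finset.mem_filter, Finset.mem_univ, true_and] at hs
    obtain ⟨⟨hF1, hF2⟩, hG1, hG2⟩ := hy
    simp only [typeClass, Finset.mem_filter, Finset.mem_univ, true_and]
    refine ⟨fun y => ?_, fun y => ?_, fun u => ?_⟩
    · have h3 : ∀ j, (c j, relabel c (s j)) = F j := fun j =>
        Prod.ext (congrFun hF1 j).symm (congrFun hs.1 j)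
      simp only [h3]
      convert hF2 y
    · have h3 : ∀ j, (c j = y.1 ∧ hits s j = (y.2 : ℕ)) ↔ G j = y := fun j => by
        rw [← congrFun hG1 j, congrFun hs.2 j]
        simp [Prod.ext_iff, Fin.ext_iff]
      simp only [h3]
      convert hG2 y
    · rw [hs.2]
      exact Nat.lt_succ_iff.1 (G u).2.2
  have hcard := Finset.card_le_card hsub
  rw [Finset.card_biUnion hdisj] at hcard
  calc _ = (FR.card * ∏ y, (R y).factorial) * (FQ.card * ∏ y, (Q y).factorial) *
        (∏ a, (∑ y, R y * occ y.2 a).factorial) := by rw [h1, h2]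
    _ = (∑ y ∈ FR ×ˢ FQ, (X y).card * ∏ y : A × Fin (K + 1), (y.2 : ℕ).factorial ^ Q y) *
        (∏ y, (R y).factorial) * (∏ y, (Q y).factorial) := by
        rw [Finset.sum_congr rfl hX, Finset.sum_const, Finset.card_product, smul_eq_mul]
        ring
    _ ≤ _ := by
        rw [← Finset.sum_mul]
        calc _ = (∑ y ∈ FR ×ˢ FQ, (X y).card) * ((∏ y, (R y).factorial) * (∏ y, (Q y).factorial) *
              ∏ y : A × Fin (K + 1), (y.2 : ℕ).factorial ^ Q y) := by ring
          _ ≤ (typeClass c R Q).card * ((∏ y, (R y).factorial) * (∏ y, (Q y).factorial) *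
              ∏ y : A × Fin (K + 1), (y.2 : ℕ).factorial ^ Q y) := Nat.mul_le_mul_right _ hcard
          _ = _ := by ring

end

end MultihopGibbs

namespace MultihopGibbs

noncomputable section

open Classical in
/-- The normalized a priori probability of a set of configurations. -/
def prior {n kmax : ℕ} (B : Set (Config n kmax)) : ℝ :=
  ∑ s : Config n kmax with s ∈ B, ∏ i, 1 / ((kmax : ℝ) * (n : ℝ) ^ ((s i).1 : ℕ))

/-- The total number of relays. -/
def relayCount {B A : Type*} {kmax : ℕ} [Fintype B] (s : B → LabelPath A kmax) : ℕ :=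
  ∑ j, ((s j).1 : ℕ)

theorem prod_prior_weight {n kmax : ℕ} (hk : 1 ≤ kmax) (s : Config n kmax) :
    ∏ i, 1 / ((kmax : ℝ) * (n : ℝ) ^ ((s i).1 : ℕ)) =
      Real.exp (-(n * Real.log kmax) - relayCount s * Real.log n) := by
  rcases Nat.eq_zero_or_pos n with rfl | hn
  · simp [relayCount]
  have hk' : (0 : ℝ) < kmax := by exact_mod_cast hk
  have hn' : (0 : ℝ) < n := by exact_mod_cast hn
  have : ∀ i : Fin n, 1 / ((kmax : ℝ) * (n : ℝ) ^ ((s i).1 : ℕ)) =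
      Real.exp (-Real.log kmax - ((s i).1 : ℕ) * Real.log n) := by
    intro i
    rw [Real.exp_sub, Real.exp_neg, Real.exp_log hk', Real.exp_nat_mul, Real.exp_log hn',
      one_div, mul_inv, div_eq_mul_inv]
  rw [Finset.prod_congr rfl fun i _ => this i, ← Real.exp_sum, Finset.sum_sub_distrib,
    ← Finset.sum_mul, relayCount]
  simp

theorem sum_hits {B A : Type*} [Fintype B] [Fintype A] {kmax : ℕ} (s : B → LabelPath A kmax) :
    ∑ a, hits s a = relayCount s := by
  simp only [hits, relayCount]
  rw [Finset.sum_comm]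
  exact Finset.sum_congr rfl fun j _ => sum_occ _

theorem sum_occ_mul {A : Type*} [Fintype A] {kmax : ℕ} (t : LabelPath A kmax) (r : A → ℝ) :
    ∑ a, (occ t a : ℝ) * r a = ∑ l, r (t.2 l) := by
  classical
  simp only [occ_eq_sum, Nat.cast_sum, Nat.cast_ite, Nat.cast_one, Nat.cast_zero, Finset.sum_mul]
  rw [Finset.sum_comm]
  exact Finset.sum_congr rfl fun l _ => by simp

theorem poissonWeight_pos {w : ℝ} (hw : 0 < w) (m : ℕ) : 0 < poissonWeight w m := by
  unfold poissonWeight; positivity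

theorem poissonWeight_mul_factorial {w : ℝ} (hw : 0 < w) (m : ℕ) :
    poissonWeight w m * m.factorial =
      Real.exp (-(1 / (Real.exp 1 * w)) - m * Real.log (Real.exp 1 * w)) := by
  unfold poissonWeight
  have : (m.factorial : ℝ) ≠ 0 := by positivity
  rw [div_mul_cancel₀ _ this, sub_eq_add_neg, Real.exp_add, one_div, inv_pow, Real.exp_neg (_ * _),
    Real.exp_nat_mul, Real.exp_log (by positivity)]

theorem hasSum_poissonWeight (w : ℝ) : HasSum (poissonWeight w) 1 := by
  unfold poissonWeight
  have := (NormedSpace.expSeries_div_hasSum_exp (𝔸 := ℝ) (1 / (Real.exp 1 * w))).mul_left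
    (Real.exp (-(1 / (Real.exp 1 * w))))
  rw [← Real.exp_eq_exp_ℝ, ← Real.exp_add] at this
  simpa [mul_div_assoc] using this

/-- The normalization of the trajectory weights. -/
def trajNorm {A : Type*} [Fintype A] {kmax : ℕ} (g : A → LabelPath A kmax → ℝ) (ρ : A → ℝ)
    (a : A) : ℝ :=
  ∑ t, Real.exp (g a t) * ∏ l, ρ (t.2 l)

/-- The normalization of the weights of the numbers of incoming hops. -/
def hopNorm {A : Type*} (w : ℝ) (h : A → ℕ → ℝ) (a : A) : ℝ :=
  ∑' m, poissonWeight w m * Real.exp (h a m)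

/-- The exponent in the exponential Chebyshev inequality `prior_le_exp`. -/
def tiltExponent {A : Type*} [Fintype A] {n kmax : ℕ} (c : Fin n → A)
    (g : A → LabelPath A kmax → ℝ) (ρ : A → ℝ) (w : ℝ) (h : A → ℕ → ℝ) (s : Config n kmax) : ℝ :=
  (∑ j, g (c j) (relabel c (s j)) - ∑ j, (trajNorm g ρ (c j) - 1))
    + (∑ u, h (c u) (hits s u) - ∑ u, (hopNorm w h (c u) - 1))
    + ∑ a, ((hits (fun j => relabel c (s j)) a : ℝ) * Real.log (ρ a)
        - Real.log ((hits (fun j => relabel c (s j)) a).factorial))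
    - n / (Real.exp 1 * w) - relayCount s * Real.log (Real.exp 1 * w)
    + relayCount s * Real.log n + n * Real.log kmax

theorem prior_le_exp {A : Type*} [Fintype A] {n kmax : ℕ} (hk : 1 ≤ kmax) (c : Fin n → A)
    (g : A → LabelPath A kmax → ℝ) (ρ : A → ℝ) (hρ : ∀ a, 0 < ρ a) {w : ℝ} (hw : 0 < w)
    (h : A → ℕ → ℝ) (hh : ∀ a, Summable fun m => poissonWeight w m * Real.exp (h a m))
    (B : Set (Config n kmax)) (E : ℝ) (hE : ∀ s ∈ B, E ≤ tiltExponent c g ρ w h s) :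
    prior B ≤ Real.exp (-E) := by
  classical
  have hZ : ∀ a, 0 < trajNorm g ρ a := by
    intro a
    have : Nonempty (LabelPath A kmax) := ⟨⟨⟨0, hk⟩, fun l => l.elim0⟩⟩
    exact Finset.sum_pos (fun t _ => mul_pos (Real.exp_pos _) (Finset.prod_pos fun l _ => hρ _))
      Finset.univ_nonempty
  have hY : ∀ a, 0 < hopNorm w h a := by
    intro a
    exact (hh a).tsum_pos (fun m => (mul_pos (poissonWeight_pos hw m) (Real.exp_pos _)).le) 0
      (mul_pos (poissonWeight_pos hw 0) (Real.exp_pos _))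
  let p : Fin n → LabelPath A kmax → ℝ := fun j t =>
    Real.exp (g (c j) t) * (∏ l, ρ (t.2 l)) / trajNorm g ρ (c j)
  let q : Fin n → ℕ → ℝ := fun u m =>
    poissonWeight w m * Real.exp (h (c u) m) / hopNorm w h (c u)
  have hQ := sum_prod_hits_le_one (kmax := kmax) c p q
    (fun j t => div_nonneg (mul_nonneg (Real.exp_pos _).le
      (Finset.prod_nonneg fun l _ => (hρ _).le)) (hZ _).le)
    (fun j => by
      simp only [p]
      rw [← Finset.sum_div]
      exact (div_self (hZ _).ne').le)
    (fun u m => div_nonneg (mul_pos (poissonWeight_pos hw m) (Real.exp_pos _)).le (hY _).le)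
    (fun u M => by
      simp only [q]
      rw [← Finset.sum_div, div_le_one (hY _)]
      exact (hh (c u)).sum_le_tsum _ fun m _ =>
        (mul_pos (poissonWeight_pos hw m) (Real.exp_pos _)).le)
  have hp : ∀ j t, Real.exp (g (c j) t + ∑ a, (occ t a : ℝ) * Real.log (ρ a)
      - (trajNorm g ρ (c j) - 1)) ≤ p j t := by
    intro j t
    simp only [p]
    rw [Real.exp_sub, Real.exp_add, sum_occ_mul, Real.exp_sum]
    simp only [Real.exp_log (hρ _)]
    refine div_le_div_of_nonneg_left ?_ (hZ _) ?_
    · exact mul_nonneg (Real.exp_pos _).le (Finset.prod_nonneg fun l _ => (hρ _).le)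
    · have := Real.add_one_le_exp (trajNorm g ρ (c j) - 1)
      linarith
  have hq : ∀ u (m : ℕ), Real.exp (h (c u) m - (hopNorm w h (c u) - 1) - 1 / (Real.exp 1 * w)
      - m * Real.log (Real.exp 1 * w)) ≤ q u m * m.factorial := by
    intro u m
    simp only [q]
    have h1 : poissonWeight w m * Real.exp (h (c u) m) / hopNorm w h (c u) * m.factorial =
        (poissonWeight w m * m.factorial) * (Real.exp (h (c u) m) / hopNorm w h (c u)) := by ring
    rw [h1, poissonWeight_mul_factorial hw]
    have h2 : Real.exp (h (c u) m - (hopNorm w h (c u) - 1) - 1 / (Real.exp 1 * w)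
      - m * Real.log (Real.exp 1 * w)) =
      Real.exp (-(1 / (Real.exp 1 * w)) - m * Real.log (Real.exp 1 * w)) *
        (Real.exp (h (c u) m) / Real.exp (hopNorm w h (c u) - 1)) := by
      rw [← Real.exp_sub, ← Real.exp_add]
      congr 1; ring
    rw [h2]
    refine mul_le_mul_of_nonneg_left ?_ (Real.exp_pos _).le
    refine div_le_div_of_nonneg_left (Real.exp_pos _).le (hY _) ?_
    have := Real.add_one_le_exp (hopNorm w h (c u) - 1)
    linarith
  have key : ∀ s ∈ B, ∏ i, 1 / ((kmax : ℝ) * (n : ℝ) ^ ((s i).1 : ℕ)) ≤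
      Real.exp (-E) * ((∏ j, p j (relabel c (s j))) *
      (∏ u, q u (hits s u) * (hits s u).factorial) /
        ∏ a, ((hits (fun j => relabel c (s j)) a).factorial : ℝ)) := by
    intro s hs
    have e2 : ∏ a, ((hits (fun j => relabel c (s j)) a).factorial : ℝ) =
        Real.exp (∑ a, Real.log ((hits (fun j => relabel c (s j)) a).factorial)) := by
      rw [Real.exp_sum]
      exact Finset.prod_congr rfl fun a _ => (Real.exp_log (by positivity)).symm
    have e3 := Finset.prod_le_prod (s := Finset.univ) (fun j _ => (Real.exp_pos _).le)
      fun j _ => hp j (relabel c (s j))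
    have e4 := Finset.prod_le_prod (s := Finset.univ) (fun u _ => (Real.exp_pos _).le)
      fun u _ => hq u (hits s u)
    rw [← Real.exp_sum] at e3 e4
    rw [prod_prior_weight hk s, e2]
    have e5 := mul_le_mul e3 e4 (Real.exp_pos _).le
      (Finset.prod_nonneg fun j _ => div_nonneg (mul_nonneg (Real.exp_pos _).le
      (Finset.prod_nonneg fun l _ => (hρ _).le)) (hZ _).le)
    rw [← Real.exp_add] at e5
    refine le_trans ?_ (mul_le_mul_of_nonneg_left
      (div_le_div_of_nonneg_right e5 (Real.exp_pos _).le) (Real.exp_pos _).le)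
    rw [← Real.exp_sub, ← Real.exp_add, Real.exp_le_exp]
    have h1 := hE s hs
    have h2 : ∑ u, (hits s u : ℝ) = relayCount s := by exact_mod_cast sum_hits s
    have h3 : ∑ j, ∑ a, (occ (relabel c (s j)) a : ℝ) * Real.log (ρ a) =
        ∑ a, (hits (fun j => relabel c (s j)) a : ℝ) * Real.log (ρ a) := by
      rw [Finset.sum_comm]
      refine Finset.sum_congr rfl fun a _ => ?_
      rw [← Finset.sum_mul]
      simp [hits]
    unfold tiltExponent at h1
    simp only [Finset.sum_sub_distrib, Finset.sum_add_distrib, ← Finset.sum_mul, h2, h3] at h1 ⊢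
    simp only [Finset.sum_const, Finset.card_univ, Fintype.card_fin, nsmul_eq_mul] at h1 ⊢
    have h4 : (n : ℝ) * (1 / (Real.exp 1 * w)) = n / (Real.exp 1 * w) := by ring
    rw [h4]
    linarith
  calc prior B ≤ ∑ s : Config n kmax with s ∈ B, Real.exp (-E) * ((∏ j, p j (relabel c (s j))) *
      (∏ u, q u (hits s u) * (hits s u).factorial) /
        ∏ a, ((hits (fun j => relabel c (s j)) a).factorial : ℝ)) := by
        unfold prior
        refine (Finset.sum_le_sum fun s hs => key s (Finset.mem_filter.1 hs).2).trans_eq ?_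
        congr!
    _ ≤ ∑ s : Config n kmax, Real.exp (-E) * ((∏ j, p j (relabel c (s j))) *
      (∏ u, q u (hits s u) * (hits s u).factorial) /
        ∏ a, ((hits (fun j => relabel c (s j)) a).factorial : ℝ)) := by
        refine Finset.sum_le_sum_of_subset_of_nonneg (Finset.filter_subset _ _) fun s _ _ => ?_
        refine mul_nonneg (Real.exp_pos _).le (div_nonneg (mul_nonneg ?_ ?_) ?_)
        · exact Finset.prod_nonneg fun j _ => (Real.exp_pos _).le.trans (hp j _)
        · exact Finset.prod_nonneg fun u _ => (Real.exp_pos _).le.trans (hq u _)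
        · positivity
    _ ≤ Real.exp (-E) := by
        rw [← Finset.mul_sum]
        refine mul_le_of_le_one_right (Real.exp_pos _).le (le_trans (le_of_eq ?_) hQ)
        rfl

/-! ### Factorials -/

theorem log_factorial_ge (N : ℕ) : N * Real.log N - N ≤ Real.log N.factorial := by
  rcases Nat.eq_zero_or_pos N with rfl | hN
  · simp
  have hN' : (0 : ℝ) < N := by exact_mod_cast hN
  have h := Real.pow_div_factorial_le_exp (N : ℝ) hN'.le N
  have hf : (0 : ℝ) < N.factorial := by positivity
  have := Real.log_le_log (by positivity) h
  rw [Real.log_exp, Real.log_div (by positivity) hf.ne', Real.log_pow] at this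
  linarith

theorem log_factorial_le (N : ℕ) :
    Real.log N.factorial ≤ N * Real.log N - N + 2 * Real.log (N + 1) + 1 := by
  induction N with
  | zero => simp
  | succ N ih =>
    rw [Nat.factorial_succ, Nat.cast_mul, Real.log_mul (by positivity) (by positivity)]
    rcases Nat.eq_zero_or_pos N with rfl | hN
    · simp only [Nat.factorial, zero_add, Nat.cast_one, Real.log_one]
      have : 0 ≤ Real.log (1 + 1) := Real.log_nonneg (by norm_num)
      linarith
    have hN' : (0 : ℝ) < N := by exact_mod_cast hN
    push_cast at ih ⊢
    have h1 : 1 / ((N : ℝ) + 1) ≤ Real.log (N + 1) - Real.log N := by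
      rw [← Real.log_div (by positivity) (by positivity)]
      have := Real.one_sub_inv_le_log_of_pos (x := ((N : ℝ) + 1) / N) (by positivity)
      refine le_trans (le_of_eq ?_) this
      field_simp
      ring
    have h2 : 1 / ((N : ℝ) + 1 + 1) ≤ Real.log (N + 1 + 1) - Real.log (N + 1) := by
      rw [← Real.log_div (by positivity) (by positivity)]
      have := Real.one_sub_inv_le_log_of_pos (x := ((N : ℝ) + 1 + 1) / (N + 1)) (by positivity)
      refine le_trans (le_of_eq ?_) this
      field_simp
      ring
    have h3 := mul_le_mul_of_nonneg_left h1 hN'.le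
    have h4 : 1 ≤ (N : ℝ) * (1 / (N + 1)) + 2 * (1 / (N + 1 + 1)) := by
      rw [mul_one_div, mul_one_div, div_add_div _ _ (by positivity) (by positivity),
        le_div_iff₀ (by positivity)]
      nlinarith
    linarith

/-- `log N! ~ N log λ + λ (t log t - t)` if `N ~ λ t`. -/
theorem tendsto_log_factorial {ι : Type*} {l : Filter ι} {lam : ι → ℝ} (hlam : Tendsto lam l atTop)
    {N : ι → ℕ} {t : ℝ} (hN : Tendsto (fun i => (N i : ℝ) / lam i) l (𝓝 t)) :
    Tendsto (fun i => (Real.log (N i).factorial - N i * Real.log (lam i)) / lam i) l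
      (𝓝 (t * Real.log t - t)) := by
  have hlog : Tendsto (fun i => (2 * Real.log (N i + 1) + 1) / lam i) l (𝓝 0) := by
    have h1 : Tendsto (fun i => 4 * (√(N i / lam i + 1 / lam i) * √(1 / lam i)) + 1 / lam i) l
        (𝓝 (4 * (√(t + 0) * √0) + 0)) := by
      have h0 : Tendsto (fun i => 1 / lam i) l (𝓝 0) := by
        simpa [Function.comp_def] using tendsto_inv_atTop_zero.comp hlam
      exact ((((Real.continuous_sqrt.tendsto _).comp (hN.add h0)).mul
        ((Real.continuous_sqrt.tendsto _).comp h0)).const_mul 4).add h0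
    simp only [Real.sqrt_zero, mul_zero, add_zero] at h1
    refine squeeze_zero' ?_ ?_ h1
    · filter_upwards [hlam.eventually_gt_atTop 0] with i hi
      have : 0 ≤ Real.log ((N i : ℝ) + 1) := Real.log_nonneg (by simp)
      positivity
    · filter_upwards [hlam.eventually_gt_atTop 0] with i hi
      have hx : (0 : ℝ) < N i + 1 := by positivity
      have h2 := Real.log_le_self (Real.sqrt_nonneg ((N i : ℝ) + 1))
      rw [Real.log_sqrt hx.le] at h2
      have h3 : √(N i / lam i + 1 / lam i) * √(1 / lam i) = √(N i + 1) / lam i := by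
        rw [← Real.sqrt_mul (by positivity), ← add_div, div_mul_div_comm, mul_one,
          Real.sqrt_div hx.le, Real.sqrt_mul_self hi.le]
      rw [h3, add_div]
      refine add_le_add ?_ le_rfl
      rw [← mul_div_assoc]
      exact div_le_div_of_nonneg_right (by linarith) hi.le
  have hmain : Tendsto (fun i => (N i : ℝ) / lam i * Real.log (N i / lam i) - N i / lam i) l
      (𝓝 (t * Real.log t - t)) :=
    ((Real.continuous_mul_log.tendsto t).comp hN).sub hN
  have hsum := hmain.add hlog
  rw [add_zero] at hsum
  have hid : ∀ᶠ i in l, (N i * Real.log (N i) - N i - N i * Real.log (lam i)) / lam i =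
      (N i : ℝ) / lam i * Real.log (N i / lam i) - N i / lam i := by
    filter_upwards [hlam.eventually_gt_atTop 0] with i hi
    rcases Nat.eq_zero_or_pos (N i) with h0 | h0
    · simp [h0]
    · have : (0 : ℝ) < N i := by exact_mod_cast h0
      rw [Real.log_div this.ne' hi.ne']
      field_simp
      ring
  refine tendsto_of_tendsto_of_tendsto_of_le_of_le' hmain hsum ?_ ?_
  · filter_upwards [hid, hlam.eventually_gt_atTop 0] with i h1 hi
    rw [← h1]
    have := log_factorial_ge (N i)
    gcongr
  · filter_upwards [hid, hlam.eventually_gt_atTop 0] with i h1 hi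
    rw [← h1, ← add_div]
    have := log_factorial_le (N i)
    gcongr
    linarith

end

end MultihopGibbs

namespace MultihopGibbs

noncomputable section

open InformationTheory BoundedContinuousFunction

/-! ### The variational formula for the relative entropy -/

theorem exists_measurable_lt_of_lt_klDiv {X : Type*} [MeasurableSpace X] (ν ρ : Measure X)
    [IsFiniteMeasure ν] [IsFiniteMeasure ρ] {a : ℝ} (ha : ENNReal.ofReal a < klDiv ν ρ) :
    ∃ (g : X → ℝ) (L : ℝ), Measurable g ∧ (∀ x, |g x| ≤ L) ∧
      a < ∫ x, g x ∂ν - ∫ x, (Real.exp (g x) - 1) ∂ρ := by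
  by_cases hac : ν ≪ ρ
  swap
  · obtain ⟨A, hA, hρA, hνA⟩ : ∃ A, MeasurableSet A ∧ ρ A = 0 ∧ ν A ≠ 0 := by
      by_contra! h
      exact hac (Measure.AbsolutelyContinuous.mk fun s hs h0 => h s hs h0)
    have hpos : 0 < ν.real A := by
      rw [Measure.real, ENNReal.toReal_pos_iff]
      exact ⟨pos_iff_ne_zero.2 hνA, measure_lt_top _ _⟩
    refine ⟨A.indicator fun _ => (|a| + 1) / ν.real A, (|a| + 1) / ν.real A,
      measurable_const.indicator hA, fun x => ?_, ?_⟩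
    · by_cases hx : x ∈ A
      · rw [Set.indicator_of_mem hx, abs_of_nonneg (by positivity)]
      · rw [Set.indicator_of_notMem hx, abs_zero]
        positivity
    · have h0 : ∫ x, (Real.exp (A.indicator (fun _ => (|a| + 1) / ν.real A) x) - 1) ∂ρ = 0 := by
        refine integral_eq_zero_of_ae ?_
        have : ∀ᵐ x ∂ρ, x ∉ A := by
          rw [ae_iff]; simpa using hρA
        filter_upwards [this] with x hx
        simp [hx]
      rw [h0, integral_indicator_const _ hA, smul_eq_mul, mul_div_cancel₀ _ hpos.ne', sub_zero]
      linarith [le_abs_self a]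
  · let f : X → ℝ := fun x => (ν.rnDeriv ρ x).toReal
    have hf0 : ∀ x, 0 ≤ f x := fun x => ENNReal.toReal_nonneg
    have hfm : Measurable f := (Measure.measurable_rnDeriv ν ρ).ennreal_toReal
    let u : ℕ → X → ℝ := fun n x => max (1 / ((n : ℝ) + 1)) (min (f x) (n + 1))
    have hu0 : ∀ n x, 0 < u n x := fun n x => lt_max_of_lt_left (by positivity)
    have hum : ∀ n, Measurable (u n) := fun n =>
      measurable_const.max (hfm.min measurable_const)
    let φ : ℕ → X → ℝ := fun n x => f x * Real.log (u n x) - u n x + 1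
    have hφm : ∀ n, Measurable (φ n) := fun n =>
      ((hfm.mul (hum n).log).sub (hum n)).add measurable_const
    have hφ0 : ∀ n x, 0 ≤ φ n x := by
      intro n x
      have hn1 : (1 : ℝ) / ((n : ℝ) + 1) ≤ 1 := by
        rw [div_le_one (by positivity)]; simp
      have hkl := klFun_nonneg (hu0 n x).le
      rw [klFun_apply] at hkl
      simp only [φ]
      rcases le_total 1 (f x) with h1 | h1
      · have h2 : 1 ≤ u n x := le_max_of_le_right (le_min h1 (by simp))
        have h3 : u n x ≤ f x := max_le (hn1.trans h1) (min_le_left _ _)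
        have := mul_le_mul_of_nonneg_right h3 (Real.log_nonneg h2)
        linarith
      · have h2 : u n x ≤ 1 := max_le hn1 ((min_le_left _ _).trans h1)
        have h3 : f x ≤ u n x := by
          refine le_max_of_le_right (le_min le_rfl (h1.trans (by simp)))
        have := mul_le_mul_of_nonpos_right h3 (Real.log_nonpos (hu0 n x).le h2)
        linarith
    have hn0 : Tendsto (fun n : ℕ => (1 : ℝ) / ((n : ℝ) + 1)) atTop (𝓝 0) :=
      tendsto_one_div_add_atTop_nhds_zero_nat
    have hlim : ∀ x, Tendsto (fun n => φ n x) atTop (𝓝 (klFun (f x))) := by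
      intro x
      rw [klFun_apply]
      have hbig : ∀ᶠ n : ℕ in atTop, f x ≤ (n : ℝ) + 1 := by
        obtain ⟨N, hN⟩ := exists_nat_ge (f x)
        filter_upwards [eventually_ge_atTop N] with n hn
        have : (N : ℝ) ≤ n := by exact_mod_cast hn
        linarith
      rcases (hf0 x).eq_or_lt with h0 | h0
      · have : ∀ n, φ n x = 1 - 1 / ((n : ℝ) + 1) := by
          intro n
          have : u n x = 1 / ((n : ℝ) + 1) := by
            simp only [u, ← h0]
            rw [min_eq_left (by positivity), max_eq_left (by positivity)]
          simp only [φ, this, ← h0]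
          ring
        simp only [this, ← h0]
        simpa using (tendsto_const_nhds (x := (1 : ℝ))).sub hn0
      · refine tendsto_const_nhds.congr' ?_
        filter_upwards [hbig, hn0.eventually_le_const h0] with n h1 h2
        have : u n x = f x := by
          simp only [u]
          rw [min_eq_left h1, max_eq_right h2]
        simp only [φ, this]
        ring
    have hfatou : klDiv ν ρ ≤ liminf (fun n => ∫⁻ x, ENNReal.ofReal (φ n x) ∂ρ) atTop := by
      rw [klDiv_eq_lintegral_klFun_of_ac hac]
      refine le_trans (le_of_eq ?_) (lintegral_liminf_le fun n => (hφm n).ennreal_ofReal)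
      refine lintegral_congr fun x => ?_
      exact ((ENNReal.continuous_ofReal.tendsto _).comp (hlim x)).liminf_eq.symm
    obtain ⟨n, hn⟩ := (eventually_lt_of_lt_liminf (lt_of_lt_of_le ha hfatou)).exists
    have hgb : ∀ x, |Real.log (u n x)| ≤ Real.log ((n : ℝ) + 1) := by
      intro x
      rw [abs_le]
      constructor
      · rw [← Real.log_inv, ← one_div]
        exact Real.log_le_log (by positivity) (le_max_left _ _)
      · refine Real.log_le_log (hu0 n x) (max_le ?_ (min_le_right _ _))
        rw [div_le_iff₀ (by positivity)]
        nlinarith [(Nat.cast_nonneg n : (0 : ℝ) ≤ n)]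
    refine ⟨fun x => Real.log (u n x), Real.log (n + 1), (hum n).log, hgb, ?_⟩
    have hub : ∀ x, |u n x| ≤ (n : ℝ) + 1 := by
      intro x
      rw [abs_of_pos (hu0 n x)]
      refine max_le ?_ (min_le_right _ _)
      rw [div_le_iff₀ (by positivity)]
      nlinarith [(Nat.cast_nonneg n : (0 : ℝ) ≤ n)]
    have hui : Integrable (u n) ρ :=
      Integrable.of_bound (hum n).aestronglyMeasurable ((n : ℝ) + 1) (ae_of_all _ hub)
    have hfi : Integrable f ρ := Measure.integrable_toReal_rnDeriv
    have hfgi : Integrable (fun x => f x * Real.log (u n x)) ρ :=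
      hfi.mul_bdd (c := Real.log (n + 1)) (hum n).log.aestronglyMeasurable (ae_of_all _ hgb)
    have hint : ∫ x, Real.log (u n x) ∂ν = ∫ x, f x * Real.log (u n x) ∂ρ := by
      rw [← integral_rnDeriv_smul hac]
      rfl
    have hexp : ∀ x, Real.exp (Real.log (u n x)) - 1 = u n x - 1 := fun x => by
      rw [Real.exp_log (hu0 n x)]
    simp only [hexp]
    have hui1 : Integrable (fun x => u n x - 1) ρ := hui.sub (integrable_const 1)
    rw [hint, ← integral_sub hfgi hui1]
    have : ∀ x, f x * Real.log (u n x) - (u n x - 1) = φ n x := fun x => by simp only [φ]; ring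
    simp only [this]
    rw [← ofReal_integral_eq_lintegral_ofReal] at hn
    · exact lt_of_not_ge fun h => hn.not_ge (ENNReal.ofReal_le_ofReal h)
    · exact (hfgi.sub hui1).congr (ae_of_all _ this)
    · exact ae_of_all _ (hφ0 n)

theorem exists_continuous_lt_of_lt_klDiv {X : Type*} [TopologicalSpace X] [NormalSpace X]
    [MeasurableSpace X] [BorelSpace X] (ν ρ : Measure X)
    [IsFiniteMeasure ν] [IsFiniteMeasure ρ] [(ν + ρ).WeaklyRegular] {a : ℝ}
    (ha : ENNReal.ofReal a < klDiv ν ρ) :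
    ∃ g : X →ᵇ ℝ, a < ∫ x, g x ∂ν - ∫ x, (Real.exp (g x) - 1) ∂ρ := by
  obtain ⟨g, L, hgm, hgL, hg⟩ := exists_measurable_lt_of_lt_klDiv ν ρ ha
  set δ := ∫ x, g x ∂ν - ∫ x, (Real.exp (g x) - 1) ∂ρ - a with hδ
  have hδ0 : 0 < δ := by linarith
  have hgi : Integrable g (ν + ρ) :=
    Integrable.of_bound hgm.aestronglyMeasurable L (ae_of_all _ hgL)
  obtain ⟨u, hu, -⟩ := hgi.exists_boundedContinuous_integral_sub_le
    (ε := δ / (2 * (1 + Real.exp L))) (by positivity)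
  let v : X →ᵇ ℝ := BoundedContinuousFunction.ofNormedAddCommGroup
    (fun x => max (-L) (min (u x) L)) (by fun_prop) |L| (fun x => by
      rw [Real.norm_eq_abs, abs_le]
      exact ⟨le_max_of_le_left (neg_le_neg (le_abs_self L)),
        max_le (neg_le_abs L) ((min_le_right _ _).trans (le_abs_self L))⟩)
  have hv : ∀ x, v x = max (-L) (min (u x) L) := fun x => rfl
  have hL : ∀ x, -L ≤ g x ∧ g x ≤ L := fun x => abs_le.1 (hgL x)
  have hvL : ∀ x, v x ≤ L := fun x => by
    rw [hv]
    exact max_le (by linarith [hL x]) (min_le_right _ _)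
  have hvg : ∀ x, |g x - v x| ≤ ‖g x - u x‖ := by
    intro x
    rw [hv, Real.norm_eq_abs]
    have h1 := hL x
    have : g x = max (-L) (min (g x) L) := by
      rw [min_eq_left h1.2, max_eq_right h1.1]
    calc |g x - max (-L) (min (u x) L)| = |max (-L) (min (g x) L) - max (-L) (min (u x) L)| := by
          rw [← this]
      _ ≤ |min (g x) L - min (u x) L| := by
          simpa using abs_max_sub_max_le_max (-L) (min (g x) L) (-L) (min (u x) L)
      _ ≤ |g x - u x| := by
          simpa using abs_min_sub_min_le_max (g x) L (u x) L
  have hexp : ∀ x, |Real.exp (v x) - Real.exp (g x)| ≤ Real.exp L * ‖g x - u x‖ := by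
    intro x
    refine le_trans ?_ (mul_le_mul_of_nonneg_left (hvg x) (Real.exp_pos L).le)
    have key : ∀ p q : ℝ, p ≤ q → q ≤ L → |Real.exp q - Real.exp p| ≤ Real.exp L * |q - p| := by
      intro p q hpq hq
      rw [abs_of_nonneg (by linarith [Real.exp_le_exp.2 hpq]), abs_of_nonneg (by linarith)]
      have h1 : Real.exp p = Real.exp q * Real.exp (p - q) := by rw [← Real.exp_add]; ring_nf
      have h2 := Real.add_one_le_exp (p - q)
      have h3 := Real.exp_le_exp.2 hq
      have h4 := Real.exp_pos q
      rw [h1]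
      nlinarith
    rcases le_total (v x) (g x) with h | h
    · rw [abs_sub_comm]
      exact key _ _ h (hL x).2
    · rw [abs_sub_comm (g x)]
      exact key _ _ h (hvL x)
  have hui : Integrable (fun x => ‖g x - u x‖) (ν + ρ) :=
    (hgi.sub (u.integrable _)).norm
  have hsplit : ∫ x, ‖g x - u x‖ ∂(ν + ρ) = ∫ x, ‖g x - u x‖ ∂ν + ∫ x, ‖g x - u x‖ ∂ρ :=
    integral_add_measure hui.left_of_add_measure hui.right_of_add_measure
  have hgν := hgi.left_of_add_measure
  have hgexp : Integrable (fun x => Real.exp (g x)) ρ :=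
    Integrable.of_bound hgm.exp.aestronglyMeasurable (Real.exp L) (ae_of_all _ fun x => by
      rw [Real.norm_eq_abs, Real.abs_exp]; exact Real.exp_le_exp.2 (hL x).2)
  have hvexp : Integrable (fun x => Real.exp (v x)) ρ :=
    Integrable.of_bound (by fun_prop) (Real.exp L) (ae_of_all _ fun x => by
      rw [Real.norm_eq_abs, Real.abs_exp]; exact Real.exp_le_exp.2 (hvL x))
  have e1 : ∫ x, g x ∂ν - ∫ x, v x ∂ν ≤ ∫ x, ‖g x - u x‖ ∂ν := by
    rw [← integral_sub hgν (v.integrable _)]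
    refine integral_mono (hgν.sub (v.integrable _)) hui.left_of_add_measure fun x => ?_
    exact (le_abs_self _).trans (hvg x)
  have e2 : ∫ x, (Real.exp (v x) - 1) ∂ρ - ∫ x, (Real.exp (g x) - 1) ∂ρ ≤
      Real.exp L * ∫ x, ‖g x - u x‖ ∂ρ := by
    have hv1 : Integrable (fun x => Real.exp (v x) - 1) ρ := hvexp.sub (integrable_const _)
    have hg1 : Integrable (fun x => Real.exp (g x) - 1) ρ := hgexp.sub (integrable_const _)
    rw [← integral_sub hv1 hg1, ← integral_const_mul]
    refine integral_mono (hv1.sub hg1) (hui.right_of_add_measure.const_mul _) fun x => ?_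
    have := (le_abs_self _).trans (hexp x)
    simp only
    linarith
  refine ⟨v, ?_⟩
  have n1 : 0 ≤ ∫ x, ‖g x - u x‖ ∂ν := integral_nonneg fun x => norm_nonneg _
  have n2 : 0 ≤ ∫ x, ‖g x - u x‖ ∂ρ := integral_nonneg fun x => norm_nonneg _
  rw [hsplit, le_div_iff₀ (by positivity)] at hu
  have := Real.exp_pos L
  nlinarith

end

end MultihopGibbs

namespace MultihopGibbs

noncomputable section

open BoundedContinuousFunction

/-! ### Partitions into small cells -/

theorem exists_cells {V : Type*} [MetricSpace V] [CompactSpace V] [MeasurableSpace V]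
    [BorelSpace V] (μ : Measure V) [IsFiniteMeasure μ] {ε : ℝ} (hε : 0 < ε) :
    ∃ (N : ℕ) (c : V → Fin N), Measurable c ∧ (∀ x y, c x = c y → dist x y < ε) ∧
      ∀ a, μ (closure (c ⁻¹' {a})) = μ (c ⁻¹' {a}) := by
  have hr : ∀ x : V, ∃ r ∈ Set.Ioo 0 (ε / 2), μ (frontier (Metric.ball x r)) = 0 := by
    intro x
    obtain ⟨r, hr, h⟩ := exists_null_frontier_thickening μ {x} (half_pos hε)
    exact ⟨r, hr, by rwa [Metric.thickening_singleton] at h⟩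
  choose r hr hr0 using hr
  obtain ⟨t, ht⟩ := isCompact_univ.elim_finite_subcover (fun x : V => Metric.ball x (r x))
    (fun x => Metric.isOpen_ball) (fun x _ => Set.mem_iUnion.2 ⟨x, Metric.mem_ball_self (hr x).1⟩)
  classical
  let b : V → (t → Bool) := fun y i => decide (y ∈ Metric.ball (i : V) (r i))
  have hbm : Measurable b := by
    refine measurable_pi_lambda _ fun i => ?_
    refine measurable_to_bool ?_
    have : (fun y => b y i) ⁻¹' {true} = Metric.ball (i : V) (r i) := by
      ext y; simp [b]
    rw [this]
    exact measurableSet_ball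
  let e := Fintype.equivFin (t → Bool)
  refine ⟨_, fun y => e (b y), (measurable_of_countable e).comp hbm, ?_, ?_⟩
  · intro x y hxy
    have hb : b x = b y := e.injective hxy
    obtain ⟨i, hi, hx⟩ := Set.mem_iUnion₂.1 (ht (Set.mem_univ x))
    have hy : y ∈ Metric.ball i (r i) := by
      have := congrFun hb ⟨i, hi⟩
      simp only [b, decide_eq_decide] at this
      exact this.1 hx
    have h1 := (hr i).2
    rw [Metric.mem_ball] at hx hy
    have := dist_triangle_right x y i
    linarith
  · intro a
    refine le_antisymm ?_ (measure_mono subset_closure)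
    have hsub : closure ((fun y => e (b y)) ⁻¹' {a}) ⊆
        ((fun y => e (b y)) ⁻¹' {a}) ∪ ⋃ i ∈ t, frontier (Metric.ball i (r i)) := by
      intro y hy
      by_contra hcon
      rw [Set.mem_union, not_or] at hcon
      obtain ⟨hya, hyf⟩ := hcon
      have hloc : ∀ᶠ z in 𝓝 y, b z = b y := by
        have : ∀ i : t, ∀ᶠ z in 𝓝 y, b z i = b y i := by
          intro i
          have hi : y ∉ frontier (Metric.ball (i : V) (r i)) := fun h =>
            hyf (Set.mem_iUnion₂.2 ⟨i, i.2, h⟩)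
          by_cases hyi : y ∈ Metric.ball (i : V) (r i)
          · filter_upwards [Metric.isOpen_ball.mem_nhds hyi] with z hz
            simp only [b, decide_eq_decide]
            exact ⟨fun _ => hyi, fun _ => hz⟩
          · have : y ∉ closure (Metric.ball (i : V) (r i)) := fun h =>
              hi ⟨h, by rwa [Metric.isOpen_ball.interior_eq]⟩
            filter_upwards [isClosed_closure.isOpen_compl.mem_nhds this] with z hz
            simp only [b, decide_eq_decide]
            exact ⟨fun h => absurd (subset_closure h) hz, fun h => absurd h hyi⟩
        filter_upwards [eventually_all.2 this] with z hz
        exact funext hz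
      obtain ⟨z, hz1, hz2⟩ := mem_closure_iff_nhds.1 hy _ hloc
      apply hya
      have hz2' : e (b z) = a := hz2
      have hz1' : b z = b y := hz1
      rw [Set.mem_preimage, Set.mem_singleton_iff, ← hz1', hz2']
    refine (measure_mono hsub).trans ((measure_union_le _ _).trans ?_)
    have : μ (⋃ i ∈ t, frontier (Metric.ball i (r i))) = 0 :=
      (measure_biUnion_null_iff t.countable_toSet).2 fun i _ => hr0 i
    rw [this, add_zero]

theorem integral_comp_finite {E A : Type*} [MeasurableSpace E] [Fintype A] [MeasurableSpace A]
    [MeasurableSingletonClass A] (ν : Measure E) [IsFiniteMeasure ν] {c : E → A}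
    (hc : Measurable c) (F : A → ℝ) :
    ∫ x, F (c x) ∂ν = ∑ a, ν.real (c ⁻¹' {a}) * F a := by
  rw [← integral_map hc.aemeasurable (measurable_of_countable F).aestronglyMeasurable,
    integral_fintype (Integrable.of_finite)]
  refine Finset.sum_congr rfl fun a _ => ?_
  rw [smul_eq_mul, map_measureReal_apply hc (measurableSet_singleton a)]

theorem sum_measureReal_preimage {E A : Type*} [MeasurableSpace E] [Fintype A] [MeasurableSpace A]
    [MeasurableSingletonClass A] (ν : Measure E) [IsFiniteMeasure ν] {c : E → A}
    (hc : Measurable c) : ∑ a, ν.real (c ⁻¹' {a}) = ν.real Set.univ := by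
  have := integral_comp_finite ν hc fun _ => (1 : ℝ)
  simpa using this.symm

theorem abs_integral_sub_le_of_cells {E A : Type*} [TopologicalSpace E] [MeasurableSpace E]
    [OpensMeasurableSpace E] [Fintype A] [MeasurableSpace A] [MeasurableSingletonClass A]
    (ν ν' : Measure E) [IsFiniteMeasure ν] [IsFiniteMeasure ν'] {c : E → A} (hc : Measurable c)
    (φ : E →ᵇ ℝ) {ε δ : ℝ} (hφ : ∀ x y, c x = c y → |φ x - φ y| ≤ ε)
    (hδ : ∀ a, |ν'.real (c ⁻¹' {a}) - ν.real (c ⁻¹' {a})| ≤ δ) :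
    |∫ x, φ x ∂ν' - ∫ x, φ x ∂ν| ≤
      ε * (ν'.real Set.univ + ν.real Set.univ) + Fintype.card A * δ * ‖φ‖ := by
  classical
  let F : A → ℝ := fun a => if h : ∃ x, c x = a then φ h.choose else 0
  have hF : ∀ x, |φ x - F (c x)| ≤ ε := by
    intro x
    have h : ∃ y, c y = c x := ⟨x, rfl⟩
    simp only [F, dif_pos h]
    exact hφ _ _ h.choose_spec.symm
  have hFb : ∀ a, |F a| ≤ ‖φ‖ := by
    intro a
    simp only [F]
    split_ifs with h
    · exact φ.norm_coe_le_norm _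
    · simp
  have hFi : ∀ (ρ : Measure E) [IsFiniteMeasure ρ], Integrable (fun x => F (c x)) ρ := by
    intro ρ _
    exact Integrable.of_bound ((measurable_of_countable F).comp hc).aestronglyMeasurable ‖φ‖
      (ae_of_all _ fun x => hFb _)
  have key : ∀ (ρ : Measure E) [IsFiniteMeasure ρ],
      |∫ x, φ x ∂ρ - ∫ x, F (c x) ∂ρ| ≤ ε * ρ.real Set.univ := by
    intro ρ _
    rw [← integral_sub (φ.integrable ρ) (hFi ρ)]
    have hF' : ∀ᵐ x ∂ρ, ‖φ x - F (c x)‖ ≤ ε := ae_of_all _ hF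
    exact norm_integral_le_of_norm_le_const hF'
  have h3 : |∫ x, F (c x) ∂ν' - ∫ x, F (c x) ∂ν| ≤ Fintype.card A * δ * ‖φ‖ := by
    rw [integral_comp_finite ν' hc, integral_comp_finite ν hc, ← Finset.sum_sub_distrib]
    refine (Finset.abs_sum_le_sum_abs _ _).trans ?_
    refine (Finset.sum_le_sum (g := fun _ => δ * ‖φ‖) fun a _ => ?_).trans_eq ?_
    · rw [← sub_mul, abs_mul]
      exact mul_le_mul (hδ a) (hFb a) (abs_nonneg _) ((abs_nonneg _).trans (hδ a))
    · simp [mul_assoc]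
  have h1 := key ν
  have h2 := key ν'
  rw [abs_le] at *
  constructor <;> linarith [h1.1, h1.2, h2.1, h2.2, h3.1, h3.2]

/-- Finite measures converge weakly if their values on the cells of finer and finer partitions
do so, at a rate controlled by the number of cells. -/
theorem tendsto_of_cells {E : Type*} [MetricSpace E] [CompactSpace E] [MeasurableSpace E]
    [OpensMeasurableSpace E] {A : ℕ → Type*} [∀ j, Fintype (A j)] [∀ j, MeasurableSpace (A j)]
    [∀ j, MeasurableSingletonClass (A j)] (ν : FiniteMeasure E) (ν' : ℕ → FiniteMeasure E)
    (c : ∀ j, E → A j) (hc : ∀ j, Measurable (c j)) {r : ℕ → ℝ} (hr : Tendsto r atTop (𝓝 0))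
    (hcr : ∀ j x y, c j x = c j y → dist x y ≤ r j) {δ : ℕ → ℝ} {j0 : ℕ}
    (hδ : Tendsto (fun j => Fintype.card (A j) * δ j) atTop (𝓝 0))
    (hν : ∀ j, j0 ≤ j → ∀ a, |(ν' j : Measure E).real (c j ⁻¹' {a}) -
      (ν : Measure E).real (c j ⁻¹' {a})| ≤ δ j) :
    Tendsto ν' atTop (𝓝 ν) := by
  rw [FiniteMeasure.tendsto_iff_forall_integral_tendsto]
  intro φ
  rw [Metric.tendsto_atTop']
  intro η hη
  have hmass : ∀ j, j0 ≤ j → (ν' j : Measure E).real Set.univ ≤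
      (ν : Measure E).real Set.univ + Fintype.card (A j) * δ j := by
    intro j hj
    rw [← sum_measureReal_preimage _ (hc j), ← sum_measureReal_preimage _ (hc j)]
    have : ∑ a : A j, δ j = Fintype.card (A j) * δ j := by simp
    rw [← this, ← Finset.sum_add_distrib]
    refine Finset.sum_le_sum fun a _ => ?_
    have := (abs_le.1 (hν j hj a)).2
    linarith
  have hw : 0 ≤ (ν : Measure E).real Set.univ := measureReal_nonneg
  set w := (ν : Measure E).real Set.univ
  have hu := CompactSpace.uniformContinuous_of_continuous φ.continuous
  rw [Metric.uniformContinuous_iff] at hu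
  obtain ⟨d, hd, hud⟩ := hu (η / (2 * (2 * w + 1))) (by positivity)
  have e1 := (hδ.mul_const ‖φ‖).eventually_lt_const (u := η / 2) (by simpa using half_pos hη)
  have e2 := hδ.eventually_lt_const (u := 1) one_pos
  have e3 := hr.eventually_lt_const hd
  obtain ⟨n, hn⟩ := eventually_atTop.1 (e1.and (e2.and (e3.and (eventually_ge_atTop j0))))
  refine ⟨n, fun j hj => ?_⟩
  obtain ⟨h1, h2, h3, h4⟩ := hn j (le_of_lt hj)
  have hφ : ∀ x y, c j x = c j y → |φ x - φ y| ≤ η / (2 * (2 * w + 1)) := fun x y hxy =>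
    (hud ((hcr j x y hxy).trans_lt h3)).le
  have := abs_integral_sub_le_of_cells (ν : Measure E) (ν' j : Measure E) (hc j) φ hφ (hν j h4)
  rw [Real.dist_eq]
  refine this.trans_lt ?_
  have h5 : η / (2 * (2 * w + 1)) * ((ν' j : Measure E).real Set.univ + w) ≤ η / 2 := by
    rw [div_mul_eq_mul_div, div_le_div_iff₀ (by positivity) two_pos]
    have := hmass j h4
    nlinarith
  linarith

theorem exists_cells_subset_of_mem_nhds {V : Type*} [MetricSpace V] [CompactSpace V]
    [MeasurableSpace V] [BorelSpace V] {kmax : ℕ} (μ : Measure V) [IsFiniteMeasure μ]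
    (Ψ : Setting V kmax) {G : Set (Setting V kmax)} (hG : G ∈ 𝓝 Ψ) :
    ∃ (N : ℕ) (c : V → Fin N) (δ : ℝ) (K : ℕ), Measurable c ∧
      (∀ a, μ (closure (c ⁻¹' {a})) = μ (c ⁻¹' {a})) ∧ 0 < δ ∧
      ∀ Φ : Setting V kmax,
        (∀ (k : Fin kmax) (α : Fin (k + 1) → Fin N),
          |(Φ.1 k : Measure (Fin (k + 1) → V)).real ((fun y => c ∘ y) ⁻¹' {α}) -
            (Ψ.1 k : Measure (Fin (k + 1) → V)).real ((fun y => c ∘ y) ⁻¹' {α})| ≤ δ) →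
        (∀ m < K, ∀ a, |(Φ.2 m : Measure V).real (c ⁻¹' {a}) -
          (Ψ.2 m : Measure V).real (c ⁻¹' {a})| ≤ δ) → Φ ∈ G := by
  by_contra! hcon
  have hpos : ∀ j : ℕ, 0 < (1 : ℝ) / (j + 1) := fun j => by positivity
  choose N c hcm hcd hcl using fun j : ℕ => exists_cells μ (hpos j)
  let δ : ℕ → ℝ := fun j => 1 / ((j + 1) * ((N j : ℝ) ^ kmax + N j + 1))
  have hδ : ∀ j, 0 < δ j := fun j => by positivity
  choose Φ hΦ1 hΦ2 hΦG using fun j => hcon (N j) (c j) (δ j) j (hcm j) (hcl j) (hδ j)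
  have h0 : Tendsto (fun n : ℕ => (1 : ℝ) / ((n : ℝ) + 1)) atTop (𝓝 0) :=
    tendsto_one_div_add_atTop_nhds_zero_nat
  have hbound : ∀ (q : ℕ → ℝ), (∀ j, 0 ≤ q j ∧ q j ≤ (N j : ℝ) ^ kmax + N j + 1) →
      Tendsto (fun j => q j * δ j) atTop (𝓝 0) := by
    intro q hq
    refine squeeze_zero (fun j => mul_nonneg (hq j).1 (hδ j).le) (fun j => ?_) h0
    simp only [δ]
    rw [mul_one_div, div_le_div_iff₀ (by positivity) (by positivity)]
    have := (hq j).2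
    have h1 : (0 : ℝ) < j + 1 := by positivity
    nlinarith
  have hlim : Tendsto Φ atTop (𝓝 Ψ) := by
    refine Tendsto.prodMk_nhds (tendsto_pi_nhds.2 fun k => ?_) (tendsto_pi_nhds.2 fun m => ?_)
    · refine tendsto_of_cells (A := fun j => Fin (k + 1) → Fin (N j)) (Ψ.1 k)
        (fun j => (Φ j).1 k) (fun j y => c j ∘ y) (fun j => ?_) h0 (fun j y z hyz => ?_)
        (δ := δ) (j0 := 0) ?_ (fun j _ α => hΦ1 j k α)
      · exact measurable_pi_lambda _ fun l => (hcm j).comp (measurable_pi_apply l)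
      · rw [dist_pi_le_iff (hpos j).le]
        exact fun l => (hcd j _ _ (congrFun hyz l)).le
      · refine hbound _ fun j => ⟨by positivity, ?_⟩
        simp only [Fintype.card_fun, Fintype.card_fin, Nat.cast_pow]
        rcases Nat.eq_zero_or_pos (N j) with h | h
        · simp [h]; positivity
        · have h1 : (1 : ℝ) ≤ N j := by exact_mod_cast h
          have := pow_le_pow_right₀ h1 (show (k : ℕ) + 1 ≤ kmax from k.2)
          linarith
    · refine tendsto_of_cells (A := fun j => Fin (N j)) (Ψ.2 m)
        (fun j => (Φ j).2 m) c hcm h0 (fun j y z hyz => (hcd j _ _ hyz).le)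
        (δ := δ) (j0 := m + 1) ?_ (fun j hj a => hΦ2 j m hj a)
      refine hbound _ fun j => ⟨by positivity, ?_⟩
      simp only [Fintype.card_fin]
      have : (0 : ℝ) ≤ (N j : ℝ) ^ kmax := by positivity
      linarith
  obtain ⟨j, hj⟩ := (hlim.eventually_mem hG).exists
  exact hΦG j hj

end

end MultihopGibbs

namespace MultihopGibbs

noncomputable section

open BoundedContinuousFunction

/-! ### Integrals against the empirical measures -/

theorem incoming_eq_hits {V : Type*} {x : ℕ → V} (hx : Function.Injective x) {n kmax : ℕ}
    (s : Config n kmax) (i : Fin n) : incoming x s i = hits s i := by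
  classical
  simp only [incoming, hits, occ_eq_sum]
  refine Finset.sum_congr rfl fun j _ => Finset.sum_congr rfl fun l _ => ?_
  simp [hx.eq_iff, Fin.ext_iff]

section Empirical

variable {V : Type*} [TopologicalSpace V] [MeasurableSpace V]
  [BorelSpace V] [MeasurableSingletonClass V]

theorem integrable_dirac_of_real {E : Type*} [MeasurableSpace E] [MeasurableSingletonClass E]
    (a : E) (f : E → ℝ) : Integrable f (dirac a : Measure E) :=
  integrable_dirac (by simp)

theorem integral_dirac_coe {E : Type*} [MeasurableSpace E] [MeasurableSingletonClass E]
    (a : E) (f : E → ℝ) : ∫ y, f y ∂(dirac a : Measure E) = f a :=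
  integral_dirac f a

theorem integral_smul_sum {E ι : Type*} [MeasurableSpace E] [TopologicalSpace E]
    [OpensMeasurableSpace E] (lam : ℝ≥0) (s : Finset ι)
    (ν : ι → FiniteMeasure E) (f : E → ℝ) (hf : ∀ i ∈ s, Integrable f (ν i : Measure E)) :
    ∫ y, f y ∂((lam⁻¹ • ∑ i ∈ s, ν i : FiniteMeasure E) : Measure E) =
      (lam : ℝ)⁻¹ * ∑ i ∈ s, ∫ y, f y ∂(ν i : Measure E) := by
  rw [FiniteMeasure.toMeasure_smul, FiniteMeasure.toMeasure_sum, integral_smul_nnreal_measure,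
    integral_finsetSum_measure hf]
  simp [NNReal.smul_def]

theorem integral_userMeasure (lam : ℝ≥0) (x : ℕ → V) (n : ℕ) (f : V → ℝ) :
    ∫ y, f y ∂(userMeasure lam x n : Measure V) = (lam : ℝ)⁻¹ * ∑ i : Fin n, f (x i) := by
  rw [userMeasure, integral_smul_sum _ _ _ _ fun i _ => integrable_dirac_of_real _ _]
  simp only [integral_dirac_coe]

theorem integral_hopMeasure (lam : ℝ≥0) {x : ℕ → V} (hx : Function.Injective x) {n kmax : ℕ}
    (s : Config n kmax) (m : ℕ) (f : V → ℝ) :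
    ∫ y, f y ∂(hopMeasure lam x s m : Measure V) =
      (lam : ℝ)⁻¹ * ∑ i : Fin n, if hits s i = m then f (x i) else 0 := by
  rw [hopMeasure, integral_smul_sum _ _ _ _ fun i _ => ?_]
  · congr 1
    refine Finset.sum_congr rfl fun i _ => ?_
    rw [incoming_eq_hits hx]
    split_ifs
    · exact integral_dirac_coe _ _
    · simp
  · split_ifs
    · exact integrable_dirac_of_real _ _
    · simp

theorem sum_integral_trajMeasure [SecondCountableTopology V] (lam : ℝ≥0) (x : ℕ → V) {n kmax : ℕ} (s : Config n kmax)
    (G : ∀ k : Fin kmax, (Fin (k + 1) → V) → ℝ) :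
    ∑ k : Fin kmax, ∫ y, G k y ∂(trajMeasure lam x s k : Measure (Fin (k + 1) → V)) =
      (lam : ℝ)⁻¹ * ∑ i : Fin n, G (s i).1 (path x i (s i)) := by
  have h1 : ∀ (k : Fin kmax) (i : Fin n), Integrable (G k)
      (Pi.single (M := fun k : Fin kmax => FiniteMeasure (Fin (k + 1) → V))
      (s i).1 (dirac (path x i (s i))) k : Measure (Fin (k + 1) → V)) := by
    intro k i
    by_cases h : k = (s i).1
    · subst h
      rw [Pi.single_eq_same]
      exact integrable_dirac_of_real _ _
    · rw [Pi.single_eq_of_ne h]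
      simp
  have h2 : ∀ k : Fin kmax, ∫ y, G k y ∂(trajMeasure lam x s k : Measure (Fin (k + 1) → V)) =
      (lam : ℝ)⁻¹ * ∑ i : Fin n, ∫ y, G k y ∂(Pi.single
        (M := fun k : Fin kmax => FiniteMeasure (Fin (k + 1) → V))
        (s i).1 (dirac (path x i (s i))) k : Measure (Fin (k + 1) → V)) := by
    intro k
    rw [trajMeasure, integral_smul_sum _ _ _ _ fun i _ => h1 k i]
  simp only [h2]
  rw [← Finset.mul_sum, Finset.sum_comm]
  congr 1
  refine Finset.sum_congr rfl fun i _ => ?_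
  rw [Finset.sum_eq_single (s i).1]
  · rw [Pi.single_eq_same, integral_dirac_coe]
  · intro k _ hk
    rw [Pi.single_eq_of_ne hk]
    simp
  · simp

theorem tendsto_card_div {μ : FiniteMeasure V} {x : ℕ → V} {n : ℝ≥0 → ℕ}
    (hL : Tendsto (fun lam => userMeasure lam x (n lam)) atTop (𝓝 μ)) :
    Tendsto (fun lam : ℝ≥0 => (n lam : ℝ) / lam) atTop (𝓝 (μ.mass : ℝ)) := by
  have := (FiniteMeasure.tendsto_iff_forall_integral_tendsto.1 hL)
    (BoundedContinuousFunction.const V (1 : ℝ))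
  simp only [BoundedContinuousFunction.const_apply, integral_userMeasure] at this
  simp only [Finset.sum_const, Finset.card_univ, Fintype.card_fin, nsmul_eq_mul, mul_one,
    integral_const, smul_eq_mul] at this
  refine (this.congr fun lam => ?_)
  rw [div_eq_inv_mul]

end Empirical

theorem tendsto_coe_atTop_real : Tendsto (fun lam : ℝ≥0 => (lam : ℝ)) atTop atTop :=
  NNReal.tendsto_coe_atTop.2 tendsto_id

theorem eventually_lt_of_isClosed {E : Type*} [TopologicalSpace E] [HasOuterApproxClosed E]
    [MeasurableSpace E] [OpensMeasurableSpace E] (ν : FiniteMeasure E) {F : Set E}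
    (hF : IsClosed F) {b : ℝ} (hb : (ν : Measure E).real F < b) :
    ∀ᶠ ν' : FiniteMeasure E in 𝓝 ν, (ν' : Measure E).real F < b := by
  have h := FiniteMeasure.limsup_measure_closed_le_of_tendsto
    (tendsto_id (x := 𝓝 ν)) hF
  have hb' : (ν : Measure E) F < ENNReal.ofReal b := by
    rw [← ENNReal.ofReal_toReal (measure_ne_top (ν : Measure E) F)]
    exact (ENNReal.ofReal_lt_ofReal_iff (measureReal_nonneg.trans_lt hb)).2 hb
  filter_upwards [eventually_lt_of_limsup_lt (h.trans_lt hb')] with ν' hν'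
  have := (ENNReal.toReal_lt_toReal (measure_ne_top (ν' : Measure E) F) ENNReal.ofReal_ne_top).2 hν'
  rwa [ENNReal.toReal_ofReal (measureReal_nonneg.trans hb.le)] at this

/-- The part of the exponent that does not depend on the test functions is asymptotically at least
`λ (w log kmax - 1 / e)` if there are at most `λ ρ a` relays with label `a`. -/
theorem eventually_le_tilt_remainder {N kmax : ℕ} {w : ℝ} (hw : 0 < w) {n : ℝ≥0 → ℕ}
    (hn : Tendsto (fun lam : ℝ≥0 => (n lam : ℝ) / lam) atTop (𝓝 w)) (ρ : Fin N → ℝ)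
    (hρ : ∀ a, 0 < ρ a) {ε : ℝ} (hε : 0 < ε) :
    ∀ᶠ lam : ℝ≥0 in atTop, ∀ (c : Fin (n lam) → Fin N) (s : Config (n lam) kmax),
      (∀ a, (hits (fun j => relabel c (s j)) a : ℝ) ≤ lam * ρ a) →
      lam * (w * Real.log kmax - 1 / Real.exp 1 - ε) ≤
        ∑ a, ((hits (fun j => relabel c (s j)) a : ℝ) * Real.log (ρ a)
          - Real.log ((hits (fun j => relabel c (s j)) a).factorial))
        - n lam / (Real.exp 1 * w) - relayCount s * Real.log (Real.exp 1 * w)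
        + relayCount s * Real.log (n lam) + n lam * Real.log kmax := by
  have hlam := tendsto_coe_atTop_real
  have hinv : Tendsto (fun lam : ℝ≥0 => 1 / (lam : ℝ)) atTop (𝓝 0) := by
    simpa [Function.comp_def] using tendsto_inv_atTop_zero.comp hlam
  set C := ∑ a, ρ a with hC
  have hC0 : 0 ≤ C := Finset.sum_nonneg fun a _ => (hρ a).le
  -- the deterministic lower bound
  let D : ℝ≥0 → ℝ := fun lam => C * -|Real.log ((n lam : ℝ) / lam / w)|
    - ∑ a : Fin N, (2 * Real.log (lam * ρ a + 1) + 1) / lam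
    - (n lam : ℝ) / lam / (Real.exp 1 * w) + (n lam : ℝ) / lam * Real.log kmax
  have hlogdiv : ∀ a, Tendsto (fun lam : ℝ≥0 => (2 * Real.log (lam * ρ a + 1) + 1) / lam)
      atTop (𝓝 0) := by
    intro a
    have h1 : Tendsto (fun lam : ℝ≥0 => 4 * (√(ρ a + 1 / lam) * √(1 / lam)) + 1 / (lam : ℝ)) atTop
        (𝓝 (4 * (√(ρ a + 0) * √0) + 0)) :=
      ((((Real.continuous_sqrt.tendsto _).comp (hinv.const_add (ρ a))).mul
        ((Real.continuous_sqrt.tendsto _).comp hinv)).const_mul 4).add hinv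
    simp only [Real.sqrt_zero, mul_zero, add_zero] at h1
    refine squeeze_zero' ?_ ?_ h1
    · filter_upwards [hlam.eventually_gt_atTop 0] with i hi
      have := hρ a
      have : 0 ≤ Real.log ((i : ℝ) * ρ a + 1) := Real.log_nonneg (by
        have := mul_pos hi this; linarith)
      positivity
    · filter_upwards [hlam.eventually_gt_atTop 0] with i hi
      have hρa := hρ a
      have hx : (0 : ℝ) < i * ρ a + 1 := by positivity
      have h2 := Real.log_le_self (Real.sqrt_nonneg ((i : ℝ) * ρ a + 1))
      rw [Real.log_sqrt hx.le] at h2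
      have h3 : √(ρ a + 1 / i) * √(1 / i) = √((i : ℝ) * ρ a + 1) / i := by
        have : ρ a + 1 / (i : ℝ) = (i * ρ a + 1) / i := by field_simp
        rw [this, ← Real.sqrt_mul (by positivity), div_mul_div_comm, mul_one,
          Real.sqrt_div hx.le, Real.sqrt_mul_self hi.le]
      rw [h3, add_div]
      refine add_le_add ?_ le_rfl
      rw [← mul_div_assoc]
      exact div_le_div_of_nonneg_right (by linarith) hi.le
  have hD : Tendsto D atTop (𝓝 (C * -|Real.log (w / w)| - ∑ a : Fin N, (0 : ℝ)
      - w / (Real.exp 1 * w) + w * Real.log kmax)) := by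
    refine (((Tendsto.const_mul C ?_).sub (tendsto_finsetSum _ fun a _ => hlogdiv a)).sub
      (hn.div_const _)).add (hn.mul_const _)
    refine (Tendsto.abs ?_).neg
    exact ((Real.continuousAt_log (by rw [div_self hw.ne']; exact one_ne_zero)).tendsto).comp
      (hn.div_const w)
  have hlim : C * -|Real.log (w / w)| - ∑ a : Fin N, (0 : ℝ)
      - w / (Real.exp 1 * w) + w * Real.log kmax = w * Real.log kmax - 1 / Real.exp 1 := by
    rw [div_self hw.ne', Real.log_one, div_mul_eq_div_div_swap, div_self hw.ne']
    simp
    ring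
  rw [hlim] at hD
  filter_upwards [hD.eventually_const_lt (u := w * Real.log kmax - 1 / Real.exp 1 - ε) (by linarith),
    hlam.eventually_gt_atTop 0, hn.eventually_const_lt hw] with lam hDl hl hnl c s hs
  have hn0 : (0 : ℝ) < n lam := by
    rcases (Nat.cast_nonneg (n lam) : (0 : ℝ) ≤ n lam).eq_or_lt with h | h
    · rw [← h] at hnl; simp at hnl
    · exact h
  refine (mul_le_mul_of_nonneg_left hDl.le hl.le).trans ?_
  set T := fun a => (hits (fun j => relabel c (s j)) a : ℝ) with hT
  have hsum : ∑ a, T a = relayCount s := by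
    have := sum_hits (fun j => relabel c (s j))
    simp only [hT]
    rw [← Nat.cast_sum, this]
    rfl
  have hterm : ∀ a, lam * ρ a * -|Real.log ((n lam : ℝ) / lam / w)|
      - (2 * Real.log (lam * ρ a + 1) + 1) ≤
      T a * Real.log (ρ a) - Real.log ((hits (fun j => relabel c (s j)) a).factorial)
      - T a * Real.log (Real.exp 1 * w) + T a * Real.log (n lam) := by
    intro a
    have h1 := log_factorial_le (hits (fun j => relabel c (s j)) a)
    have hT0 : 0 ≤ T a := Nat.cast_nonneg _
    have h2 : Real.log (T a + 1) ≤ Real.log (lam * ρ a + 1) :=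
      Real.log_le_log (by positivity) (by linarith [hs a])
    have h3 : lam * ρ a * -|Real.log ((n lam : ℝ) / lam / w)| ≤
        T a * (Real.log (ρ a) - Real.log (T a) - Real.log w + Real.log (n lam)) := by
      rcases hT0.eq_or_lt with h0 | h0
      · rw [← h0, zero_mul]
        have := hρ a
        have := abs_nonneg (Real.log ((n lam : ℝ) / lam / w))
        rw [mul_neg, neg_nonpos]
        positivity
      · have h4 : Real.log (T a) ≤ Real.log lam + Real.log (ρ a) := by
          rw [← Real.log_mul hl.ne' (hρ a).ne']
          exact Real.log_le_log h0 (hs a)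
        have h5 : Real.log ((n lam : ℝ) / lam / w) =
            Real.log (n lam) - Real.log lam - Real.log w := by
          rw [Real.log_div (by positivity) hw.ne', Real.log_div hn0.ne' hl.ne']
        have h6 : -|Real.log ((n lam : ℝ) / lam / w)| ≤
            Real.log (ρ a) - Real.log (T a) - Real.log w + Real.log (n lam) := by
          have := neg_abs_le (Real.log ((n lam : ℝ) / lam / w))
          rw [h5] at this ⊢
          linarith
        calc lam * ρ a * -|Real.log ((n lam : ℝ) / lam / w)|
            ≤ T a * -|Real.log ((n lam : ℝ) / lam / w)| :=
              mul_le_mul_of_nonpos_right (hs a) (neg_nonpos.2 (abs_nonneg _))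
          _ ≤ _ := mul_le_mul_of_nonneg_left h6 h0.le
    rw [Real.log_mul (Real.exp_pos 1).ne' hw.ne', Real.log_exp]
    simp only [hT] at h1 h2 h3 ⊢
    linarith
  have hall := Finset.sum_le_sum fun a (_ : a ∈ Finset.univ) => hterm a
  rw [Finset.sum_sub_distrib, ← Finset.sum_mul, ← Finset.mul_sum, ← hC,
    Finset.sum_add_distrib (f := fun a => T a * Real.log (ρ a)
      - Real.log ((hits (fun j => relabel c (s j)) a).factorial)
      - T a * Real.log (Real.exp 1 * w)), Finset.sum_sub_distrib (f := fun a => T a * Real.log (ρ a)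
      - Real.log ((hits (fun j => relabel c (s j)) a).factorial)), ← Finset.sum_mul,
      ← Finset.sum_mul, hsum] at hall
  have hDe : lam * D lam = lam * C * -|Real.log ((n lam : ℝ) / lam / w)|
      - ∑ a : Fin N, (2 * Real.log (lam * ρ a + 1) + 1) - n lam / (Real.exp 1 * w)
      + n lam * Real.log kmax := by
    simp only [D]
    rw [← Finset.sum_div]
    field_simp
  rw [hDe]
  linarith

end

end MultihopGibbs

namespace MultihopGibbs

noncomputable section

open BoundedContinuousFunction

/-! ### Constraints on the limit points of the empirical measures -/

theorem sum_smul_eq_of_forall_integral_le {V : Type*} [TopologicalSpace V] [HasOuterApproxClosed V]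
    [MeasurableSpace V] [BorelSpace V] (μ : Measure V) [IsFiniteMeasure μ]
    (ν : ℕ → FiniteMeasure V) (a : ℕ → ℕ)
    (hle : ∀ (φ : V →ᵇ ℝ), (∀ x, 0 ≤ φ x) → ∀ K,
      ∑ m ∈ Finset.range K, (a m : ℝ) * ∫ x, φ x ∂(ν m : Measure V) ≤ ∫ x, φ x ∂μ)
    (hmass : ∀ ε > 0, ∃ K, μ.real Set.univ - ε <
      ∑ m ∈ Finset.range K, (a m : ℝ) * (ν m : Measure V).real Set.univ) :
    Measure.sum (fun m => (a m : ℝ≥0∞) • (ν m : Measure V)) = μ := by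
  have hmle : ∀ K, ∑ m ∈ Finset.range K, (a m : ℝ) * (ν m : Measure V).real Set.univ ≤
      μ.real Set.univ := by
    intro K
    have := hle (BoundedContinuousFunction.const V 1) (fun _ => zero_le_one) K
    simpa using this
  have hfin : IsFiniteMeasure (Measure.sum (fun m => (a m : ℝ≥0∞) • (ν m : Measure V))) := by
    refine ⟨lt_of_le_of_lt ?_ (measure_lt_top μ Set.univ)⟩
    rw [Measure.sum_apply _ MeasurableSet.univ]
    refine ENNReal.tsum_le_of_sum_range_le fun K => ?_
    have := ENNReal.ofReal_le_ofReal (hmle K)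
    rw [Measure.real, ENNReal.ofReal_toReal (measure_ne_top _ _),
      ENNReal.ofReal_sum_of_nonneg (fun m _ => by positivity)] at this
    refine le_trans (le_of_eq ?_) this
    refine Finset.sum_congr rfl fun m _ => ?_
    rw [ENNReal.ofReal_mul (by positivity), Measure.real, ENNReal.ofReal_toReal (measure_ne_top _ _),
      ENNReal.ofReal_natCast]
    rfl
  refine ext_of_forall_integral_eq_of_IsFiniteMeasure fun φ => ?_
  have h1 := (hasSum_integral_measure (φ.integrable
    (Measure.sum (fun m => (a m : ℝ≥0∞) • (ν m : Measure V))))).tendsto_sum_nat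
  refine tendsto_nhds_unique h1 ?_
  have hint : ∀ m, ∫ x, φ x ∂((a m : ℝ≥0∞) • (ν m : Measure V)) =
      (a m : ℝ) * ∫ x, φ x ∂(ν m : Measure V) := by
    intro m
    rw [integral_smul_measure]
    simp
  simp only [hint]
  have key : ∀ K, |∑ m ∈ Finset.range K, (a m : ℝ) * ∫ x, φ x ∂(ν m : Measure V) - ∫ x, φ x ∂μ| ≤
      ‖φ‖ * (μ.real Set.univ -
        ∑ m ∈ Finset.range K, (a m : ℝ) * (ν m : Measure V).real Set.univ) := by
    intro K
    have e1 := hle (BoundedContinuousFunction.const V ‖φ‖ + φ) (fun x => by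
      have := (abs_le.1 (φ.norm_coe_le_norm x)).1
      simp only [BoundedContinuousFunction.coe_add, Pi.add_apply,
        BoundedContinuousFunction.const_apply]
      linarith) K
    have e2 := hle (BoundedContinuousFunction.const V ‖φ‖ - φ) (fun x => by
      have := (abs_le.1 (φ.norm_coe_le_norm x)).2
      simp only [BoundedContinuousFunction.coe_sub, Pi.sub_apply,
        BoundedContinuousFunction.const_apply]
      linarith) K
    have i1 : ∀ ρ : Measure V, IsFiniteMeasure ρ →
        ∫ x, (BoundedContinuousFunction.const V ‖φ‖ + φ) x ∂ρ =
        ρ.real Set.univ * ‖φ‖ + ∫ x, φ x ∂ρ := by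
      intro ρ _
      simp only [BoundedContinuousFunction.coe_add, Pi.add_apply,
        BoundedContinuousFunction.const_apply]
      rw [integral_add (integrable_const _) (φ.integrable _)]
      simp
    have i2 : ∀ ρ : Measure V, IsFiniteMeasure ρ →
        ∫ x, (BoundedContinuousFunction.const V ‖φ‖ - φ) x ∂ρ =
        ρ.real Set.univ * ‖φ‖ - ∫ x, φ x ∂ρ := by
      intro ρ _
      simp only [BoundedContinuousFunction.coe_sub, Pi.sub_apply,
        BoundedContinuousFunction.const_apply]
      rw [integral_sub (integrable_const _) (φ.integrable _)]
      simp
    rw [i1 _ inferInstance] at e1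
    rw [i2 _ inferInstance] at e2
    simp only [fun m => i1 (ν m : Measure V) inferInstance,
      fun m => i2 (ν m : Measure V) inferInstance, mul_add, mul_sub, Finset.sum_add_distrib,
      Finset.sum_sub_distrib, ← mul_assoc, ← Finset.sum_mul] at e1 e2
    rw [abs_le]
    constructor <;> nlinarith
  rw [tendsto_iff_norm_sub_tendsto_zero]
  refine squeeze_zero (fun K => norm_nonneg _) key ?_
  rw [← mul_zero ‖φ‖]
  refine Tendsto.const_mul _ ?_
  have hmono : Monotone fun K =>
      ∑ m ∈ Finset.range K, (a m : ℝ) * (ν m : Measure V).real Set.univ := by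
    intro K K' h
    exact Finset.sum_le_sum_of_subset_of_nonneg (Finset.range_mono h) fun m _ _ => by positivity
  rw [Metric.tendsto_atTop]
  intro ε hε
  obtain ⟨K, hK⟩ := hmass ε hε
  refine ⟨K, fun K' hK' => ?_⟩
  have h2 := hmono hK'
  have h3 := hmle K'
  simp only at h2
  rw [Real.dist_eq, sub_zero, abs_of_nonneg (by linarith)]
  linarith

section Limit

variable {V : Type*} [MetricSpace V] [CompactSpace V] [MeasurableSpace V] [BorelSpace V]

/-- The setting is approached by empirical measures along arbitrarily large `λ`. -/
def IsReachable {kmax : ℕ} (x : ℕ → V) (n : ℝ≥0 → ℕ) (Ψ : Setting V kmax) : Prop :=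
  ∀ U ∈ 𝓝 Ψ, ∃ᶠ lam : ℝ≥0 in atTop, ∃ s : Config (n lam) kmax, empirical lam x s ∈ U

theorem IsReachable.le_of_tendsto {kmax : ℕ} {x : ℕ → V} {n : ℝ≥0 → ℕ} {Ψ : Setting V kmax}
    (h : IsReachable x n Ψ) {F : Setting V kmax → ℝ} (hF : ContinuousAt F Ψ) {G : ℝ≥0 → ℝ} {g : ℝ}
    (hG : Tendsto G atTop (𝓝 g))
    (hFG : ∀ᶠ lam in atTop, ∀ s : Config (n lam) kmax, F (empirical lam x s) ≤ G lam) :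
    F Ψ ≤ g := by
  by_contra! hlt
  obtain ⟨r, hr1, hr2⟩ := exists_between hlt
  have h1 := h _ (hF.eventually_const_lt hr2)
  have h2 := hG.eventually_lt_const hr1
  obtain ⟨lam, ⟨s, hs⟩, h3, h4⟩ := (h1.and_eventually (hFG.and h2)).exists
  have : r < F (empirical lam x s) := hs
  linarith [h3 s]

theorem continuous_integral_traj {kmax : ℕ} (k : Fin kmax) (φ : (Fin (k + 1) → V) →ᵇ ℝ) :
    Continuous fun Ψ : Setting V kmax => ∫ y, φ y ∂(Ψ.1 k : Measure (Fin (k + 1) → V)) :=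
  (FiniteMeasure.continuous_integral_boundedContinuousFunction φ).comp
    ((continuous_apply k).comp continuous_fst)

theorem continuous_integral_hop {kmax : ℕ} (m : ℕ) (φ : V →ᵇ ℝ) :
    Continuous fun Ψ : Setting V kmax => ∫ y, φ y ∂(Ψ.2 m : Measure V) :=
  (FiniteMeasure.continuous_integral_boundedContinuousFunction φ).comp
    ((continuous_apply m).comp continuous_snd)

theorem sum_integral_hopMeasure {x : ℕ → V} (hx : Function.Injective x) (lam : ℝ≥0) {n kmax : ℕ}
    (s : Config n kmax) (K : ℕ) (F : ℕ → V → ℝ) :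
    ∑ m ∈ Finset.range K, ∫ y, F m y ∂(hopMeasure lam x s m : Measure V) =
      (lam : ℝ)⁻¹ * ∑ i : Fin n, if hits s i < K then F (hits s i) (x i) else 0 := by
  simp only [integral_hopMeasure lam hx]
  rw [← Finset.mul_sum, Finset.sum_comm]
  congr 1
  refine Finset.sum_congr rfl fun i _ => ?_
  rw [Finset.sum_ite_eq]
  simp

theorem sum_path_succ {x : ℕ → V} {n kmax : ℕ} (s : Config n kmax) (φ : V → ℝ) :
    ∑ i : Fin n, ∑ l : Fin (s i).1, φ (path x i (s i) l.succ) =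
      ∑ u : Fin n, (hits s u : ℝ) * φ (x u) := by
  have h1 : ∀ i : Fin n, ∑ l : Fin (s i).1, φ (path x i (s i) l.succ) =
      ∑ u : Fin n, (occ (s i) u : ℝ) * φ (x u) := by
    intro i
    rw [sum_occ_mul (s i) fun u : Fin n => φ (x u)]
    rfl
  simp only [h1]
  rw [Finset.sum_comm]
  refine Finset.sum_congr rfl fun u _ => ?_
  rw [← Finset.sum_mul]
  simp [hits]

/-- The bounded continuous function `y ↦ φ (y l)`. -/
def evalAt {k : ℕ} (φ : V →ᵇ ℝ) (l : Fin k) : (Fin k → V) →ᵇ ℝ :=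
  φ.compContinuous ⟨fun y => y l, continuous_apply l⟩

theorem integral_map_eval {k : ℕ} (ν : Measure (Fin k → V)) (φ : V →ᵇ ℝ) (l : Fin k) :
    ∫ x, φ x ∂(ν.map fun y => y l) = ∫ y, evalAt φ l y ∂ν := by
  rw [integral_map (measurable_pi_apply l).aemeasurable φ.continuous.aestronglyMeasurable]
  rfl

variable {μ : FiniteMeasure V} {x : ℕ → V} {n : ℝ≥0 → ℕ} {kmax : ℕ} {Ψ : Setting V kmax}

theorem tendsto_integral_userMeasure
    (hL : Tendsto (fun lam => userMeasure lam x (n lam)) atTop (𝓝 μ)) (φ : V →ᵇ ℝ) :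
    Tendsto (fun lam : ℝ≥0 => (lam : ℝ)⁻¹ * ∑ i : Fin (n lam), φ (x i)) atTop
      (𝓝 (∫ y, φ y ∂(μ : Measure V))) := by
  have := FiniteMeasure.tendsto_iff_forall_integral_tendsto.1 hL φ
  simpa only [integral_userMeasure] using this

theorem IsReachable.start (h : IsReachable x n Ψ)
    (hL : Tendsto (fun lam => userMeasure lam x (n lam)) atTop (𝓝 μ)) :
    ∑ k : Fin kmax, (Ψ.1 k : Measure (Fin (k + 1) → V)).map (fun y => y 0) = (μ : Measure V) := by
  have hle : ∀ φ : V →ᵇ ℝ, ∑ k : Fin kmax, ∫ y, evalAt φ 0 y ∂(Ψ.1 k : Measure (Fin (k + 1) → V)) ≤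
      ∫ y, φ y ∂(μ : Measure V) := by
    intro φ
    have hc : Continuous fun Ψ : Setting V kmax =>
        ∑ k : Fin kmax, ∫ y, evalAt φ 0 y ∂(Ψ.1 k : Measure (Fin (k + 1) → V)) :=
      continuous_finsetSum _ fun k _ => continuous_integral_traj k (evalAt φ 0)
    refine h.le_of_tendsto hc.continuousAt
      (tendsto_integral_userMeasure hL φ) (Eventually.of_forall fun lam s => ?_)
    simp only [empirical]
    rw [sum_integral_trajMeasure lam x s fun k y => evalAt φ 0 y]
    exact le_of_eq rfl
  have : IsFiniteMeasure (∑ k : Fin kmax,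
      (Ψ.1 k : Measure (Fin (k + 1) → V)).map (fun y => y 0)) := inferInstance
  refine ext_of_forall_integral_eq_of_IsFiniteMeasure fun φ => ?_
  rw [integral_finsetSum_measure fun k _ => φ.integrable _]
  simp only [integral_map_eval]
  refine le_antisymm (hle φ) ?_
  have := hle (-φ)
  have e : ∀ (k : Fin kmax) (y : Fin (k + 1) → V), evalAt (-φ) 0 y = -evalAt φ 0 y :=
    fun k y => rfl
  simp only [e, integral_neg, Finset.sum_neg_distrib, BoundedContinuousFunction.coe_neg,
    Pi.neg_apply] at this
  linarith

theorem IsReachable.users_le (h : IsReachable x n Ψ) (hx : Function.Injective x)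
    (hL : Tendsto (fun lam => userMeasure lam x (n lam)) atTop (𝓝 μ)) (φ : V →ᵇ ℝ)
    (hφ : ∀ x, 0 ≤ φ x) (K : ℕ) :
    ∑ m ∈ Finset.range K, ∫ y, φ y ∂(Ψ.2 m : Measure V) ≤ ∫ y, φ y ∂(μ : Measure V) := by
  have hc : Continuous fun Ψ : Setting V kmax =>
      ∑ m ∈ Finset.range K, ∫ y, φ y ∂(Ψ.2 m : Measure V) :=
    continuous_finsetSum _ fun k _ => continuous_integral_hop k φ
  refine h.le_of_tendsto hc.continuousAt
      (tendsto_integral_userMeasure hL φ) (Eventually.of_forall fun lam s => ?_)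
  simp only [empirical]
  rw [sum_integral_hopMeasure hx lam s K fun _ => φ]
  refine mul_le_mul_of_nonneg_left (Finset.sum_le_sum fun i _ => ?_) (by positivity)
  split_ifs
  · exact le_rfl
  · exact hφ _

theorem IsReachable.relays_le (h : IsReachable x n Ψ) (hx : Function.Injective x) (φ : V →ᵇ ℝ)
    (hφ : ∀ x, 0 ≤ φ x) (K : ℕ) :
    ∑ m ∈ Finset.range K, (m : ℝ) * ∫ y, φ y ∂(Ψ.2 m : Measure V) ≤
      ∑ k : Fin kmax, ∑ l : Fin k,
        ∫ y, evalAt φ l.succ y ∂(Ψ.1 k : Measure (Fin (k + 1) → V)) := by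
  rw [← sub_nonpos]
  have hc : Continuous fun Ψ : Setting V kmax =>
      ∑ m ∈ Finset.range K, (m : ℝ) * ∫ y, φ y ∂(Ψ.2 m : Measure V) -
      ∑ k : Fin kmax, ∑ l : Fin k,
        ∫ y, evalAt φ l.succ y ∂(Ψ.1 k : Measure (Fin (k + 1) → V)) :=
    (continuous_finsetSum _ fun k _ => (continuous_integral_hop k φ).const_mul _).sub
      (continuous_finsetSum _ fun k _ => continuous_finsetSum _ fun l _ =>
        continuous_integral_traj k (evalAt φ l.succ))
  refine h.le_of_tendsto hc.continuousAt
      (tendsto_const_nhds (x := (0 : ℝ))) (Eventually.of_forall fun lam s => ?_)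
  simp only [empirical]
  have e1 : ∀ m : ℕ, (m : ℝ) * ∫ y, φ y ∂(hopMeasure lam x s m : Measure V) =
      ∫ y, (m : ℝ) * φ y ∂(hopMeasure lam x s m : Measure V) := fun m =>
    (integral_const_mul _ _).symm
  have e2 : ∀ k : Fin kmax, ∑ l : Fin k,
      ∫ y, evalAt φ l.succ y ∂(trajMeasure lam x s k : Measure (Fin (k + 1) → V)) =
      ∫ y, ∑ l : Fin k, φ (y l.succ) ∂(trajMeasure lam x s k : Measure (Fin (k + 1) → V)) := by
    intro k
    rw [integral_finsetSum _ fun l _ => (evalAt φ l.succ).integrable _]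
    rfl
  simp only [e1, e2]
  rw [sum_integral_hopMeasure hx lam s K fun m y => (m : ℝ) * φ y,
    sum_integral_trajMeasure lam x s fun k y => ∑ l : Fin k, φ (y l.succ),
    sum_path_succ, ← mul_sub, ← Finset.sum_sub_distrib]
  refine mul_nonpos_of_nonneg_of_nonpos (by positivity) (Finset.sum_nonpos fun i _ => ?_)
  have : 0 ≤ (hits s i : ℝ) * φ (x i) := mul_nonneg (Nat.cast_nonneg _) (hφ _)
  split_ifs <;> linarith

/-! ### Escape of incoming hops to infinity -/

open Classical in
/-- The number of incoming hops at users with at least `K` incoming hops. -/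
def tailHits {n kmax : ℕ} (s : Config n kmax) (K : ℕ) : ℕ :=
  ∑ u, if K ≤ hits s u then hits s u else 0

theorem relayCount_le {n kmax : ℕ} (s : Config n kmax) : relayCount s ≤ n * kmax := by
  calc relayCount s ≤ ∑ _j : Fin n, kmax := Finset.sum_le_sum fun j _ => (s j).1.2.le
    _ = n * kmax := by simp

theorem exists_prior_tail_le (hk : 1 ≤ kmax) {w : ℝ} (hw : 0 < w)
    (hn : Tendsto (fun lam : ℝ≥0 => (n lam : ℝ) / lam) atTop (𝓝 w)) {ε : ℝ} (hε : 0 < ε) (a : ℝ) :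
    ∃ K, 1 ≤ K ∧ ∀ᶠ lam : ℝ≥0 in atTop,
      prior {s : Config (n lam) kmax | lam * ε ≤ tailHits s K} ≤ Real.exp (-(lam * a)) := by
  let ρ : Fin 1 → ℝ := fun _ => (w + 1) * kmax
  have hk0 : (0 : ℝ) < kmax := by exact_mod_cast hk
  have hρ : ∀ b, 0 < ρ b := fun b => by simp only [ρ]; positivity
  let g : Fin 1 → LabelPath (Fin 1) kmax → ℝ := fun _ _ => 0
  let Z := trajNorm g ρ 0
  let θ := (a + (w + 1) * |Z - 1| + (w + 1) - (w * Real.log kmax - 1 / Real.exp 1 - 1)) / ε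
  have hsθ : Summable fun m : ℕ => poissonWeight w m * Real.exp (|θ| * m) := by
    have h := NormedSpace.expSeries_div_summable (𝔸 := ℝ)
      (Real.exp |θ| * (1 / (Real.exp 1 * w)))
    refine (h.mul_left (Real.exp (-(1 / (Real.exp 1 * w))))).congr fun m => ?_
    rw [poissonWeight, mul_comm |θ|, Real.exp_nat_mul, mul_pow]
    ring
  obtain ⟨K, hK1, hK⟩ : ∃ K, 1 ≤ K ∧
      ∑' m, poissonWeight w (m + K) * Real.exp (|θ| * (m + K : ℕ)) ≤ 1 := by
    have := (tendsto_sum_nat_add fun m : ℕ => poissonWeight w m * Real.exp (|θ| * m))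
    obtain ⟨K, h1, h2⟩ := ((this.eventually_le_const one_pos).and (eventually_ge_atTop 1)).exists
    exact ⟨K, h2, h1⟩
  let h : Fin 1 → ℕ → ℝ := fun _ m => if K ≤ m then |θ| * m else 0
  have hterm : ∀ m, poissonWeight w m * Real.exp (h 0 m) ≤
      poissonWeight w m + if K ≤ m then poissonWeight w m * Real.exp (|θ| * m) else 0 := by
    intro m
    have := (poissonWeight_pos hw m).le
    simp only [h]
    split_ifs
    · linarith
    · simp
  have htail : Summable fun m =>
      if K ≤ m then poissonWeight w m * Real.exp (|θ| * m) else 0 := by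
    refine Summable.of_nonneg_of_le (fun m => ?_) (fun m => ?_) hsθ
    · split_ifs
      · exact (mul_pos (poissonWeight_pos hw m) (Real.exp_pos _)).le
      · exact le_rfl
    · have := (mul_pos (poissonWeight_pos hw m) (Real.exp_pos (|θ| * m))).le
      split_ifs
      · exact le_rfl
      · exact this
  have hsum : ∀ b, Summable fun m => poissonWeight w m * Real.exp (h b m) := fun b =>
    Summable.of_nonneg_of_le
      (fun m => (mul_pos (poissonWeight_pos hw m) (Real.exp_pos _)).le) hterm
      ((hasSum_poissonWeight w).summable.add htail)
  have hY : ∀ b, hopNorm w h b ≤ 2 := by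
    intro b
    refine ((hsum b).tsum_le_tsum hterm ((hasSum_poissonWeight w).summable.add htail)).trans ?_
    rw [(hasSum_poissonWeight w).summable.tsum_add htail, (hasSum_poissonWeight w).tsum_eq,
      ← htail.sum_add_tsum_nat_add K]
    have h0 : ∑ m ∈ Finset.range K,
        (if K ≤ m then poissonWeight w m * Real.exp (|θ| * m) else 0) = 0 :=
      Finset.sum_eq_zero fun m hm => if_neg (not_le.2 (Finset.mem_range.1 hm))
    rw [h0]
    simp only [le_add_iff_nonneg_left, zero_le, if_true, zero_add]
    linarith
  refine ⟨K, hK1, ?_⟩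
  have hn1 := hn.eventually_le_const (u := w + 1) (by linarith)
  filter_upwards [eventually_le_tilt_remainder (kmax := kmax) hw hn ρ hρ one_pos, hn1,
    tendsto_coe_atTop_real.eventually_gt_atTop 0] with lam hrem hn1 hl
  have hnl : (n lam : ℝ) ≤ lam * (w + 1) := by
    rwa [div_le_iff₀ hl, mul_comm] at hn1
  refine prior_le_exp hk (fun _ => (0 : Fin 1)) g ρ hρ hw h hsum _ _ fun s hs => ?_
  have hs' : lam * ε ≤ (tailHits s K : ℝ) := hs
  have h1 := hrem (fun _ => 0) s (fun b => by
    have h2 : hits (fun j => relabel (fun _ => (0 : Fin 1)) (s j)) b ≤ relayCount s := by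
      have h3 := sum_hits (fun j => relabel (fun _ => (0 : Fin 1)) (s j))
      have h4 : relayCount s = relayCount (fun j => relabel (fun _ => (0 : Fin 1)) (s j)) := rfl
      rw [h4, ← h3]
      exact Finset.single_le_sum (f := fun b => hits (fun j => relabel (fun _ => (0 : Fin 1)) (s j)) b)
        (fun _ _ => Nat.zero_le _) (Finset.mem_univ b)
    have h3 : (relayCount s : ℝ) ≤ n lam * kmax := by exact_mod_cast relayCount_le s
    have h4 : (hits (fun j => relabel (fun _ => (0 : Fin 1)) (s j)) b : ℝ) ≤ relayCount s := by
      exact_mod_cast h2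
    simp only [ρ]
    nlinarith)
  unfold tiltExponent
  have e1 : ∑ u : Fin (n lam), h 0 (hits s u) = |θ| * tailHits s K := by
    simp only [h, tailHits, Nat.cast_sum, Finset.mul_sum]
    refine Finset.sum_congr rfl fun u _ => ?_
    split_ifs <;> simp
  have e2 : ∑ _j : Fin (n lam), (trajNorm g ρ 0 - 1) ≤ lam * ((w + 1) * |Z - 1|) := by
    simp only [Finset.sum_const, Finset.card_univ, Fintype.card_fin, nsmul_eq_mul]
    have : trajNorm g ρ 0 - 1 ≤ |Z - 1| := le_abs_self _
    have h0 := abs_nonneg (Z - 1)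
    have h5 : (0 : ℝ) ≤ n lam := Nat.cast_nonneg _
    nlinarith
  have e3 : ∑ _j : Fin (n lam), (hopNorm w h 0 - 1) ≤ lam * (w + 1) := by
    simp only [Finset.sum_const, Finset.card_univ, Fintype.card_fin, nsmul_eq_mul]
    have := hY 0
    have h5 : (0 : ℝ) ≤ n lam := Nat.cast_nonneg _
    nlinarith
  have e4 : θ * (lam * ε) ≤ |θ| * tailHits s K :=
    (mul_le_mul_of_nonneg_right (le_abs_self θ) (by positivity)).trans
      (mul_le_mul_of_nonneg_left hs' (abs_nonneg _))
  have e5 : θ * (lam * ε) = lam * (a + (w + 1) * |Z - 1| + (w + 1)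
      - (w * Real.log kmax - 1 / Real.exp 1 - 1)) := by
    simp only [θ]
    field_simp
  have e6 : ∑ j : Fin (n lam), g 0 (relabel (fun _ => (0 : Fin 1)) (s j)) = 0 := by
    simp [g]
  rw [e1, e6]
  rw [e5] at e4
  linarith

end Limit

end

end MultihopGibbs

namespace MultihopGibbs

noncomputable section

open BoundedContinuousFunction

section Limit

variable {V : Type*} [MetricSpace V] [CompactSpace V] [MeasurableSpace V] [BorelSpace V]

/-- The sum of the distributions of the relays. -/
def relayMarginal {kmax : ℕ} (Ψ : Setting V kmax) : Measure V :=
  ∑ k : Fin kmax, ∑ l : Fin k, (Ψ.1 k : Measure (Fin (k + 1) → V)).map (fun y => y l.succ)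

instance {kmax : ℕ} (Ψ : Setting V kmax) : IsFiniteMeasure (relayMarginal Ψ) := by
  unfold relayMarginal; infer_instance

theorem integral_relayMarginal {kmax : ℕ} (Ψ : Setting V kmax) (φ : V →ᵇ ℝ) :
    ∫ y, φ y ∂(relayMarginal Ψ) = ∑ k : Fin kmax, ∑ l : Fin k,
        ∫ y, evalAt φ l.succ y ∂(Ψ.1 k : Measure (Fin (k + 1) → V)) := by
  rw [relayMarginal, integral_finsetSum_measure fun k _ => φ.integrable _]
  refine Finset.sum_congr rfl fun k _ => ?_
  rw [integral_finsetSum_measure fun k _ => φ.integrable _]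
  exact Finset.sum_congr rfl fun l _ => integral_map_eval _ _ _

variable {μ : FiniteMeasure V} {x : ℕ → V} {n : ℝ≥0 → ℕ} {kmax : ℕ} {Ψ : Setting V kmax}

theorem prior_mono {n kmax : ℕ} {B B' : Set (Config n kmax)} (h : B ⊆ B') :
    prior B ≤ prior B' := by
  unfold prior
  refine Finset.sum_le_sum_of_subset_of_nonneg ?_ fun s _ _ => ?_
  · intro s hs
    simp only [Finset.mem_filter, Finset.mem_univ, true_and] at hs ⊢
    exact h hs
  · exact Finset.prod_nonneg fun i _ => by positivity

theorem exists_prior_le_of_not_isAdmissible (hk : 1 ≤ kmax) (hμ : 0 < (μ.mass : ℝ))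
    (hx : Function.Injective x)
    (hL : Tendsto (fun lam => userMeasure lam x (n lam)) atTop (𝓝 μ))
    (hΨ : ¬ IsAdmissible μ Ψ) (a : ℝ) :
    ∃ U ∈ 𝓝 Ψ, ∀ᶠ lam : ℝ≥0 in atTop,
      prior {s : Config (n lam) kmax | empirical lam x s ∈ U} ≤ Real.exp (-(lam * a)) := by
  have hn := tendsto_card_div hL
  have hmassμ : (μ : Measure V).real Set.univ = μ.mass := rfl
  obtain ⟨φ, hφ⟩ : ∃ φ : V →ᵇ ℝ, ∀ y, φ y = 1 :=
    ⟨BoundedContinuousFunction.const V 1, fun y => rfl⟩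
  have hone : ∀ ρ : Measure V, ∫ y, φ y ∂ρ = ρ.real Set.univ := fun ρ => by simp [hφ]
  by_cases hreach : IsReachable x n Ψ
  swap
  · simp only [IsReachable, not_forall, not_frequently, not_exists] at hreach
    obtain ⟨U, hU, h⟩ := hreach
    refine ⟨U, hU, h.mono fun lam hlam => ?_⟩
    have : {s : Config (n lam) kmax | empirical lam x s ∈ U} = ∅ :=
      Set.eq_empty_of_forall_notMem hlam
    rw [this, prior]
    simpa using (Real.exp_pos _).le
  have hstart := hreach.start hL
  by_cases husers : Measure.sum (fun m : ℕ => (Ψ.2 m : Measure V)) = (μ : Measure V)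
  · have hrelays : ¬ relayMeasure Ψ = relayMarginal Ψ := fun h => hΨ ⟨hstart, husers, h⟩
    have hgap : ∃ ε > 0, ∀ K, ∑ m ∈ Finset.range K, (m : ℝ) * (Ψ.2 m : Measure V).real Set.univ ≤
        (relayMarginal Ψ).real Set.univ - ε := by
      by_contra! hcon
      refine hrelays (sum_smul_eq_of_forall_integral_le (relayMarginal Ψ) Ψ.2 (fun m => m) ?_ hcon)
      intro φ hφ K
      rw [integral_relayMarginal]
      exact hreach.relays_le hx φ hφ K
    obtain ⟨ε, hε, hgap⟩ := hgap
    obtain ⟨K, hK1, hK⟩ := exists_prior_tail_le (n := n) hk hμ hn (half_pos hε) a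
    have hc : Continuous fun Ψ : Setting V kmax =>
        ∑ m ∈ Finset.range K, (m : ℝ) * ∫ y, φ y ∂(Ψ.2 m : Measure V) -
        ∑ k : Fin kmax, ∑ l : Fin k,
          ∫ y, evalAt φ l.succ y ∂(Ψ.1 k : Measure (Fin (k + 1) → V)) :=
      (continuous_finsetSum _ fun k _ => (continuous_integral_hop k φ).const_mul _).sub
        (continuous_finsetSum _ fun k _ => continuous_finsetSum _ fun l _ =>
          continuous_integral_traj k (evalAt φ l.succ))
    refine ⟨_, hc.continuousAt.eventually_lt_const (u := -(ε / 2)) ?_, ?_⟩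
    · have e := integral_relayMarginal Ψ φ
      simp only [hone] at e ⊢
      linarith [hgap K]
    · filter_upwards [hK, tendsto_coe_atTop_real.eventually_gt_atTop 0] with lam hlam hl
      refine le_trans (prior_mono fun s hs => ?_) hlam
      rw [Set.mem_ofPred_eq] at hs ⊢
      have hs' : ∑ m ∈ Finset.range K, (m : ℝ) * ∫ y, φ y ∂(hopMeasure lam x s m : Measure V) -
        ∑ k : Fin kmax, ∑ l : Fin k,
          ∫ y, evalAt φ l.succ y ∂(trajMeasure lam x s k : Measure (Fin (k + 1) → V)) < -(ε / 2) :=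
        hs
      have e1 : ∀ m : ℕ, (m : ℝ) * ∫ y, φ y ∂(hopMeasure lam x s m : Measure V) =
          ∫ y, (m : ℝ) * φ y ∂(hopMeasure lam x s m : Measure V) := fun m =>
        (integral_const_mul _ _).symm
      have e2 : ∀ k : Fin kmax, ∑ l : Fin k,
          ∫ y, evalAt φ l.succ y ∂(trajMeasure lam x s k : Measure (Fin (k + 1) → V)) =
          ∫ y, ∑ l : Fin k, φ (y l.succ) ∂(trajMeasure lam x s k : Measure (Fin (k + 1) → V)) := by
        intro k
        rw [integral_finsetSum _ fun l _ => (evalAt φ l.succ).integrable _]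
        rfl
      simp only [e1, e2] at hs'
      rw [sum_integral_hopMeasure hx lam s K fun m y => (m : ℝ) * φ y,
        sum_integral_trajMeasure lam x s fun k y => ∑ l : Fin k, φ (y l.succ),
        sum_path_succ, ← mul_sub, ← Finset.sum_sub_distrib] at hs'
      have e3 : ∑ i : Fin (n lam), ((if hits s i < K then (hits s i : ℝ) * φ (x i) else 0) -
          (hits s i : ℝ) * φ (x i)) = -(tailHits s K : ℝ) := by
        simp only [tailHits, Nat.cast_sum]
        rw [← Finset.sum_neg_distrib]
        refine Finset.sum_congr rfl fun i _ => ?_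
        rcases lt_or_ge (hits s i) K with h | h
        · simp [h, not_le.2 h]
        · simp [h, not_lt.2 h, hφ]
      rw [e3, inv_mul_lt_iff₀ hl] at hs'
      linarith
  · have hgap : ∃ ε > 0, ∀ K, ∑ m ∈ Finset.range K, (Ψ.2 m : Measure V).real Set.univ ≤
        μ.mass - ε := by
      by_contra! hcon
      have := sum_smul_eq_of_forall_integral_le (μ : Measure V) Ψ.2 (fun _ => 1) ?_ ?_
      · simp only [Nat.cast_one, one_smul] at this
        exact husers this
      · intro φ hφ K
        simpa using hreach.users_le hx hL φ hφ K
      · simpa [hmassμ] using hcon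
    obtain ⟨ε, hε, hgap⟩ := hgap
    obtain ⟨K, hK1, hK⟩ := exists_prior_tail_le (n := n) hk hμ hn
      (show 0 < ε / 4 by positivity) a
    have hc : Continuous fun Ψ : Setting V kmax =>
        ∑ m ∈ Finset.range K, ∫ y, φ y ∂(Ψ.2 m : Measure V) :=
      continuous_finsetSum _ fun k _ => continuous_integral_hop k φ
    refine ⟨_, hc.continuousAt.eventually_lt_const (u := μ.mass - ε / 2) ?_, ?_⟩
    · simp only [hone]
      linarith [hgap K]
    · filter_upwards [hK, tendsto_coe_atTop_real.eventually_gt_atTop 0,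
        hn.eventually_const_lt (u := μ.mass - ε / 4) (by linarith)] with lam hlam hl hnl
      refine le_trans (prior_mono fun s hs => ?_) hlam
      rw [Set.mem_ofPred_eq] at hs ⊢
      have hs' : ∑ m ∈ Finset.range K, ∫ y, φ y ∂(hopMeasure lam x s m : Measure V) <
        μ.mass - ε / 2 := hs
      rw [sum_integral_hopMeasure hx lam s K fun _ => φ, inv_mul_lt_iff₀ hl] at hs'
      rw [lt_div_iff₀ hl] at hnl
      have e3 : (n lam : ℝ) ≤
          (∑ i : Fin (n lam), if hits s i < K then φ (x i) else 0) + tailHits s K := by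
        have : (n lam : ℝ) = ∑ _i : Fin (n lam), (1 : ℝ) := by simp
        rw [this]
        simp only [tailHits, Nat.cast_sum]
        rw [← Finset.sum_add_distrib]
        refine Finset.sum_le_sum fun i _ => ?_
        rcases lt_or_ge (hits s i) K with h | h
        · simp [h, hφ, not_le.2 h]
        · have : (1 : ℝ) ≤ hits s i := by exact_mod_cast hK1.trans h
          simpa [h, not_lt.2 h] using this
      linarith

/-! ### Test functions from a lower bound on the rate function -/

theorem exists_real_lt_add {y z : ℝ≥0∞} {b : ℝ} (h : (b : EReal) < (y : EReal) + (z : EReal)) :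
    ∃ b₁ b₂ : ℝ, (b₁ : EReal) < y ∧ (b₂ : EReal) < z ∧ b ≤ b₁ + b₂ := by
  have hneg : ∀ z : ℝ≥0∞, ((-1 : ℝ) : EReal) < z := fun z =>
    lt_of_lt_of_le (by exact_mod_cast (by norm_num : (-1 : ℝ) < 0)) (EReal.coe_ennreal_nonneg z)
  rcases eq_or_ne y ⊤ with rfl | hy
  · exact ⟨b + 1, -1, by simpa using EReal.coe_lt_top (b + 1), hneg z, by linarith⟩
  rcases eq_or_ne z ⊤ with rfl | hz
  · exact ⟨-1, b + 1, hneg y, by simpa using EReal.coe_lt_top (b + 1), by linarith⟩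
  lift y to ℝ≥0 using hy
  lift z to ℝ≥0 using hz
  have h' : b < (y : ℝ) + z := by
    have : ((y : ℝ≥0∞) : EReal) + ((z : ℝ≥0∞) : EReal) = (((y : ℝ) + (z : ℝ) : ℝ) : EReal) := by
      norm_cast
    rw [this] at h
    exact_mod_cast h
  have e : ∀ y : ℝ≥0, ((y : ℝ≥0∞) : EReal) = ((y : ℝ) : EReal) := fun y => by norm_cast
  refine ⟨y - (y + z - b) / 2, z - (y + z - b) / 2, ?_, ?_, by linarith⟩
  · rw [e, EReal.coe_lt_coe_iff]; linarith
  · rw [e, EReal.coe_lt_coe_iff]; linarith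

theorem exists_real_lt_sum {ι : Type*} (s : Finset ι) (y : ι → ℝ≥0∞) {b : ℝ}
    (h : (b : EReal) < ((∑ i ∈ s, y i : ℝ≥0∞) : EReal)) :
    ∃ c : ι → ℝ, (∀ i ∈ s, (c i : EReal) < y i) ∧ b ≤ ∑ i ∈ s, c i := by
  classical
  induction s using Finset.induction_on generalizing b with
  | empty =>
    refine ⟨fun _ => 0, by simp, ?_⟩
    simp only [Finset.sum_empty, EReal.coe_ennreal_zero] at h ⊢
    exact le_of_lt (by exact_mod_cast h)
  | insert i s hi ih =>
    rw [Finset.sum_insert hi, EReal.coe_ennreal_add] at h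
    obtain ⟨b₁, b₂, h₁, h₂, hb⟩ := exists_real_lt_add h
    obtain ⟨c, hc, hcb⟩ := ih h₂
    refine ⟨Function.update c i b₁, fun j hj => ?_, ?_⟩
    · by_cases hji : j = i
      · subst hji; simpa using h₁
      · rw [Function.update_of_ne hji]
        exact hc j ((Finset.mem_insert.1 hj).resolve_left hji)
    · rw [Finset.sum_insert hi, Function.update_self, Finset.sum_congr rfl (g := c)]
      · linarith
      · intro j hj
        rw [Function.update_of_ne]
        rintro rfl
        exact hi hj

theorem exists_continuous_lt_of_coe_lt_klDiv {X : Type*} [TopologicalSpace X] [NormalSpace X]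
    [MeasurableSpace X] [BorelSpace X] (ν ρ : Measure X)
    [IsFiniteMeasure ν] [IsFiniteMeasure ρ] [(ν + ρ).WeaklyRegular] {a : ℝ}
    (ha : (a : EReal) < (InformationTheory.klDiv ν ρ : ℝ≥0∞)) :
    ∃ g : X →ᵇ ℝ, a < ∫ x, g x ∂ν - ∫ x, (Real.exp (g x) - 1) ∂ρ := by
  rcases lt_or_ge a 0 with h | h
  · exact ⟨0, by simpa using h⟩
  · refine exists_continuous_lt_of_lt_klDiv ν ρ ?_
    have : (a : EReal) = ((ENNReal.ofReal a : ℝ≥0∞) : EReal) := by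
      rw [EReal.coe_ennreal_ofReal, max_eq_left h]
    rw [this] at ha
    exact_mod_cast ha

theorem IsAdmissible.relayMeasure_eq (hΨ : IsAdmissible μ Ψ) : relayMeasure Ψ = relayMarginal Ψ :=
  hΨ.relays

theorem IsAdmissible.isFiniteMeasure (hΨ : IsAdmissible μ Ψ) : IsFiniteMeasure (relayMeasure Ψ) := by
  rw [hΨ.relayMeasure_eq]; infer_instance

theorem isFiniteMeasure_referenceMeasure (hΨ : IsAdmissible μ Ψ) (k : ℕ) :
    IsFiniteMeasure (referenceMeasure μ Ψ k) := by
  have := hΨ.isFiniteMeasure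
  unfold referenceMeasure
  have : ∀ i, IsFiniteMeasure
      ((Fin.cons (μ : Measure V) (fun _ => relayMeasure Ψ) : Fin (k + 1) → Measure V) i) := by
    intro i
    refine Fin.cases ?_ (fun i => ?_) i
    · rw [Fin.cons_zero]; infer_instance
    · rw [Fin.cons_succ]; infer_instance
  infer_instance

theorem exists_test_functions (hΨ : IsAdmissible μ Ψ) {a : ℝ} (ha : (a : EReal) < rate μ Ψ) :
    ∃ (g : ∀ k : Fin kmax, (Fin (k + 1) → V) →ᵇ ℝ) (K : ℕ) (h : ℕ → V →ᵇ ℝ),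
      a < ∑ k : Fin kmax, (∫ y, g k y ∂(Ψ.1 k : Measure (Fin (k + 1) → V))
          - ∫ y, (Real.exp (g k y) - 1) ∂(referenceMeasure μ Ψ k))
        + ∑ m ∈ Finset.range K, (∫ y, h m y ∂(Ψ.2 m : Measure V)
          - poissonWeight μ.mass m * ∫ y, (Real.exp (h m y) - 1) ∂(μ : Measure V))
        + (μ.mass : ℝ) * (1 - ∑ k : Fin kmax, (relayMeasure Ψ).real Set.univ ^ (k : ℕ))
        - 1 / Real.exp 1 + μ.mass * Real.log kmax := by
  have hfin := isFiniteMeasure_referenceMeasure hΨ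
  set r : ℝ := (μ.mass : ℝ) * (1 - ∑ k : Fin kmax, (relayMeasure Ψ).real Set.univ ^ (k : ℕ))
        - 1 / Real.exp 1 + μ.mass * Real.log kmax with hr
  rw [rate, if_pos hΨ, entropy, add_assoc, ← EReal.coe_add, ← hr] at ha
  set S₁ := ∑ k : Fin kmax, InformationTheory.klDiv (Ψ.1 k : Measure (Fin (k + 1) → V))
        (referenceMeasure μ Ψ k)
  set S₂ := ∑' m : ℕ, InformationTheory.klDiv (Ψ.2 m : Measure V)
        (ENNReal.ofReal (poissonWeight (μ.mass : ℝ) m) • (μ : Measure V))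
  have ha' : ((a - r : ℝ) : EReal) < (S₁ : EReal) + (S₂ : EReal) := by
    rw [EReal.coe_sub]
    exact EReal.sub_lt_of_lt_add ha
  obtain ⟨b, hb1, hb2⟩ := EReal.lt_iff_exists_real_btwn.1 ha'
  obtain ⟨b₁, b₂, h₁, h₂, hb⟩ := exists_real_lt_add hb2
  have hab : a - r < b := by exact_mod_cast hb1
  obtain ⟨c, hc, hcb⟩ := exists_real_lt_sum _ _ h₁
  have h₂' : ∃ K, (b₂ : EReal) < ((∑ m ∈ Finset.range K, InformationTheory.klDiv (Ψ.2 m : Measure V)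
        (ENNReal.ofReal (poissonWeight (μ.mass : ℝ) m) • (μ : Measure V)) : ℝ≥0∞) : EReal) :=
    (((continuous_coe_ennreal_ereal.tendsto _).comp
      (ENNReal.tendsto_nat_tsum _)).eventually_const_lt h₂).exists
  obtain ⟨K, hK⟩ := h₂'
  obtain ⟨d, hd, hdb⟩ := exists_real_lt_sum _ _ hK
  have hg : ∀ k : Fin kmax, ∃ g : (Fin (k + 1) → V) →ᵇ ℝ,
      c k < ∫ y, g y ∂(Ψ.1 k : Measure (Fin (k + 1) → V))
          - ∫ y, (Real.exp (g y) - 1) ∂(referenceMeasure μ Ψ k) := by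
    intro k
    exact exists_continuous_lt_of_coe_lt_klDiv _ _ (hc k (Finset.mem_univ k))
  have hh : ∀ m, ∃ h : V →ᵇ ℝ, m ∈ Finset.range K → d m < ∫ y, h y ∂(Ψ.2 m : Measure V)
          - poissonWeight μ.mass m * ∫ y, (Real.exp (h y) - 1) ∂(μ : Measure V) := by
    intro m
    by_cases hm : m ∈ Finset.range K
    · have : IsFiniteMeasure (ENNReal.ofReal (poissonWeight (μ.mass : ℝ) m) • (μ : Measure V)) :=
        Measure.smul_finite _ ENNReal.ofReal_ne_top
      obtain ⟨h, hh⟩ := exists_continuous_lt_of_coe_lt_klDiv _ _ (hd m hm)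
      refine ⟨h, fun _ => ?_⟩
      rw [integral_smul_measure, ENNReal.toReal_ofReal] at hh
      · exact hh
      · unfold poissonWeight; positivity
    · exact ⟨0, fun h => absurd h hm⟩
  choose g hg using hg
  choose h hh using hh
  refine ⟨g, K, h, ?_⟩
  have e1 : ∑ k : Fin kmax, c k ≤ _ := Finset.sum_le_sum fun k _ => (hg k).le
  have e2 : ∑ m ∈ Finset.range K, d m ≤ _ := Finset.sum_le_sum fun m hm => (hh m hm).le
  linarith

end Limit

end

end MultihopGibbs

namespace MultihopGibbs

noncomputable section

open BoundedContinuousFunction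

section Limit

variable {V : Type*} [MetricSpace V] [CompactSpace V] [MeasurableSpace V] [BorelSpace V]
variable {μ : FiniteMeasure V} {x : ℕ → V} {n : ℝ≥0 → ℕ} {kmax : ℕ} {Ψ : Setting V kmax}

theorem referenceMeasure_real_cell (hΨ : IsAdmissible μ Ψ) {N : ℕ} (c : V → Fin N) (k : ℕ)
    (a : Fin N) (α : Fin k → Fin N) :
    (referenceMeasure μ Ψ k).real ((fun y => c ∘ y) ⁻¹' {Fin.cons a α}) =
      (μ : Measure V).real (c ⁻¹' {a}) * ∏ l, (relayMeasure Ψ).real (c ⁻¹' {α l}) := by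
  have := hΨ.isFiniteMeasure
  have hs : ∀ i, SigmaFinite
      ((Fin.cons (μ : Measure V) (fun _ => relayMeasure Ψ) : Fin (k + 1) → Measure V) i) := by
    intro i
    refine Fin.cases ?_ (fun i => ?_) i
    · rw [Fin.cons_zero]; infer_instance
    · rw [Fin.cons_succ]; infer_instance
  have hset : ((fun y : Fin (k + 1) → V => c ∘ y) ⁻¹' {Fin.cons a α}) =
      Set.univ.pi fun i => c ⁻¹' {(Fin.cons a α : Fin (k + 1) → Fin N) i} := by
    ext y
    simp [funext_iff, Set.mem_pi]
  rw [hset, Measure.real, referenceMeasure, Measure.pi_pi, ENNReal.toReal_prod, Fin.prod_univ_succ]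
  simp [Measure.real]

theorem measurable_cells {N : ℕ} {c : V → Fin N} (hc : Measurable c) (k : ℕ) :
    Measurable fun y : Fin k → V => c ∘ y :=
  measurable_pi_lambda _ fun l => hc.comp (measurable_pi_apply l)

theorem sum_cells_eq (ν : ∀ k : Fin kmax, Measure (Fin (k + 1) → V)) [∀ k, IsFiniteMeasure (ν k)]
    {N : ℕ} {c : V → Fin N} (hc : Measurable c) (F : Fin N → LabelPath (Fin N) kmax → ℝ) :
    ∑ a, ∑ t : LabelPath (Fin N) kmax, F a t *
      (ν t.1).real ((fun y => c ∘ y) ⁻¹' {(Fin.cons a t.2 : Fin (t.1 + 1) → Fin N)}) =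
    ∑ k : Fin kmax, ∫ y, F (c (y 0)) ⟨k, fun l => c (y l.succ)⟩ ∂(ν k) := by
  have h1 : ∀ k : Fin kmax,
      ∫ y, F (c (y 0)) ⟨k, fun l => c (y l.succ)⟩ ∂(ν k) =
      ∑ a, ∑ α : Fin k → Fin N, F a ⟨k, α⟩ *
        (ν k).real ((fun y => c ∘ y) ⁻¹' {(Fin.cons a α : Fin (k + 1) → Fin N)}) := by
    intro k
    have := integral_comp_finite (ν k) (measurable_cells hc (k + 1))
      (fun β => F (β 0) ⟨k, fun l => β l.succ⟩)
    simp only [Function.comp_apply] at this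
    rw [this, ← (Fin.consEquiv fun _ : Fin (k + 1) => Fin N).sum_comp, Fintype.sum_prod_type]
    refine Finset.sum_congr rfl fun a _ => Finset.sum_congr rfl fun α _ => ?_
    simp only [Fin.consEquiv, Equiv.coe_fn_mk, Fin.cons_zero, Fin.cons_succ]
    rw [mul_comm]
  simp only [h1, Fintype.sum_sigma]
  rw [Finset.sum_comm]

theorem sum_cells_eq_sum_integral (hΨ : IsAdmissible μ Ψ) {N : ℕ} {c : V → Fin N}
    (hc : Measurable c) (F : Fin N → LabelPath (Fin N) kmax → ℝ) :
    ∑ a, (μ : Measure V).real (c ⁻¹' {a}) *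
      ∑ t : LabelPath (Fin N) kmax, F a t * ∏ l, (relayMeasure Ψ).real (c ⁻¹' {t.2 l}) =
    ∑ k : Fin kmax, ∫ y, F (c (y 0)) ⟨k, fun l => c (y l.succ)⟩ ∂(referenceMeasure μ Ψ k) := by
  have hfin := fun k : Fin kmax => isFiniteMeasure_referenceMeasure hΨ k
  rw [← sum_cells_eq (fun k : Fin kmax => referenceMeasure μ Ψ k) hc F]
  refine Finset.sum_congr rfl fun a _ => ?_
  rw [Finset.mul_sum]
  refine Finset.sum_congr rfl fun t _ => ?_
  rw [referenceMeasure_real_cell hΨ]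
  ring

theorem referenceMeasure_real_univ (hΨ : IsAdmissible μ Ψ) (k : ℕ) :
    (referenceMeasure μ Ψ k).real Set.univ = μ.mass * (relayMeasure Ψ).real Set.univ ^ k := by
  have := hΨ.isFiniteMeasure
  have hs : ∀ i, SigmaFinite
      ((Fin.cons (μ : Measure V) (fun _ => relayMeasure Ψ) : Fin (k + 1) → Measure V) i) := by
    intro i
    refine Fin.cases ?_ (fun i => ?_) i
    · rw [Fin.cons_zero]; infer_instance
    · rw [Fin.cons_succ]; infer_instance
  rw [Measure.real, referenceMeasure, Measure.pi_univ, ENNReal.toReal_prod, Fin.prod_univ_succ]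
  simp [Measure.real]
  exact Or.inl rfl

theorem measurable_indicator_one {c : Set V} (hc : MeasurableSet c) :
    Measurable (c.indicator fun _ => (1 : ℝ)) := measurable_const.indicator hc

theorem integral_relayMarginal_empirical (lam : ℝ≥0) {n : ℕ} (s : Config n kmax) {f : V → ℝ}
    (hf : Measurable f) {C : ℝ} (hC : ∀ y, |f y| ≤ C) :
    ∫ y, f y ∂(relayMarginal (empirical lam x s)) =
      (lam : ℝ)⁻¹ * ∑ u : Fin n, (hits s u : ℝ) * f (x u) := by
  have hi : ∀ (ρ : Measure V) [IsFiniteMeasure ρ], Integrable f ρ := fun ρ _ =>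
    Integrable.of_bound hf.aestronglyMeasurable C (ae_of_all _ hC)
  rw [relayMarginal, integral_finsetSum_measure fun k _ => hi _]
  have e : ∀ k : Fin kmax, ∫ y, f y ∂(∑ l : Fin k,
      ((empirical lam x s).1 k : Measure (Fin (k + 1) → V)).map fun y => y l.succ) =
      ∫ y, ∑ l : Fin k, f (y l.succ) ∂(trajMeasure lam x s k : Measure (Fin (k + 1) → V)) := by
    intro k
    rw [integral_finsetSum_measure fun k _ => hi _, integral_finsetSum]
    · refine Finset.sum_congr rfl fun l _ => ?_
      rw [integral_map (measurable_pi_apply _).aemeasurable hf.aestronglyMeasurable]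
      rfl
    · intro l _
      exact Integrable.of_bound (hf.comp (measurable_pi_apply _)).aestronglyMeasurable C
        (ae_of_all _ fun y => hC _)
  simp only [e]
  rw [sum_integral_trajMeasure lam x s fun k y => ∑ l : Fin k, f (y l.succ), sum_path_succ]

theorem hits_relabel_eq {lam : ℝ≥0} (hl : 0 < (lam : ℝ)) {n N : ℕ} (s : Config n kmax)
    {c : V → Fin N} (hc : Measurable c) (a : Fin N) :
    (hits (fun j => relabel (fun i : Fin n => c (x i)) (s j)) a : ℝ) =
      lam * (relayMarginal (empirical lam x s)).real (c ⁻¹' {a}) := by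
  have hm : MeasurableSet (c ⁻¹' {a}) := hc (measurableSet_singleton a)
  have h := integral_relayMarginal_empirical (x := x) lam s (measurable_indicator_one hm)
    (C := 1) (fun y => by by_cases hy : y ∈ c ⁻¹' {a} <;> simp [Set.indicator, hy])
  rw [integral_indicator_const _ hm, smul_eq_mul, mul_one] at h
  rw [h, ← mul_assoc, mul_inv_cancel₀ hl.ne', one_mul, hits_relabel, Nat.cast_sum,
    Finset.sum_filter]
  refine Finset.sum_congr rfl fun u _ => ?_
  by_cases hu : c (x u) = a <;> simp [hu, Set.indicator]

/-- `relayMarginal` as a finite measure. -/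
def relayFinite {kmax : ℕ} (Ψ : Setting V kmax) : FiniteMeasure V :=
  ∑ k : Fin kmax, ∑ l : Fin k, (Ψ.1 k).map (fun y => y l.succ)

theorem relayFinite_coe {kmax : ℕ} (Ψ : Setting V kmax) :
    (relayFinite Ψ : Measure V) = relayMarginal Ψ := by
  simp only [relayFinite, relayMarginal, FiniteMeasure.toMeasure_sum, FiniteMeasure.toMeasure_map]

theorem continuous_relayFinite : Continuous (relayFinite : Setting V kmax → FiniteMeasure V) := by
  unfold relayFinite
  refine continuous_finsetSum _ fun k _ => continuous_finsetSum _ fun l _ => ?_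
  exact (FiniteMeasure.continuous_map (continuous_apply l.succ)).comp
    ((continuous_apply k).comp continuous_fst)

theorem IsAdmissible.relayMeasure_ac (hΨ : IsAdmissible μ Ψ) :
    relayMeasure Ψ ≪ (μ : Measure V) := by
  intro S hS
  rw [← hΨ.users, Measure.sum_apply_eq_zero] at hS
  rw [relayMeasure, Measure.sum_apply_eq_zero]
  intro m
  simp [hS m]

theorem IsAdmissible.relayMeasure_closure (hΨ : IsAdmissible μ Ψ) {S : Set V}
    (hS : MeasurableSet S) (h : (μ : Measure V) (closure S) = (μ : Measure V) S) :
    (relayMeasure Ψ).real (closure S) = (relayMeasure Ψ).real S := by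
  have h0 : (μ : Measure V) (closure S \ S) = 0 := by
    rw [measure_sdiff subset_closure hS.nullMeasurableSet (measure_ne_top _ _), h, tsub_self]
  have h1 := hΨ.relayMeasure_ac h0
  refine le_antisymm ?_ ?_
  · have := hΨ.isFiniteMeasure
    rw [← Set.union_sdiff_cancel (subset_closure : S ⊆ closure S)]
    refine (measureReal_union_le _ _).trans ?_
    simp [Measure.real, h1]
  · have := hΨ.isFiniteMeasure
    exact measureReal_mono subset_closure

theorem eventually_hits_le (hΨ : IsAdmissible μ Ψ) {N : ℕ} {c : V → Fin N} (hc : Measurable c)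
    (hcl : ∀ a, (μ : Measure V) (closure (c ⁻¹' {a})) = (μ : Measure V) (c ⁻¹' {a}))
    {δ : ℝ} (hδ : 0 < δ) :
    ∀ᶠ Φ in 𝓝 Ψ, ∀ a, (relayMarginal Φ).real (c ⁻¹' {a}) ≤
      (relayMeasure Ψ).real (c ⁻¹' {a}) + δ := by
  rw [eventually_all]
  intro a
  have hm : MeasurableSet (c ⁻¹' {a}) := hc (measurableSet_singleton a)
  have h1 : (relayFinite Ψ : Measure V).real (closure (c ⁻¹' {a})) <
      (relayMeasure Ψ).real (c ⁻¹' {a}) + δ := by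
    rw [relayFinite_coe, ← hΨ.relayMeasure_eq, hΨ.relayMeasure_closure hm (hcl a)]
    linarith
  have h2 := (continuous_relayFinite.tendsto Ψ).eventually
    (eventually_lt_of_isClosed (relayFinite Ψ) isClosed_closure h1)
  filter_upwards [h2] with Φ hΦ
  rw [relayFinite_coe] at hΦ
  exact (measureReal_mono subset_closure).trans hΦ.le

theorem eventually_sum_cell_le
    (hL : Tendsto (fun lam => userMeasure lam x (n lam)) atTop (𝓝 μ))
    {N : ℕ} {c : V → Fin N} (hc : Measurable c)
    (hcl : ∀ a, (μ : Measure V) (closure (c ⁻¹' {a})) = (μ : Measure V) (c ⁻¹' {a}))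
    {δ : ℝ} (hδ : 0 < δ) :
    ∀ᶠ lam : ℝ≥0 in atTop, ∀ Z : Fin N → ℝ, (∀ a, 0 ≤ Z a) →
      ∑ j : Fin (n lam), Z (c (x j)) ≤ lam * ∑ a, ((μ : Measure V).real (c ⁻¹' {a}) + δ) * Z a := by
  have h1 : ∀ᶠ lam : ℝ≥0 in atTop, ∀ a, (userMeasure lam x (n lam) : Measure V).real
      (closure (c ⁻¹' {a})) < (μ : Measure V).real (c ⁻¹' {a}) + δ := by
    rw [eventually_all]
    intro a
    refine hL.eventually (eventually_lt_of_isClosed μ isClosed_closure ?_)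
    simp only [Measure.real, hcl a]
    linarith
  filter_upwards [h1, tendsto_coe_atTop_real.eventually_gt_atTop 0] with lam hlam hl Z hZ
  have h2 := integral_userMeasure lam x (n lam) fun y => Z (c y)
  rw [integral_comp_finite _ hc] at h2
  have h3 : ∑ j : Fin (n lam), Z (c (x j)) =
      lam * ∑ a, (userMeasure lam x (n lam) : Measure V).real (c ⁻¹' {a}) * Z a := by
    rw [h2, ← mul_assoc, mul_inv_cancel₀ hl.ne', one_mul]
  rw [h3]
  refine mul_le_mul_of_nonneg_left (Finset.sum_le_sum fun a _ => ?_) hl.le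
  exact mul_le_mul_of_nonneg_right
    ((measureReal_mono subset_closure).trans (hlam a).le) (hZ a)

theorem exists_close {E : Type*} [MetricSpace E] [CompactSpace E] (φ : E →ᵇ ℝ) {ε : ℝ}
    (hε : 0 < ε) : ∀ᶠ r in 𝓝[>] (0 : ℝ), ∀ y z, dist y z < r → |φ y - φ z| ≤ ε := by
  have hu := CompactSpace.uniformContinuous_of_continuous φ.continuous
  rw [Metric.uniformContinuous_iff] at hu
  obtain ⟨d, hd, hud⟩ := hu ε hε
  filter_upwards [Ioo_mem_nhdsGT hd] with r hr y z hyz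
  exact (hud (hyz.trans hr.2)).le

theorem exists_prior_le_of_isAdmissible (hk : 1 ≤ kmax) (hμ : 0 < (μ.mass : ℝ))
    (hx : Function.Injective x)
    (hL : Tendsto (fun lam => userMeasure lam x (n lam)) atTop (𝓝 μ))
    (hΨ : IsAdmissible μ Ψ) {a : ℝ} (ha : (a : EReal) < rate μ Ψ) :
    ∃ U ∈ 𝓝 Ψ, ∀ᶠ lam : ℝ≥0 in atTop,
      prior {s : Config (n lam) kmax | empirical lam x s ∈ U} ≤ Real.exp (-(lam * a)) := by
  have hn := tendsto_card_div hL
  have hfinM := hΨ.isFiniteMeasure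
  have hfinR := isFiniteMeasure_referenceMeasure hΨ
  obtain ⟨g, K, h, hgh⟩ := exists_test_functions hΨ ha
  set w : ℝ := (μ.mass : ℝ) with hw
  have hwμ : (μ : Measure V).real Set.univ = w := rfl
  have hV : Nonempty V := by
    by_contra hne
    rw [not_nonempty_iff] at hne
    have : (μ : Measure V) = 0 := Measure.eq_zero_of_isEmpty _
    have h0 : w = 0 := by rw [← hwμ, this]; simp
    exact hμ.ne' h0
  -- the total error
  set A := ∑ k : Fin kmax, ∫ y, Real.exp (g k y) ∂(referenceMeasure μ Ψ k) with hA
  set B := ∑ m ∈ Finset.range K, poissonWeight w m * ∫ y, Real.exp (h m y) ∂(μ : Measure V) with hB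
  set v := ∑ k : Fin kmax, ∫ y, g k y ∂(Ψ.1 k : Measure (Fin (k + 1) → V)) - A + w
    + ∑ m ∈ Finset.range K, ∫ y, h m y ∂(Ψ.2 m : Measure V) - B
    + w * ∑ m ∈ Finset.range K, poissonWeight w m - 1 / Real.exp 1 + w * Real.log kmax with hv
  have hexpi : ∀ {E : Type _} [TopologicalSpace E] [MeasurableSpace E] [OpensMeasurableSpace E]
      (ρ : Measure E) [IsFiniteMeasure ρ] (φ : E →ᵇ ℝ), Integrable (fun y => Real.exp (φ y)) ρ := by
    intro E _ _ _ ρ _ φ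
    refine Integrable.of_bound (Real.continuous_exp.comp φ.continuous).aestronglyMeasurable
      (Real.exp ‖φ‖) (ae_of_all _ fun y => ?_)
    rw [Real.norm_eq_abs, Real.abs_exp]
    exact Real.exp_le_exp.2 ((le_abs_self _).trans (φ.norm_coe_le_norm y))
  have hav : a < v := by
    refine hgh.trans_eq ?_
    have e1 : ∀ k : Fin kmax, ∫ y, (Real.exp (g k y) - 1) ∂(referenceMeasure μ Ψ k) =
        ∫ y, Real.exp (g k y) ∂(referenceMeasure μ Ψ k) -
          w * (relayMeasure Ψ).real Set.univ ^ (k : ℕ) := by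
      intro k
      rw [integral_sub (hexpi _ _) (integrable_const _)]
      congr 1
      have := referenceMeasure_real_univ hΨ k
      simpa using this
    have e2 : ∀ m, poissonWeight w m * ∫ y, (Real.exp (h m y) - 1) ∂(μ : Measure V) =
        poissonWeight w m * ∫ y, Real.exp (h m y) ∂(μ : Measure V) - w * poissonWeight w m := by
      intro m
      rw [integral_sub (hexpi _ _) (integrable_const _)]
      simp only [integral_const, smul_eq_mul, mul_one, hwμ]
      ring
    simp only [e1, e2, Finset.sum_sub_distrib, ← Finset.mul_sum, hv, hA, hB]
    ring
  obtain ⟨ε, hε, hεv⟩ : ∃ ε > 0, (Real.exp ε - 1) * (A + B) + 2 * ε * (w + ε) + 7 * ε < v - a := by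
    have hc : Continuous fun ε : ℝ =>
        (Real.exp ε - 1) * (A + B) + 2 * ε * (w + ε) + 7 * ε := by fun_prop
    have h0 := (hc.tendsto 0).eventually_lt_const (u := v - a) (by simp; linarith)
    obtain ⟨ε, h1, h2⟩ := ((h0.filter_mono nhdsWithin_le_nhds).and
      (self_mem_nhdsWithin (s := Set.Ioi (0 : ℝ)))).exists
    exact ⟨ε, h2, h1⟩
  -- the cells
  obtain ⟨r, hr0, hrg, hrh⟩ : ∃ r > 0,
      (∀ (k : Fin kmax) (y z), dist y z < r → |g k y - g k z| ≤ ε) ∧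
      (∀ m ∈ Finset.range K, ∀ y z, dist y z < r → |h m y - h m z| ≤ ε) := by
    have h1 := eventually_all.2 fun k : Fin kmax => exists_close (g k) hε
    have h2 := (Finset.eventually_all (Finset.range K)).2 fun m _ => exists_close (h m) hε
    obtain ⟨r, hr⟩ := ((h1.and h2).and (self_mem_nhdsWithin (s := Set.Ioi (0 : ℝ)))).exists
    exact ⟨r, hr.2, hr.1.1, hr.1.2⟩
  obtain ⟨N, c, hc, hcr, hcl⟩ := exists_cells (μ : Measure V) hr0
  classical
  let rep : Fin N → V := fun b => if hb : ∃ y, c y = b then hb.choose else Classical.arbitrary V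
  have hrep : ∀ y, dist (rep (c y)) y < r := by
    intro y
    have hb : ∃ z, c z = c y := ⟨y, rfl⟩
    refine hcr _ _ ?_
    simp only [rep, dif_pos hb]
    exact hb.choose_spec
  let G : Fin N → LabelPath (Fin N) kmax → ℝ := fun b t =>
    g t.1 fun i => rep ((Fin.cons b t.2 : Fin (t.1 + 1) → Fin N) i)
  let H : Fin N → ℕ → ℝ := fun b m => if m < K then h m (rep b) else 0
  have hG : ∀ (k : Fin kmax) (y : Fin (k + 1) → V),
      |g k y - G (c (y 0)) ⟨k, fun l => c (y l.succ)⟩| ≤ ε := by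
    intro k y
    refine hrg k _ _ ?_
    rw [dist_pi_lt_iff hr0]
    intro i
    rw [dist_comm]
    refine Fin.cases ?_ (fun l => ?_) i
    · simp only [Fin.cons_zero]; exact hrep _
    · simp only [Fin.cons_succ]; exact hrep _
  have hH : ∀ m < K, ∀ y, |h m y - H (c y) m| ≤ ε := by
    intro m hm y
    simp only [H, if_pos hm]
    refine hrh m (Finset.mem_range.2 hm) _ _ ?_
    rw [dist_comm]
    exact hrep y
  have hHS : ∀ b, HasSum (fun m => poissonWeight w m * Real.exp (H b m))
      (1 + ∑ m ∈ Finset.range K, poissonWeight w m * (Real.exp (h m (rep b)) - 1)) := by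
    intro b
    have h1 : HasSum (fun m => poissonWeight w m * (Real.exp (H b m) - 1))
        (∑ m ∈ Finset.range K, poissonWeight w m * (Real.exp (H b m) - 1)) := by
      refine hasSum_sum_of_ne_finset_zero fun m hm => ?_
      simp only [H, if_neg (fun h => hm (Finset.mem_range.2 h)), Real.exp_zero, sub_self, mul_zero]
    have h2 := (hasSum_poissonWeight w).add h1
    convert h2 using 1
    · ext m; ring
    · congr 1
      refine Finset.sum_congr rfl fun m hm => ?_
      simp only [H, if_pos (Finset.mem_range.1 hm)]
  have hcell : ∀ Z : Fin N → ℝ, ∑ b, (μ : Measure V).real (c ⁻¹' {b}) * Z b =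
      ∫ y, Z (c y) ∂(μ : Measure V) := fun Z => (integral_comp_finite _ hc Z).symm
  have hexp_le : ∀ {u v : ℝ}, |u - v| ≤ ε → Real.exp v ≤ Real.exp ε * Real.exp u := by
    intro u v huv
    rw [← Real.exp_add]
    exact Real.exp_le_exp.2 (by linarith [(abs_le.1 huv).1])
  have hA' : ∑ b, (μ : Measure V).real (c ⁻¹' {b}) *
      trajNorm G (fun b => (relayMeasure Ψ).real (c ⁻¹' {b})) b ≤ Real.exp ε * A := by
    simp only [trajNorm]
    rw [sum_cells_eq_sum_integral hΨ hc fun b t => Real.exp (G b t), hA, Finset.mul_sum]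
    refine Finset.sum_le_sum fun k _ => ?_
    rw [← integral_const_mul]
    refine integral_mono_of_nonneg (ae_of_all _ fun y => (Real.exp_pos _).le)
      ((hexpi _ _).const_mul _) (ae_of_all _ fun y => hexp_le (hG k y))
  have hB' : ∑ b, (μ : Measure V).real (c ⁻¹' {b}) * hopNorm w H b ≤
      w - w * ∑ m ∈ Finset.range K, poissonWeight w m + Real.exp ε * B := by
    have e1 : ∀ b, hopNorm w H b = 1 - ∑ m ∈ Finset.range K, poissonWeight w m +
        ∑ m ∈ Finset.range K, poissonWeight w m * Real.exp (h m (rep b)) := by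
      intro b
      rw [hopNorm, (hHS b).tsum_eq]
      simp only [mul_sub, Finset.sum_sub_distrib, mul_one]
      ring
    have e2 : ∑ b, (μ : Measure V).real (c ⁻¹' {b}) *
        ∑ m ∈ Finset.range K, poissonWeight w m * Real.exp (h m (rep b)) ≤ Real.exp ε * B := by
      simp only [Finset.mul_sum, hB]
      rw [Finset.sum_comm]
      refine Finset.sum_le_sum fun m hm => ?_
      have e3 := hcell fun b => Real.exp (h m (rep b))
      have e4 : ∫ y, Real.exp (h m (rep (c y))) ∂(μ : Measure V) ≤
          Real.exp ε * ∫ y, Real.exp (h m y) ∂(μ : Measure V) := by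
        rw [← integral_const_mul]
        refine integral_mono_of_nonneg (ae_of_all _ fun y => (Real.exp_pos _).le)
          ((hexpi _ _).const_mul _) (ae_of_all _ fun y => hexp_le ?_)
        have := hH m (Finset.mem_range.1 hm) y
        simpa only [H, if_pos (Finset.mem_range.1 hm)] using this
      calc ∑ b, (μ : Measure V).real (c ⁻¹' {b}) * (poissonWeight w m * Real.exp (h m (rep b)))
          = poissonWeight w m *
            ∑ b, (μ : Measure V).real (c ⁻¹' {b}) * Real.exp (h m (rep b)) := by
            rw [Finset.mul_sum]
            exact Finset.sum_congr rfl fun b _ => by ring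
        _ ≤ poissonWeight w m * (Real.exp ε * ∫ y, Real.exp (h m y) ∂(μ : Measure V)) := by
            rw [e3]
            exact mul_le_mul_of_nonneg_left e4 (poissonWeight_pos hμ m).le
        _ = _ := by ring
    have e5 := hcell fun _ => 1 - ∑ m ∈ Finset.range K, poissonWeight w m
    rw [integral_const, smul_eq_mul, hwμ] at e5
    simp only [e1, mul_add, Finset.sum_add_distrib]
    rw [e5]
    linarith
  obtain ⟨δ, hδ, hδA, hδB⟩ : ∃ δ > 0,
      ∑ b, ((μ : Measure V).real (c ⁻¹' {b}) + δ) *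
        trajNorm G (fun b => (relayMeasure Ψ).real (c ⁻¹' {b}) + δ) b ≤ Real.exp ε * A + ε ∧
      ∑ b, ((μ : Measure V).real (c ⁻¹' {b}) + δ) * hopNorm w H b ≤
        w - w * ∑ m ∈ Finset.range K, poissonWeight w m + Real.exp ε * B + ε := by
    have hc1 : Continuous fun δ : ℝ => ∑ b, ((μ : Measure V).real (c ⁻¹' {b}) + δ) *
        trajNorm G (fun b => (relayMeasure Ψ).real (c ⁻¹' {b}) + δ) b := by
      unfold trajNorm
      fun_prop
    have hc2 : Continuous fun δ : ℝ =>
        ∑ b, ((μ : Measure V).real (c ⁻¹' {b}) + δ) * hopNorm w H b := by fun_prop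
    have h1 := (hc1.tendsto 0).eventually_lt_const (u := Real.exp ε * A + ε)
      (by simp only [add_zero]; linarith)
    have h2 := (hc2.tendsto 0).eventually_lt_const
      (u := w - w * ∑ m ∈ Finset.range K, poissonWeight w m + Real.exp ε * B + ε)
      (by simp only [add_zero]; linarith)
    obtain ⟨δ, h3, h4⟩ := (((h1.and h2).filter_mono nhdsWithin_le_nhds).and
      (self_mem_nhdsWithin (s := Set.Ioi (0 : ℝ)))).exists
    exact ⟨δ, h4, h3.1.le, h3.2.le⟩
  set ρ : Fin N → ℝ := fun b => (relayMeasure Ψ).real (c ⁻¹' {b}) + δ with hρdef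
  have hρ : ∀ b, 0 < ρ b := fun b => add_pos_of_nonneg_of_pos measureReal_nonneg hδ
  have hU1 : ∀ᶠ Φ : Setting V kmax in 𝓝 Ψ,
      ∑ k : Fin kmax, ∫ y, g k y ∂(Ψ.1 k : Measure (Fin (k + 1) → V)) - ε <
      ∑ k : Fin kmax, ∫ y, g k y ∂(Φ.1 k : Measure (Fin (k + 1) → V)) := by
    have hc : Continuous fun Φ : Setting V kmax =>
        ∑ k : Fin kmax, ∫ y, g k y ∂(Φ.1 k : Measure (Fin (k + 1) → V)) :=
      continuous_finsetSum _ fun k _ => continuous_integral_traj k (g k)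
    exact (hc.tendsto Ψ).eventually_const_lt (by linarith)
  have hU2 : ∀ᶠ Φ : Setting V kmax in 𝓝 Ψ,
      ∑ m ∈ Finset.range K, ∫ y, h m y ∂(Ψ.2 m : Measure V) - ε <
      ∑ m ∈ Finset.range K, ∫ y, h m y ∂(Φ.2 m : Measure V) := by
    have hc : Continuous fun Φ : Setting V kmax =>
        ∑ m ∈ Finset.range K, ∫ y, h m y ∂(Φ.2 m : Measure V) :=
      continuous_finsetSum _ fun m _ => continuous_integral_hop m (h m)
    exact (hc.tendsto Ψ).eventually_const_lt (by linarith)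
  refine ⟨_, (hU1.and hU2).and (eventually_hits_le hΨ hc hcl hδ), ?_⟩
  filter_upwards [eventually_sum_cell_le hL hc hcl hδ, eventually_le_tilt_remainder hμ hn ρ hρ hε,
    hn.eventually_const_lt (show w - ε < w by linarith),
    hn.eventually_lt_const (show w < w + ε by linarith),
    tendsto_coe_atTop_real.eventually_gt_atTop 0] with lam hcells hrem hn1 hn2 hl
  refine prior_le_exp hk (fun i : Fin (n lam) => c (x i)) G ρ hρ hμ H (fun b => (hHS b).summable)
    _ _ ?_
  rintro s ⟨⟨hs1, hs2⟩, hs3⟩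
  have hrem' := hrem (fun i : Fin (n lam) => c (x i)) s fun b => by
    rw [hits_relabel_eq hl s hc b]
    exact mul_le_mul_of_nonneg_left (hs3 b) hl.le
  have hN1 := hcells (trajNorm G ρ) fun b => Finset.sum_nonneg fun t _ =>
    mul_nonneg (Real.exp_pos _).le (Finset.prod_nonneg fun l _ => (hρ _).le)
  have hN2 := hcells (hopNorm w H) fun b => tsum_nonneg fun m =>
    mul_nonneg (poissonWeight_pos hμ m).le (Real.exp_pos _).le
  have hn1' : lam * (w - ε) ≤ n lam := by
    rw [lt_div_iff₀ hl] at hn1; linarith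
  have hn2' : n lam ≤ lam * (w + ε) := by
    rw [div_lt_iff₀ hl] at hn2; linarith
  have hg : lam * (∑ k : Fin kmax, ∫ y, g k y ∂(Ψ.1 k : Measure (Fin (k + 1) → V)) - ε) -
      ε * n lam ≤ ∑ j : Fin (n lam), G (c (x j)) (relabel (fun i : Fin (n lam) => c (x i)) (s j)) := by
    have e1 := sum_integral_trajMeasure lam x s fun k y => g k y
    have e2 : lam * ∑ k : Fin kmax, ∫ y, g k y ∂((empirical lam x s).1 k :
        Measure (Fin (k + 1) → V)) = ∑ i, g (s i).1 (path x i (s i)) := by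
      change lam * ∑ k : Fin kmax, ∫ y, g k y ∂(trajMeasure lam x s k :
        Measure (Fin (k + 1) → V)) = _
      rw [e1, ← mul_assoc, mul_inv_cancel₀ hl.ne', one_mul]
    have e3 := mul_le_mul_of_nonneg_left hs1.le hl.le
    rw [e2] at e3
    have e4 : ∑ i, g (s i).1 (path x i (s i)) ≤
        ∑ j : Fin (n lam), (G (c (x j)) (relabel (fun i : Fin (n lam) => c (x i)) (s j)) + ε) := by
      refine Finset.sum_le_sum fun j _ => ?_
      have := (abs_le.1 (hG (s j).1 (path x j (s j)))).2
      have e5 : G (c (path x j (s j) 0)) ⟨(s j).1, fun l => c (path x j (s j) l.succ)⟩ =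
        G (c (x j)) (relabel (fun i : Fin (n lam) => c (x i)) (s j)) := rfl
      linarith
    rw [Finset.sum_add_distrib, Finset.sum_const, Finset.card_univ, Fintype.card_fin,
      nsmul_eq_mul] at e4
    linarith
  have hh : lam * (∑ m ∈ Finset.range K, ∫ y, h m y ∂(Ψ.2 m : Measure V) - ε) - ε * n lam ≤
      ∑ u : Fin (n lam), H (c (x u)) (hits s u) := by
    have e2 : lam * ∑ m ∈ Finset.range K, ∫ y, h m y ∂((empirical lam x s).2 m : Measure V) =
        ∑ u : Fin (n lam), if hits s u < K then h (hits s u) (x u) else 0 := by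
      change lam * ∑ m ∈ Finset.range K, ∫ y, h m y ∂(hopMeasure lam x s m : Measure V) = _
      simp only [integral_hopMeasure lam hx]
      rw [← Finset.mul_sum, ← mul_assoc, mul_inv_cancel₀ hl.ne', one_mul, Finset.sum_comm]
      refine Finset.sum_congr rfl fun u _ => ?_
      rw [Finset.sum_ite_eq]
      simp only [Finset.mem_range]
    have e3 := mul_le_mul_of_nonneg_left hs2.le hl.le
    rw [e2] at e3
    have e4 : (∑ u : Fin (n lam), if hits s u < K then h (hits s u) (x u) else 0) ≤
        ∑ u : Fin (n lam), (H (c (x u)) (hits s u) + ε) := by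
      refine Finset.sum_le_sum fun u _ => ?_
      split_ifs with hu
      · linarith [(abs_le.1 (hH _ hu (x u))).2]
      · simp only [H, if_neg hu]
        linarith
    rw [Finset.sum_add_distrib, Finset.sum_const, Finset.card_univ, Fintype.card_fin,
      nsmul_eq_mul] at e4
    linarith
  have hN1' := hN1.trans (mul_le_mul_of_nonneg_left hδA hl.le)
  have hN2' := hN2.trans (mul_le_mul_of_nonneg_left hδB hl.le)
  have hεn := mul_le_mul_of_nonneg_left hn2' hε.le
  have hfin := mul_le_mul_of_nonneg_left (show a ≤ v - ((Real.exp ε - 1) * (A + B) +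
    2 * ε * (w + ε) + 7 * ε) by linarith) hl.le
  simp only [tiltExponent, Finset.sum_sub_distrib, Finset.sum_const, Finset.card_univ,
    Fintype.card_fin, nsmul_eq_mul, mul_one] at hrem' ⊢
  rw [hv] at hfin
  nlinarith

end Limit

end

end MultihopGibbs

namespace MultihopGibbs

noncomputable section

/-! ### The number of configurations with given empirical data -/

theorem eventually_le_and_tendsto_sub {ι : Type*} {l : Filter ι} {lam : ι → ℝ}
    (hlam : Tendsto lam l atTop) {F G : ι → ℕ} {s t : ℝ}
    (hF : Tendsto (fun i => (F i : ℝ) / lam i) l (𝓝 s))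
    (hG : Tendsto (fun i => (G i : ℝ) / lam i) l (𝓝 t)) (h : t < s ∨ ∀ᶠ i in l, G i = 0) :
    (∀ᶠ i in l, G i ≤ F i) ∧ Tendsto (fun i => ((F i - G i : ℕ) : ℝ) / lam i) l (𝓝 (s - t)) := by
  have h1 : ∀ᶠ i in l, G i ≤ F i := by
    rcases h with h | h
    · filter_upwards [hG.eventually_lt hF h, hlam.eventually_gt_atTop 0] with i hi hl
      exact_mod_cast ((div_lt_div_iff_of_pos_right hl).1 hi).le
    · filter_upwards [h] with i hi
      rw [hi]; exact Nat.zero_le _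
  refine ⟨h1, (hF.sub hG).congr' ?_⟩
  filter_upwards [h1] with i hi
  rw [Nat.cast_sub hi, sub_div]

theorem tendsto_floor_mul_div {ι : Type*} {l : Filter ι} {lam : ι → ℝ}
    (hlam : Tendsto lam l atTop) {t : ℝ} (ht : 0 ≤ t) :
    Tendsto (fun i => (⌊t * lam i⌋₊ : ℝ) / lam i) l (𝓝 t) :=
  (tendsto_nat_floor_mul_div_atTop ht).comp hlam

theorem tendsto_sum_div {ι κ : Type*} {l : Filter ι} {lam : ι → ℝ} (s : Finset κ)
    {F : ι → κ → ℕ} {t : κ → ℝ}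
    (hF : ∀ y ∈ s, Tendsto (fun i => (F i y : ℝ) / lam i) l (𝓝 (t y))) :
    Tendsto (fun i => ((∑ y ∈ s, F i y : ℕ) : ℝ) / lam i) l (𝓝 (∑ y ∈ s, t y)) := by
  simp only [Nat.cast_sum, Finset.sum_div]
  exact tendsto_finsetSum _ hF

theorem tendsto_mul_const_div {ι : Type*} {l : Filter ι} {lam : ι → ℝ} {F : ι → ℕ} {t : ℝ}
    (hF : Tendsto (fun i => (F i : ℝ) / lam i) l (𝓝 t)) (m : ℕ) :
    Tendsto (fun i => ((F i * m : ℕ) : ℝ) / lam i) l (𝓝 (t * m)) := by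
  refine (hF.mul_const (m : ℝ)).congr fun i => ?_
  push_cast; ring

open Classical in
/-- Real data with the constraints of `card_typeClass` are limits of integer data with these
constraints. -/
theorem exists_tendsto_counts {A : Type*} [Fintype A] {kmax K : ℕ} {ι : Type*} {l : Filter ι}
    {lam : ι → ℝ} (hlam : Tendsto lam l atTop) {N : ι → A → ℕ} {u : A → ℝ}
    (hN : ∀ a, Tendsto (fun i => (N i a : ℝ) / lam i) l (𝓝 (u a)))
    (r : A × LabelPath A kmax → ℝ) (p : A → Fin (K + 2) → ℝ)
    (hr0 : ∀ y, 0 ≤ r y) (hp0 : ∀ a m, 0 ≤ p a m)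
    (hr : ∀ a, ∑ t, r (a, t) = u a) (hp : ∀ a, ∑ m, p a m = u a)
    (hT : ∀ a, ∑ m, p a m * (m : ℕ) = ∑ y, r y * occ y.2 a)
    (t0 : LabelPath A kmax) (ht0 : ∀ a, occ t0 a = 0)
    (hrpos : ∀ a, 0 < r (a, t0) ∨ ∀ t, t ≠ t0 → r (a, t) = 0)
    (hppos : ∀ a, (0 < p a 0 ∧ 0 < p a 1) ∨ ∀ m, m ≠ 0 → p a m = 0) :
    ∃ (R : ι → A × LabelPath A kmax → ℕ) (Q : ι → A × Fin (K + 2) → ℕ),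
      (∀ y, Tendsto (fun i => (R i y : ℝ) / lam i) l (𝓝 (r y))) ∧
      (∀ a m, Tendsto (fun i => (Q i (a, m) : ℝ) / lam i) l (𝓝 (p a m))) ∧
      ∀ᶠ i in l, (∀ a, ∑ t, R i (a, t) = N i a) ∧ (∀ a, ∑ m, Q i (a, m) = N i a) ∧
        ∀ a, ∑ m, Q i (a, m) * (m : ℕ) = ∑ y, R i y * occ y.2 a := by
  have hfl : ∀ {t : ℝ}, 0 ≤ t → Tendsto (fun i => (⌊t * lam i⌋₊ : ℝ) / lam i) l (𝓝 t) :=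
    fun ht => tendsto_floor_mul_div hlam ht
  let S : ι → A → ℕ := fun i a => ∑ t ∈ Finset.univ.erase t0, ⌊r (a, t) * lam i⌋₊
  let R : ι → A × LabelPath A kmax → ℕ := fun i y =>
    if y.2 = t0 then N i y.1 - S i y.1 else ⌊r y * lam i⌋₊
  have hS : ∀ a, Tendsto (fun i => (S i a : ℝ) / lam i) l
      (𝓝 (∑ t ∈ Finset.univ.erase t0, r (a, t))) := fun a =>
    tendsto_sum_div _ fun t _ => hfl (hr0 (a, t))
  have hr' : ∀ a, u a - ∑ t ∈ Finset.univ.erase t0, r (a, t) = r (a, t0) := by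
    intro a
    rw [← hr a, ← Finset.add_sum_erase _ _ (Finset.mem_univ t0)]
    ring
  have hSR : ∀ a, (∀ᶠ i in l, S i a ≤ N i a) ∧
      Tendsto (fun i => ((N i a - S i a : ℕ) : ℝ) / lam i) l (𝓝 (r (a, t0))) := by
    intro a
    rw [← hr']
    refine eventually_le_and_tendsto_sub hlam (hN a) (hS a) ?_
    rcases hrpos a with h | h
    · left; linarith [hr' a]
    · right
      refine Eventually.of_forall fun i => Finset.sum_eq_zero fun t ht => ?_
      rw [h t (Finset.ne_of_mem_erase ht)]; simp
  have hR : ∀ y, Tendsto (fun i => (R i y : ℝ) / lam i) l (𝓝 (r y)) := by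
    rintro ⟨a, t⟩
    by_cases h : t = t0
    · subst h
      simpa only [R, if_true] using (hSR a).2
    · simpa only [R, if_neg h] using hfl (hr0 (a, t))
  let T : ι → A → ℕ := fun i a => ∑ y, R i y * occ y.2 a
  have hTt : ∀ a, Tendsto (fun i => (T i a : ℝ) / lam i) l (𝓝 (∑ m, p a m * (m : ℕ))) := by
    intro a
    rw [hT]
    exact tendsto_sum_div _ fun y _ => tendsto_mul_const_div (hR y) _
  have hT0 : ∀ a, (∀ m, m ≠ 0 → p a m = 0) → ∀ i, T i a = 0 := by
    intro a h i
    have h1 : ∑ y, r y * occ y.2 a = 0 := by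
      rw [← hT]
      refine Finset.sum_eq_zero fun m _ => ?_
      by_cases hm : m = 0
      · simp [hm]
      · simp [h m hm]
    rw [Finset.sum_eq_zero_iff_of_nonneg fun y _ => mul_nonneg (hr0 y) (Nat.cast_nonneg _)] at h1
    refine Finset.sum_eq_zero fun y _ => ?_
    by_cases hy : y.2 = t0
    · simp [hy, ht0]
    · rcases mul_eq_zero.1 (h1 y (Finset.mem_univ _)) with h2 | h2
      · simp [R, hy, h2]
      · rw [Nat.cast_eq_zero.1 h2, mul_zero]
  let Q2 : ι → A → Fin K → ℕ := fun i a m => ⌊p a m.succ.succ * lam i⌋₊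
  have hQ2 : ∀ a m, Tendsto (fun i => (Q2 i a m : ℝ) / lam i) l (𝓝 (p a m.succ.succ)) :=
    fun a m => hfl (hp0 _ _)
  let S1 : ι → A → ℕ := fun i a => ∑ m, Q2 i a m * (m + 2 : ℕ)
  let Q1 : ι → A → ℕ := fun i a => T i a - S1 i a
  have hQ1 : ∀ a, (∀ᶠ i in l, S1 i a ≤ T i a) ∧
      Tendsto (fun i => (Q1 i a : ℝ) / lam i) l (𝓝 (p a 1)) := by
    intro a
    have e : ∑ m, p a m * (m : ℕ) - ∑ m : Fin K, p a m.succ.succ * ((m : ℕ) + 2 : ℕ) = p a 1 := by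
      rw [Fin.sum_univ_succ, Fin.sum_univ_succ]
      simp
      ring_nf
    have hS1 : Tendsto (fun i => (S1 i a : ℝ) / lam i) l
        (𝓝 (∑ m : Fin K, p a m.succ.succ * ((m : ℕ) + 2 : ℕ))) :=
      tendsto_sum_div _ fun m _ => tendsto_mul_const_div (hQ2 a m) _
    rw [← e]
    refine eventually_le_and_tendsto_sub hlam (hTt a) hS1 ?_
    rcases hppos a with h | h
    · left; linarith [h.2]
    · right
      refine Eventually.of_forall fun i => Finset.sum_eq_zero fun m _ => ?_
      simp [Q2, h m.succ.succ (Fin.succ_ne_zero _)]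
  let S0 : ι → A → ℕ := fun i a => Q1 i a + ∑ m, Q2 i a m
  have hQ0 : ∀ a, (∀ᶠ i in l, S0 i a ≤ N i a) ∧
      Tendsto (fun i => ((N i a - S0 i a : ℕ) : ℝ) / lam i) l (𝓝 (p a 0)) := by
    intro a
    have e : u a - (p a 1 + ∑ m : Fin K, p a m.succ.succ) = p a 0 := by
      rw [← hp, Fin.sum_univ_succ, Fin.sum_univ_succ]
      simp
    have hS0 : Tendsto (fun i => (S0 i a : ℝ) / lam i) l
        (𝓝 (p a 1 + ∑ m : Fin K, p a m.succ.succ)) := by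
      simp only [S0, Nat.cast_add, add_div]
      exact (hQ1 a).2.add (tendsto_sum_div _ fun m _ => hQ2 a m)
    rw [← e]
    refine eventually_le_and_tendsto_sub hlam (hN a) hS0 ?_
    rcases hppos a with h | h
    · left; linarith [h.1]
    · right
      refine Eventually.of_forall fun i => ?_
      simp [S0, Q1, hT0 a h, Q2, h _ (Fin.succ_ne_zero _)]
  let Q : ι → A × Fin (K + 2) → ℕ := fun i y =>
    (Fin.cons (N i y.1 - S0 i y.1) (Fin.cons (Q1 i y.1) (Q2 i y.1)) : Fin (K + 2) → ℕ) y.2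
  refine ⟨R, Q, hR, fun a m => ?_, ?_⟩
  · refine Fin.cases ?_ (fun m => Fin.cases ?_ (fun m => ?_) m) m
    · simpa only [Q, Fin.cons_zero] using (hQ0 a).2
    · exact (hQ1 a).2
    · simpa only [Q, Fin.cons_succ] using hQ2 a m
  · filter_upwards [eventually_all.2 fun a => (hSR a).1, eventually_all.2 fun a => (hQ1 a).1,
      eventually_all.2 fun a => (hQ0 a).1] with i h1 h2 h3
    refine ⟨fun a => ?_, fun a => ?_, fun a => ?_⟩
    · rw [← Finset.add_sum_erase _ _ (Finset.mem_univ t0)]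
      have e : ∑ t ∈ Finset.univ.erase t0, R i (a, t) = S i a :=
        Finset.sum_congr rfl fun t ht => by simp only [R, if_neg (Finset.ne_of_mem_erase ht)]
      rw [e]
      simp only [R, if_true]
      exact Nat.sub_add_cancel (h1 a)
    · simp only [Q]
      rw [Fin.sum_univ_succ, Fin.sum_univ_succ]
      simp only [Fin.cons_zero, Fin.cons_succ]
      exact Nat.sub_add_cancel (h3 a)
    · simp only [Q]
      rw [Fin.sum_univ_succ, Fin.sum_univ_succ]
      simp only [Fin.cons_zero, Fin.cons_succ, Fin.val_zero, mul_zero, zero_add, Fin.val_succ,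
        mul_one]
      exact Nat.sub_add_cancel (h2 a)

/-- The exponential rate of `N!`, up to the power of `λ`, if `N ~ λ t`. -/
def factorialRate (t : ℝ) : ℝ := t * Real.log t - t

/-- The exponential decay rate of the a priori probability of the configurations with given
empirical data. -/
def typeRate {A : Type*} [Fintype A] {kmax K : ℕ} (w : ℝ) (u : A → ℝ)
    (r : A × LabelPath A kmax → ℝ) (p : A → Fin K → ℝ) : ℝ :=
  ∑ y, factorialRate (r y) + ∑ a, ∑ m, (factorialRate (p a m) + p a m * Real.log (m : ℕ).factorial)
    - 2 * ∑ a, factorialRate (u a) - ∑ a, factorialRate (∑ y, r y * occ y.2 a)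
    + (∑ a, ∑ y, r y * occ y.2 a) * Real.log w + w * Real.log kmax

open Classical in
theorem hits_relabel_of_mem_typeClass {B A : Type*} [Fintype B] [DecidableEq B] [Fintype A]
    {kmax K : ℕ} {c : B → A} {R : A × LabelPath A kmax → ℕ} {Q : A × Fin (K + 1) → ℕ}
    {s : B → LabelPath B kmax} (hs : s ∈ typeClass c R Q) (a : A) :
    hits (fun j => relabel c (s j)) a = ∑ y, R y * occ y.2 a := by
  simp only [typeClass, Finset.mem_filter] at hs
  have := sum_comp_of_card_fiber (fun j => (c j, relabel c (s j))) R (fun y => by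
    convert hs.2.1 y) fun y => occ y.2 a
  exact this

open Classical in
theorem eventually_exp_le_prior_typeClass {A : Type*} [Fintype A] {kmax K : ℕ} (hk : 1 ≤ kmax)
    {w : ℝ} (hw : 0 < w) {n : ℝ≥0 → ℕ}
    (hn : Tendsto (fun lam : ℝ≥0 => (n lam : ℝ) / lam) atTop (𝓝 w))
    (c : ∀ lam : ℝ≥0, Fin (n lam) → A) {u : A → ℝ}
    (hu : ∀ a, Tendsto (fun lam : ℝ≥0 =>
      ((Finset.univ.filter fun j => c lam j = a).card : ℝ) / lam) atTop (𝓝 (u a)))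
    {r : A × LabelPath A kmax → ℝ} {p : A → Fin (K + 1) → ℝ}
    {R : ℝ≥0 → A × LabelPath A kmax → ℕ} {Q : ℝ≥0 → A × Fin (K + 1) → ℕ}
    (hR : ∀ y, Tendsto (fun lam : ℝ≥0 => (R lam y : ℝ) / lam) atTop (𝓝 (r y)))
    (hQ : ∀ a m, Tendsto (fun lam : ℝ≥0 => (Q lam (a, m) : ℝ) / lam) atTop (𝓝 (p a m)))
    (hRQ : ∀ᶠ lam : ℝ≥0 in atTop,
      (∀ a, ∑ t, R lam (a, t) = (Finset.univ.filter fun j => c lam j = a).card) ∧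
      (∀ a, ∑ m, Q lam (a, m) = (Finset.univ.filter fun j => c lam j = a).card) ∧
      ∀ a, ∑ m, Q lam (a, m) * (m : ℕ) = ∑ y, R lam y * occ y.2 a)
    {b : ℝ} (hb : typeRate w u r p < b) :
    ∀ᶠ lam : ℝ≥0 in atTop,
      Real.exp (-(lam * b)) ≤ prior (typeClass (c lam) (R lam) (Q lam) : Set (Config (n lam) kmax)) := by
  have hlam := tendsto_coe_atTop_real
  set T : ℝ≥0 → A → ℕ := fun lam a => ∑ y, R lam y * occ y.2 a with hTdef
  have hT : ∀ a, Tendsto (fun lam : ℝ≥0 => (T lam a : ℝ) / lam) atTop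
      (𝓝 (∑ y, r y * occ y.2 a)) := fun a =>
    tendsto_sum_div _ fun y _ => tendsto_mul_const_div (hR y) _
  let F : ℕ → ℝ≥0 → ℝ := fun N lam => (Real.log N.factorial - N * Real.log lam) / lam
  set nn : ℝ≥0 → A → ℕ := fun lam a => (Finset.univ.filter fun j => c lam j = a).card with hnn
  have hlim : Tendsto (fun lam : ℝ≥0 =>
      ∑ y, F (R lam y) lam + ∑ a, ∑ m, (F (Q lam (a, m)) lam +
        (Q lam (a, m) : ℝ) / lam * Real.log (m : ℕ).factorial)
      - 2 * ∑ a, F (nn lam a) lam - ∑ a, F (T lam a) lam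
      + (∑ a, (T lam a : ℝ) / lam) * Real.log (n lam / lam) + n lam / lam * Real.log kmax)
      atTop (𝓝 (typeRate w u r p)) := by
    refine ((((Tendsto.add ?_ ?_).sub (Tendsto.const_mul _ ?_)).sub ?_).add (Tendsto.mul ?_ ?_)).add
      (hn.mul_const _)
    · exact tendsto_finsetSum _ fun y _ => tendsto_log_factorial hlam (hR y)
    · exact tendsto_finsetSum _ fun a _ => tendsto_finsetSum _ fun m _ =>
        (tendsto_log_factorial hlam (hQ a m)).add ((hQ a m).mul_const _)
    · exact tendsto_finsetSum _ fun a _ => tendsto_log_factorial hlam (hu a)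
    · exact tendsto_finsetSum _ fun a _ => tendsto_log_factorial hlam (hT a)
    · exact tendsto_finsetSum _ fun a _ => hT a
    · exact hn.log hw.ne'
  filter_upwards [hlim.eventually_lt_const hb, hRQ, hlam.eventually_gt_atTop 0,
    hn.eventually_const_lt hw] with lam h1 h2 hl hnpos
  have hnpos' : (0 : ℝ) < n lam := by
    rwa [lt_div_iff₀ hl, zero_mul] at hnpos
  have hn0 : 0 < n lam := by exact_mod_cast hnpos'
  have hcard := card_typeClass (c lam) (R lam) (Q lam) h2.1 h2.2.1 h2.2.2
  change (∏ a, (nn lam a).factorial) * (∏ a, (nn lam a).factorial) * (∏ a, (T lam a).factorial) ≤ _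
    at hcard
  have hfac : ∀ N : ℕ, (0 : ℝ) < N.factorial := fun N => by positivity
  have hexp : ∀ N : ℕ, (N.factorial : ℝ) = Real.exp (Real.log N.factorial) := fun N =>
    (Real.exp_log (hfac N)).symm
  have hprior : prior (typeClass (c lam) (R lam) (Q lam) : Set (Config (n lam) kmax)) =
      (typeClass (c lam) (R lam) (Q lam)).card *
        Real.exp (-(n lam * Real.log kmax) - (∑ a, (T lam a : ℝ)) * Real.log (n lam)) := by
    have e : ∀ s ∈ typeClass (c lam) (R lam) (Q lam),
        ∏ i, 1 / ((kmax : ℝ) * (n lam : ℝ) ^ ((s i).1 : ℕ)) =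
        Real.exp (-(n lam * Real.log kmax) - (∑ a, (T lam a : ℝ)) * Real.log (n lam)) := by
      intro s hs
      rw [prod_prior_weight hk]
      congr 3
      have h3 : relayCount s = relayCount (fun j => relabel (c lam) (s j)) := rfl
      rw [h3, ← sum_hits]
      push_cast
      exact Finset.sum_congr rfl fun a _ => by rw [hits_relabel_of_mem_typeClass hs a]
    unfold prior
    simp only [Finset.mem_coe]
    rw [← nsmul_eq_mul, ← Finset.sum_const, ← Finset.sum_congr rfl e]
    refine Finset.sum_congr ?_ fun _ _ => rfl
    ext s
    simp
  have hcardR : Real.exp (2 * ∑ a, Real.log (nn lam a).factorial +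
      ∑ a, Real.log (T lam a).factorial - ∑ y, Real.log (R lam y).factorial -
      ∑ a, ∑ m, (Real.log (Q lam (a, m)).factorial +
        (Q lam (a, m) : ℝ) * Real.log (m : ℕ).factorial)) ≤
      (typeClass (c lam) (R lam) (Q lam)).card := by
    have h3 : (((∏ a, (nn lam a).factorial) * (∏ a, (nn lam a).factorial) *
        (∏ a, (T lam a).factorial) : ℕ) : ℝ) ≤ _ := Nat.cast_le.2 hcard
    push_cast at h3
    have e1 : ∏ y, ((Q lam y).factorial : ℝ) = Real.exp (∑ a, ∑ m, Real.log (Q lam (a, m)).factorial) := by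
      rw [← Fintype.sum_prod_type', Real.exp_sum]
      exact Finset.prod_congr rfl fun y _ => hexp _
    have e2 : ∏ y : A × Fin (K + 1), ((y.2 : ℕ).factorial : ℝ) ^ Q lam y =
        Real.exp (∑ a, ∑ m : Fin (K + 1), (Q lam (a, m) : ℝ) * Real.log (m : ℕ).factorial) := by
      rw [← Fintype.sum_prod_type' (f := fun a (m : Fin (K + 1)) =>
        (Q lam (a, m) : ℝ) * Real.log (m : ℕ).factorial), Real.exp_sum]
      refine Finset.prod_congr rfl fun y _ => ?_
      rw [Real.exp_nat_mul, Real.exp_log (hfac _)]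
    have e3 : ∀ {κ : Type _} [Fintype κ] (Z : κ → ℕ), ∏ y, ((Z y).factorial : ℝ) =
        Real.exp (∑ y, Real.log (Z y).factorial) := by
      intro κ _ Z
      rw [Real.exp_sum]
      exact Finset.prod_congr rfl fun y _ => hexp _
    rw [e1, e2, e3 (nn lam), e3 (T lam), e3 (R lam)] at h3
    simp only [mul_assoc, ← Real.exp_add] at h3
    rw [← div_le_iff₀ (Real.exp_pos _), ← Real.exp_sub] at h3
    refine le_trans (le_of_eq ?_) h3
    congr 1
    simp only [Finset.sum_add_distrib]
    ring
  rw [hprior]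
  refine le_trans ?_ (mul_le_mul_of_nonneg_right hcardR (Real.exp_pos _).le)
  rw [← Real.exp_add, Real.exp_le_exp]
  have hcount1 : ∑ y, (R lam y : ℝ) = ∑ a, (nn lam a : ℝ) := by
    rw [Fintype.sum_prod_type]
    exact Finset.sum_congr rfl fun a _ => by exact_mod_cast h2.1 a
  have hcount2 : ∑ a, ∑ m, (Q lam (a, m) : ℝ) = ∑ a, (nn lam a : ℝ) :=
    Finset.sum_congr rfl fun a _ => by exact_mod_cast h2.2.1 a
  have h4 := (mul_lt_mul_iff_right₀ hl).2 h1
  rw [Real.log_div hnpos'.ne' hl.ne'] at h4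
  have hF : ∀ N : ℕ, F N lam = (Real.log N.factorial - N * Real.log lam) * (lam : ℝ)⁻¹ := fun N =>
    div_eq_mul_inv _ _
  have hd : ∀ z : ℝ, z / (lam : ℝ) = z * (lam : ℝ)⁻¹ := fun z => div_eq_mul_inv _ _
  have hL : (lam : ℝ) * (lam : ℝ)⁻¹ = 1 := mul_inv_cancel₀ hl.ne'
  have h5 : (lam : ℝ) * (∑ y, F (R lam y) lam + ∑ a, ∑ m, (F (Q lam (a, m)) lam +
        (Q lam (a, m) : ℝ) / lam * Real.log (m : ℕ).factorial)
      - 2 * ∑ a, F (nn lam a) lam - ∑ a, F (T lam a) lam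
      + (∑ a, (T lam a : ℝ) / lam) * (Real.log (n lam) - Real.log lam)
      + n lam / lam * Real.log kmax) =
      (lam * (lam : ℝ)⁻¹) * (∑ y, Real.log (R lam y).factorial + ∑ a, ∑ m,
        (Real.log (Q lam (a, m)).factorial + (Q lam (a, m) : ℝ) * Real.log (m : ℕ).factorial)
      - 2 * ∑ a, Real.log (nn lam a).factorial - ∑ a, Real.log (T lam a).factorial
      + (∑ a, (T lam a : ℝ)) * Real.log (n lam) + n lam * Real.log kmax
      - (∑ y, (R lam y : ℝ) + ∑ a, ∑ m, (Q lam (a, m) : ℝ) - 2 * ∑ a, (nn lam a : ℝ)) *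
        Real.log lam) := by
    have hsF : ∀ {κ : Type _} [Fintype κ] (Z : κ → ℕ), ∑ y, F (Z y) lam =
        (∑ y, Real.log (Z y).factorial - (∑ y, (Z y : ℝ)) * Real.log lam) * (lam : ℝ)⁻¹ := by
      intro κ _ Z
      simp only [hF, ← Finset.sum_mul, Finset.sum_sub_distrib]
    have hsQ : ∑ a, ∑ m, (F (Q lam (a, m)) lam +
        (Q lam (a, m) : ℝ) / lam * Real.log (m : ℕ).factorial) =
        (∑ a, ∑ m, (Real.log (Q lam (a, m)).factorial +
          (Q lam (a, m) : ℝ) * Real.log (m : ℕ).factorial) -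
          (∑ a, ∑ m, (Q lam (a, m) : ℝ)) * Real.log lam) * (lam : ℝ)⁻¹ := by
      simp only [Finset.sum_mul, ← Finset.sum_sub_distrib]
      refine Finset.sum_congr rfl fun a _ => Finset.sum_congr rfl fun m _ => ?_
      rw [hF, hd]
      ring
    rw [hsF, hsQ, hsF, hsF, hd]
    simp only [hd, ← Finset.sum_mul]
    ring
  rw [h5, hL, hcount1, hcount2] at h4
  linarith

end

end MultihopGibbs

namespace MultihopGibbs

noncomputable section

theorem factorialRate_mul {κ t : ℝ} (hκ : 0 < κ) (ht : 0 ≤ t) :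
    factorialRate (κ * t) = κ * factorialRate t + κ * Real.log κ * t := by
  unfold factorialRate
  rcases ht.eq_or_lt with rfl | ht
  · simp
  · rw [Real.log_mul hκ.ne' ht.ne']; ring

theorem continuous_factorialRate : Continuous factorialRate :=
  Real.continuous_mul_log.sub continuous_id

theorem tendsto_sum_fin_add_two {g : ℕ → ℝ} {s : ℝ} (hg : HasSum g s) {K : ℕ → ℕ}
    (hK : Tendsto K atTop atTop) :
    Tendsto (fun j => ∑ i : Fin (K j), g (i + 2)) atTop (𝓝 (s - g 0 - g 1)) := by
  have h := (hasSum_nat_add_iff' 2).2 hg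
  simp only [Finset.sum_range_succ, Finset.sum_range_zero, zero_add, ← sub_sub] at h
  refine (h.tendsto_sum_nat.comp hK).congr fun j => ?_
  exact Finset.sum_range fun i => g (i + 2)

/-- The truncation of a distribution `p` on `ℕ` with mass `u` and mean `M` that has mass `u` and
mean `M'`. -/
def truncation (p : ℕ → ℝ) (u M' κ : ℝ) (K : ℕ) : Fin (K + 2) → ℝ :=
  Fin.cons (u - (M' - κ * ∑ i : Fin K, ((i + 2 : ℕ) : ℝ) * p (i + 2)) - κ * ∑ i : Fin K, p (i + 2))
    (Fin.cons (M' - κ * ∑ i : Fin K, ((i + 2 : ℕ) : ℝ) * p (i + 2)) fun i => κ * p (i + 2))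

section Truncation

variable {p : ℕ → ℝ} {u M M' κ : ℝ} {K : ℕ}

theorem sum_truncation (F : ℕ → ℝ → ℝ) : ∑ m : Fin (K + 2), F m (truncation p u M' κ K m) =
    F 0 (u - (M' - κ * ∑ i : Fin K, ((i + 2 : ℕ) : ℝ) * p (i + 2)) - κ * ∑ i : Fin K, p (i + 2)) +
    (F 1 (M' - κ * ∑ i : Fin K, ((i + 2 : ℕ) : ℝ) * p (i + 2)) +
      ∑ i : Fin K, F (i + 2) (κ * p (i + 2))) := by
  rw [Fin.sum_univ_succ, Fin.sum_univ_succ]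
  rfl

theorem sum_truncation_eq : ∑ m, truncation p u M' κ K m = u := by
  rw [sum_truncation fun _ t => t, ← Finset.mul_sum]
  ring

theorem sum_truncation_mul : ∑ m : Fin (K + 2), truncation p u M' κ K m * (m : ℕ) = M' := by
  rw [sum_truncation fun (m : ℕ) t => t * m]
  have : ∀ i : Fin K, κ * p (i + 2) * ((i + 2 : ℕ) : ℝ) = κ * (((i + 2 : ℕ) : ℝ) * p (i + 2)) :=
    fun i => by ring
  simp only [this, ← Finset.mul_sum]
  push_cast
  ring

variable {p : ℕ → ℝ} {u M : ℝ} {κ : ℕ → ℝ} {M' : ℕ → ℝ} {K : ℕ → ℕ}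

theorem tendsto_truncation_zero (hp : HasSum p u) (hpM : HasSum (fun m : ℕ => (m : ℝ) * p m) M)
    (hκ : Tendsto κ atTop (𝓝 1)) (hM : Tendsto M' atTop (𝓝 M)) (hK : Tendsto K atTop atTop) :
    Tendsto (fun j => u - (M' j - κ j * ∑ i : Fin (K j), ((i + 2 : ℕ) : ℝ) * p (i + 2)) -
      κ j * ∑ i : Fin (K j), p (i + 2)) atTop (𝓝 (p 0)) := by
  have h1 := tendsto_sum_fin_add_two hp hK
  have h2 := tendsto_sum_fin_add_two hpM hK
  have := (tendsto_const_nhds (x := u) (f := atTop (α := ℕ))).sub (hM.sub (hκ.mul h2)) |>.sub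
    (hκ.mul h1)
  convert this using 2
  push_cast; ring

theorem tendsto_truncation_one (hpM : HasSum (fun m : ℕ => (m : ℝ) * p m) M)
    (hκ : Tendsto κ atTop (𝓝 1)) (hM : Tendsto M' atTop (𝓝 M)) (hK : Tendsto K atTop atTop) :
    Tendsto (fun j => M' j - κ j * ∑ i : Fin (K j), ((i + 2 : ℕ) : ℝ) * p (i + 2)) atTop
      (𝓝 (p 1)) := by
  have h2 := tendsto_sum_fin_add_two hpM hK
  have := hM.sub (hκ.mul h2)
  convert this using 2
  push_cast; ring

theorem tendsto_truncation (hp : HasSum p u) (hpM : HasSum (fun m : ℕ => (m : ℝ) * p m) M)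
    (hκ : Tendsto κ atTop (𝓝 1)) (hM : Tendsto M' atTop (𝓝 M)) (hK : Tendsto K atTop atTop)
    (m : ℕ) : Tendsto (fun j => if h : m < K j + 2 then truncation p u (M' j) (κ j) (K j) ⟨m, h⟩
      else 0) atTop (𝓝 (p m)) := by
  rcases m with _ | _ | m
  · refine (tendsto_truncation_zero hp hpM hκ hM hK).congr fun j => ?_
    rw [dif_pos (by omega)]; rfl
  · refine (tendsto_truncation_one hpM hκ hM hK).congr fun j => ?_
    rw [dif_pos (by omega)]; rfl
  · have := hκ.mul_const (p (m + 2))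
    rw [one_mul] at this
    refine this.congr' ?_
    filter_upwards [hK.eventually_gt_atTop m] with j hj
    rw [dif_pos (by omega)]; rfl

theorem tendsto_sum_truncation_mul (hp : HasSum p u) (hpM : HasSum (fun m : ℕ => (m : ℝ) * p m) M)
    (hκ : Tendsto κ atTop (𝓝 1)) (hM : Tendsto M' atTop (𝓝 M)) (hK : Tendsto K atTop atTop)
    {η : ℕ → ℝ} {s : ℝ} (hη : HasSum (fun m : ℕ => η m * p m) s) :
    Tendsto (fun j => ∑ m : Fin (K j + 2), η m * truncation p u (M' j) (κ j) (K j) m) atTop (𝓝 s) := by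
  simp only [sum_truncation fun (m : ℕ) t => η m * t]
  have h1 := (tendsto_truncation_zero hp hpM hκ hM hK).const_mul (η 0)
  have h2 := (tendsto_truncation_one hpM hκ hM hK).const_mul (η 1)
  have h3 := hκ.mul (tendsto_sum_fin_add_two hη hK)
  have h4 := h1.add (h2.add h3)
  have e : η 0 * p 0 + (η 1 * p 1 + 1 * (s - η 0 * p 0 - η 1 * p 1)) = s := by ring
  rw [e] at h4
  refine h4.congr fun j => ?_
  congr 2
  rw [Finset.mul_sum]
  exact Finset.sum_congr rfl fun i _ => by ring

theorem tendsto_sum_truncation_rate (hp0 : ∀ m, 0 ≤ p m) (hp : HasSum p u)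
    (hpM : HasSum (fun m : ℕ => (m : ℝ) * p m) M)
    (hκ : Tendsto κ atTop (𝓝 1)) (hM : Tendsto M' atTop (𝓝 M)) (hK : Tendsto K atTop atTop)
    {s : ℝ} (hs : HasSum (fun m : ℕ => factorialRate (p m) + p m * Real.log m.factorial) s) :
    Tendsto (fun j => ∑ m : Fin (K j + 2), (factorialRate (truncation p u (M' j) (κ j) (K j) m) +
      truncation p u (M' j) (κ j) (K j) m * Real.log (m : ℕ).factorial)) atTop (𝓝 s) := by
  simp only [sum_truncation fun (m : ℕ) t => factorialRate t + t * Real.log m.factorial]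
  have h1 := (continuous_factorialRate.tendsto _).comp (tendsto_truncation_zero hp hpM hκ hM hK)
  have h2 := (continuous_factorialRate.tendsto _).comp (tendsto_truncation_one hpM hκ hM hK)
  have h3 := hκ.mul (tendsto_sum_fin_add_two hs hK)
  have hlog : Tendsto (fun j => κ j * Real.log (κ j)) atTop (𝓝 (1 * Real.log 1)) :=
    hκ.mul (hκ.log one_ne_zero)
  have h4 := hlog.mul (tendsto_sum_fin_add_two hp hK)
  have h5 := h1.add (h2.add (h3.add h4))
  simp only [Nat.factorial, Nat.cast_one, Real.log_one, mul_zero, add_zero, zero_mul, mul_one,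
    one_mul] at h5 ⊢
  have e : factorialRate (p 0) + (factorialRate (p 1) +
      (s - factorialRate (p 0) - factorialRate (p 1))) = s := by ring
  rw [e] at h5
  refine h5.congr' ?_
  filter_upwards [hκ.eventually_const_lt one_pos] with j hj
  simp only [Function.comp_apply]
  congr 2
  rw [Finset.mul_sum, Finset.mul_sum, ← Finset.sum_add_distrib]
  refine Finset.sum_congr rfl fun i _ => ?_
  rw [factorialRate_mul hj (hp0 _)]
  ring

end Truncation

theorem sum_fin_add_two_le {g : ℕ → ℝ} {s : ℝ} (hg0 : ∀ m, 0 ≤ g m) (hg : HasSum g s) (K : ℕ) :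
    ∑ i : Fin K, g (i + 2) ≤ s - g 0 - g 1 := by
  have h := (hasSum_nat_add_iff' 2).2 hg
  simp only [Finset.sum_range_succ, Finset.sum_range_zero, zero_add, ← sub_sub] at h
  rw [← Finset.sum_range fun i => g (i + 2)]
  exact sum_le_hasSum _ (fun i _ => hg0 _) h

/-- If the mean is slightly decreased, then the truncation is nonnegative, with positive values at
`0` and `1` unless the mean vanishes. -/
theorem truncation_nonneg {p : ℕ → ℝ} {u M ε : ℝ} {K : ℕ} (hp0 : ∀ m, 0 ≤ p m) (hp : HasSum p u)
    (hpM : HasSum (fun m : ℕ => (m : ℝ) * p m) M) (hε : 0 < ε) (hε1 : ε + ε ^ 2 < 1)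
    (htail : M - p 1 - ∑ i : Fin K, ((i + 2 : ℕ) : ℝ) * p (i + 2) ≤ ε ^ 3)
    (hu : 0 < u → ε * (M - u) + ε ^ 2 < u) :
    (∀ m, 0 ≤ truncation p u ((1 - ε) * M) (1 - ε - ε ^ 2) K m) ∧
    ((0 < truncation p u ((1 - ε) * M) (1 - ε - ε ^ 2) K 0 ∧
      0 < truncation p u ((1 - ε) * M) (1 - ε - ε ^ 2) K 1) ∨
      ∀ m, m ≠ 0 → truncation p u ((1 - ε) * M) (1 - ε - ε ^ 2) K m = 0) := by
  set κ := 1 - ε - ε ^ 2 with hκ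
  have hκ0 : 0 < κ := by rw [hκ]; linarith
  have hmp : ∀ m : ℕ, 0 ≤ (m : ℝ) * p m := fun m => mul_nonneg (Nat.cast_nonneg _) (hp0 m)
  have hM0 : 0 ≤ M := hpM.nonneg hmp
  have hu0 : 0 ≤ u := hp.nonneg hp0
  set S₁ := ∑ i : Fin K, ((i + 2 : ℕ) : ℝ) * p (i + 2) with hS₁
  set S₀ := ∑ i : Fin K, p (i + 2) with hS₀
  have e0 : truncation p u ((1 - ε) * M) κ K 0 = u - ((1 - ε) * M - κ * S₁) - κ * S₀ := rfl
  have e1 : truncation p u ((1 - ε) * M) κ K 1 = (1 - ε) * M - κ * S₁ := rfl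
  have e2 : ∀ i : Fin K, truncation p u ((1 - ε) * M) κ K i.succ.succ = κ * p (i + 2) :=
    fun i => rfl
  rcases hM0.eq_or_lt with hM | hM
  · have hz : ∀ m, m ≠ 0 → p m = 0 := by
      intro m hm
      rw [← hM, hasSum_zero_iff_of_nonneg hmp] at hpM
      have := congrFun hpM m
      simpa [hm] using this
    have hS₁' : S₁ = 0 := Finset.sum_eq_zero fun i _ => by rw [hz _ (by omega), mul_zero]
    have hS₀' : S₀ = 0 := Finset.sum_eq_zero fun i _ => hz _ (by omega)
    have h1 : ∀ m, m ≠ 0 → truncation p u ((1 - ε) * M) κ K m = 0 := by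
      intro m
      refine Fin.cases (fun h => absurd rfl h) (fun m _ => Fin.cases ?_ (fun i => ?_) m) m
      · rw [Fin.succ_zero_eq_one, e1, ← hM, hS₁']; ring
      · rw [e2, hz _ (by omega), mul_zero]
    refine ⟨fun m => ?_, Or.inr h1⟩
    by_cases hm : m = 0
    · rw [hm, e0, ← hM, hS₁', hS₀']; simpa using hu0
    · rw [h1 m hm]
  · have hupos : 0 < u := by
      refine hu0.lt_of_ne fun h => hM.ne ?_
      rw [← h, hasSum_zero_iff_of_nonneg hp0] at hp
      rw [hp] at hpM
      simpa using hasSum_zero.unique (by simpa using hpM)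
    have hS₁M : S₁ ≤ M - p 1 := by
      have := sum_fin_add_two_le hmp hpM K
      simp only [Nat.cast_zero, zero_mul, sub_zero, Nat.cast_one, one_mul] at this
      exact this
    have hS₁p : 0 ≤ S₁ := Finset.sum_nonneg fun i _ => hmp _
    have hS₁0 : M - u + p 0 ≤ S₁ - S₀ + ε ^ 3 := by
      have h1 : S₁ - S₀ = ∑ i : Fin K, (((i + 2 : ℕ) : ℝ) * p (i + 2) - p (i + 2)) :=
        (Finset.sum_sub_distrib _ _).symm
      have h2 := sum_fin_add_two_le hp0 hp K
      have h3 : S₀ ≤ u - p 0 - p 1 := h2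
      linarith
    have hpos0 : 0 < truncation p u ((1 - ε) * M) κ K 0 := by
      rw [e0]
      have h1 : κ * (M - u + p 0) ≤ κ * (S₁ - S₀ + ε ^ 3) := mul_le_mul_of_nonneg_left hS₁0 hκ0.le
      have h2 := hu hupos
      have h3 : κ * p 0 ≥ 0 := mul_nonneg hκ0.le (hp0 0)
      have h4 : κ * ε ^ 3 ≤ ε ^ 3 := by
        have : κ ≤ 1 := by rw [hκ]; nlinarith
        have : 0 ≤ ε ^ 3 := by positivity
        nlinarith
      have h5 := mul_lt_mul_of_pos_left h2 hε
      have h6 : κ * (M - u + p 0) = (1 - ε - ε ^ 2) * (M - u) + κ * p 0 := by rw [hκ]; ring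
      nlinarith
    have hpos1 : 0 < truncation p u ((1 - ε) * M) κ K 1 := by
      rw [e1]
      have h1 : (1 - ε) * M - κ * S₁ = (1 - ε) * (M - S₁) + ε ^ 2 * S₁ := by rw [hκ]; ring
      rw [h1]
      have hε' : 0 < 1 - ε := by nlinarith
      have hp1 := hp0 1
      rcases hS₁p.eq_or_lt with h | h
      · rw [← h]; simpa using mul_pos hε' hM
      · have : 0 < ε ^ 2 * S₁ := by positivity
        have : 0 ≤ (1 - ε) * (M - S₁) := mul_nonneg hε'.le (by linarith)
        linarith
    refine ⟨fun m => ?_, Or.inl ⟨hpos0, hpos1⟩⟩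
    refine Fin.cases hpos0.le (fun m => Fin.cases hpos1.le (fun i => ?_) m) m
    rw [e2]
    exact mul_nonneg hκ0.le (hp0 _)

open Classical in
/-- Empirical data of infinite range are limits of data to which `exists_tendsto_counts` applies,
along which the exponential rates converge as well. -/
theorem exists_approximation {A : Type*} [Fintype A] {kmax : ℕ} {w : ℝ} {u : A → ℝ}
    (r : A × LabelPath A kmax → ℝ) (p : A → ℕ → ℝ)
    (hr0 : ∀ y, 0 ≤ r y) (hp0 : ∀ a m, 0 ≤ p a m)
    (hr : ∀ a, ∑ t, r (a, t) = u a) (hp : ∀ a, HasSum (p a) (u a))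
    (hT : ∀ a, HasSum (fun m : ℕ => (m : ℝ) * p a m) (∑ y, r y * occ y.2 a))
    (t0 : LabelPath A kmax) (ht0 : ∀ a, occ t0 a = 0)
    {σ : A → ℝ} (hσ : ∀ a, HasSum (fun m : ℕ => factorialRate (p a m) +
      p a m * Real.log m.factorial) (σ a))
    {b : ℝ} (hb : ∑ y, factorialRate (r y) + ∑ a, σ a - 2 * ∑ a, factorialRate (u a)
      - ∑ a, factorialRate (∑ y, r y * occ y.2 a)
      + (∑ a, ∑ y, r y * occ y.2 a) * Real.log w + w * Real.log kmax < b)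
    {η : ℕ → ℝ} {τ : A → ℝ} (hη : ∀ a, HasSum (fun m : ℕ => η m * p a m) (τ a))
    {δ : ℝ} (hδ : 0 < δ) (K0 : ℕ) :
    ∃ (K : ℕ) (r' : A × LabelPath A kmax → ℝ) (p' : A → Fin (K + 2) → ℝ),
      K0 ≤ K ∧ (∀ y, 0 ≤ r' y) ∧ (∀ a m, 0 ≤ p' a m) ∧
      (∀ a, ∑ t, r' (a, t) = u a) ∧ (∀ a, ∑ m, p' a m = u a) ∧
      (∀ a, ∑ m, p' a m * (m : ℕ) = ∑ y, r' y * occ y.2 a) ∧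
      (∀ a, 0 < r' (a, t0) ∨ ∀ t, t ≠ t0 → r' (a, t) = 0) ∧
      (∀ a, (0 < p' a 0 ∧ 0 < p' a 1) ∨ ∀ m, m ≠ 0 → p' a m = 0) ∧
      (∀ y, |r' y - r y| < δ) ∧
      (∀ m < K0, ∀ a, |(if h : m < K + 2 then p' a ⟨m, h⟩ else 0) - p a m| < δ) ∧
      typeRate w u r' p' < b ∧ ∑ a, ∑ m : Fin (K + 2), η m * p' a m < ∑ a, τ a + δ := by
  set M : A → ℝ := fun a => ∑ y, r y * occ y.2 a with hMdef
  let ε : ℕ → ℝ := fun j => 1 / ((j : ℝ) + 1 + 1)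
  have hε0 : ∀ j, 0 < ε j := fun j => by positivity
  have hε : Tendsto ε atTop (𝓝 0) := by
    have := (tendsto_add_atTop_iff_nat 1).2 (tendsto_one_div_add_atTop_nhds_zero_nat (𝕜 := ℝ))
    simpa [ε] using this
  have hKex : ∀ j : ℕ, ∃ K : ℕ, j ≤ K ∧ ∀ a,
      M a - p a 1 - ∑ i : Fin K, ((i + 2 : ℕ) : ℝ) * p a (i + 2) ≤ ε j ^ 3 := by
    intro j
    have h1 : ∀ᶠ K : ℕ in atTop, ∀ a,
        M a - p a 1 - ∑ i : Fin K, ((i + 2 : ℕ) : ℝ) * p a (i + 2) ≤ ε j ^ 3 := by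
      rw [eventually_all]
      intro a
      have h2 := (tendsto_sum_fin_add_two (hT a) tendsto_id).const_sub (M a - p a 1)
      have h3 : M a - p a 1 - (M a - ((0 : ℕ) : ℝ) * p a 0 - ((1 : ℕ) : ℝ) * p a 1) < ε j ^ 3 := by
        have : 0 < ε j ^ 3 := pow_pos (hε0 j) 3
        simpa using this
      filter_upwards [h2.eventually_lt_const h3] with K hK
      exact hK.le
    obtain ⟨K, h2, h3⟩ := ((eventually_ge_atTop j).and h1).exists
    exact ⟨K, h2, h3⟩
  choose K hKj hKtail using hKex
  have hK : Tendsto K atTop atTop := tendsto_atTop_mono hKj tendsto_id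
  let κ : ℕ → ℝ := fun j => 1 - ε j - ε j ^ 2
  have hκ : Tendsto κ atTop (𝓝 1) := by
    have := (hε.const_sub 1).sub (hε.pow 2)
    simpa using this
  have h1ε : Tendsto (fun j => 1 - ε j) atTop (𝓝 1) := by simpa using hε.const_sub 1
  have hM' : ∀ a, Tendsto (fun j => (1 - ε j) * M a) atTop (𝓝 (M a)) := fun a => by
    simpa using h1ε.mul_const (M a)
  let r' : ℕ → A × LabelPath A kmax → ℝ := fun j y =>
    (1 - ε j) * r y + if y.2 = t0 then ε j * u y.1 else 0
  have hr' : ∀ y, Tendsto (fun j => r' j y) atTop (𝓝 (r y)) := by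
    intro y
    have h2 : Tendsto (fun j => if y.2 = t0 then ε j * u y.1 else 0) atTop (𝓝 0) := by
      split_ifs
      · simpa using hε.mul_const (u y.1)
      · exact tendsto_const_nhds
    simpa using (h1ε.mul_const (r y)).add h2
  have hr'M : ∀ j a, ∑ y, r' j y * occ y.2 a = (1 - ε j) * M a := by
    intro j a
    simp only [hMdef, Finset.mul_sum]
    refine Finset.sum_congr rfl fun y _ => ?_
    by_cases hy : y.2 = t0
    · simp [hy, ht0]
    · simp [r', hy, mul_assoc]
  let p' : ∀ j, A → Fin (K j + 2) → ℝ := fun j a =>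
    truncation (p a) (u a) ((1 - ε j) * M a) (κ j) (K j)
  have hu0 : ∀ a, 0 ≤ u a := fun a => (hp a).nonneg (hp0 a)
  have ev1 : ∀ᶠ j in atTop, ε j + ε j ^ 2 < 1 := by
    have := hε.add (hε.pow 2)
    exact this.eventually_lt_const (by norm_num)
  have ev2 : ∀ᶠ j in atTop, ∀ a, 0 < u a → ε j * (M a - u a) + ε j ^ 2 < u a := by
    rw [eventually_all]
    intro a
    by_cases ha : 0 < u a
    · have := (hε.mul_const (M a - u a)).add (hε.pow 2)
      filter_upwards [this.eventually_lt_const (u := u a) (by simpa using ha)] with j hj _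
      exact hj
    · exact Eventually.of_forall fun j h => absurd h ha
  have ev3 : ∀ᶠ j in atTop, ∀ y, |r' j y - r y| < δ := by
    rw [eventually_all]
    intro y
    have := ((hr' y).sub_const (r y)).abs
    exact this.eventually_lt_const (by simpa using hδ)
  have ev4 : ∀ᶠ j in atTop, ∀ m ∈ Finset.range K0, ∀ a,
      |(if h : m < K j + 2 then p' j a ⟨m, h⟩ else 0) - p a m| < δ := by
    rw [Finset.eventually_all]
    intro m _
    rw [eventually_all]
    intro a
    have := ((tendsto_truncation (hp a) (hT a) hκ (hM' a) hK m).sub_const (p a m)).abs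
    exact this.eventually_lt_const (by simpa using hδ)
  have ev5 : ∀ᶠ j in atTop, typeRate w u (r' j) (p' j) < b := by
    refine Tendsto.eventually_lt_const hb ?_
    unfold typeRate
    refine ((((Tendsto.add ?_ ?_).sub tendsto_const_nhds).sub ?_).add (Tendsto.mul_const _ ?_)).add
      tendsto_const_nhds
    · exact tendsto_finsetSum _ fun y _ => (continuous_factorialRate.tendsto _).comp (hr' y)
    · exact tendsto_finsetSum _ fun a _ =>
        tendsto_sum_truncation_rate (hp0 a) (hp a) (hT a) hκ (hM' a) hK (hσ a)
    · refine tendsto_finsetSum _ fun a _ => (continuous_factorialRate.tendsto _).comp ?_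
      simpa only [hr'M] using hM' a
    · refine tendsto_finsetSum _ fun a _ => ?_
      simpa only [hr'M] using hM' a
  have ev6 : ∀ᶠ j in atTop, ∑ a, ∑ m : Fin (K j + 2), η m * p' j a m < ∑ a, τ a + δ :=
    Tendsto.eventually_lt_const (by linarith : ∑ a, τ a < ∑ a, τ a + δ)
      (tendsto_finsetSum _ fun a _ =>
        tendsto_sum_truncation_mul (hp a) (hT a) hκ (hM' a) hK (hη a))
  obtain ⟨j, h1, h2, h3, h4, h5, h6, h7⟩ := (ev1.and (ev2.and (ev3.and (ev4.and (ev5.and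
    (ev6.and (eventually_ge_atTop K0))))))).exists
  have hpos := fun a => truncation_nonneg (K := K j) (hp0 a) (hp a) (hT a) (hε0 j) h1
    (hKtail j a) (h2 a)
  have h1' : 0 < 1 - ε j := by nlinarith [hε0 j]
  refine ⟨K j, r' j, p' j, h7.trans (hKj j), fun y => ?_, fun a => (hpos a).1, fun a => ?_,
    fun a => sum_truncation_eq, fun a => ?_, fun a => ?_, fun a => (hpos a).2, h3,
    fun m hm => h4 m (Finset.mem_range.2 hm), h5, h6⟩
  · refine add_nonneg (mul_nonneg h1'.le (hr0 y)) ?_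
    split_ifs
    · exact mul_nonneg (hε0 j).le (hu0 _)
    · exact le_rfl
  · simp only [r', Finset.sum_add_distrib, ← Finset.mul_sum, hr, Finset.sum_ite_eq',
      Finset.mem_univ, if_true]
    ring
  · rw [hr'M]
    exact sum_truncation_mul
  · rcases (hu0 a).eq_or_lt with h | h
    · right
      intro t ht
      have h8 := hr a
      rw [← h, Finset.sum_eq_zero_iff_of_nonneg fun t _ => hr0 _] at h8
      simp [r', ht, h8 t (Finset.mem_univ _)]
    · left
      simp only [r', if_true]
      have := mul_nonneg h1'.le (hr0 (a, t0))
      have := mul_pos (hε0 j) h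
      linarith

end

end MultihopGibbs

namespace MultihopGibbs

noncomputable section

open InformationTheory

theorem finsetSum_measureReal_apply {E ι : Type*} [MeasurableSpace E] (s : Finset ι)
    (ν : ι → Measure E) [∀ i, IsFiniteMeasure (ν i)] (S : Set E) :
    (∑ i ∈ s, ν i).real S = ∑ i ∈ s, (ν i).real S := by
  simp only [Measure.real, Measure.finsetSum_apply]
  exact ENNReal.toReal_sum fun i _ => measure_ne_top _ _

/-- The relative entropy dominates its discretization to finitely many cells. -/
theorem sum_cells_le_klDiv {E A : Type*} [MeasurableSpace E] [Fintype A] [MeasurableSpace A]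
    [MeasurableSingletonClass A] (ν ρ : Measure E) [IsFiniteMeasure ν] [IsFiniteMeasure ρ]
    {c : E → A} (hc : Measurable c) (h : klDiv ν ρ ≠ ⊤) :
    ∑ a, ρ.real (c ⁻¹' {a}) * klFun (ν.real (c ⁻¹' {a}) / ρ.real (c ⁻¹' {a})) ≤
      (klDiv ν ρ).toReal := by
  obtain ⟨hac, hint⟩ := klDiv_ne_top_iff.1 h
  have hi : Integrable (fun x => klFun (ν.rnDeriv ρ x).toReal) ρ :=
    (integrable_klFun_rnDeriv_iff hac).2 hint
  have hm : ∀ a, MeasurableSet (c ⁻¹' {a}) := fun a => hc (measurableSet_singleton a)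
  have hsplit : ∫ x, klFun (ν.rnDeriv ρ x).toReal ∂ρ =
      ∑ a, ∫ x in c ⁻¹' {a}, klFun (ν.rnDeriv ρ x).toReal ∂ρ := by
    rw [← integral_iUnion_fintype hm ?_ fun a => hi.integrableOn]
    · have : ⋃ a, c ⁻¹' {a} = Set.univ := by ext; simp
      rw [this, setIntegral_univ]
    · intro a b hab
      exact (Set.disjoint_singleton.2 hab).preimage c
  rw [toReal_klDiv_eq_integral_klFun hac, hsplit]
  refine Finset.sum_le_sum fun a _ => ?_
  by_cases h0 : ρ (c ⁻¹' {a}) = 0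
  · rw [Measure.real, h0]
    simp only [ENNReal.toReal_zero, zero_mul]
    exact integral_nonneg fun x => klFun_nonneg ENNReal.toReal_nonneg
  · have hpos : 0 < ρ.real (c ⁻¹' {a}) :=
      ENNReal.toReal_pos h0 (measure_ne_top _ _)
    have := convexOn_klFun.map_set_average_le (μ := ρ) (t := c ⁻¹' {a})
      (f := fun x => (ν.rnDeriv ρ x).toReal)
      continuous_klFun.continuousOn isClosed_Ici h0 (measure_ne_top _ _)
      (ae_of_all _ fun x => ENNReal.toReal_nonneg) Measure.integrable_toReal_rnDeriv.integrableOn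
      hi.integrableOn
    rw [setAverage_eq, setAverage_eq, Measure.setIntegral_toReal_rnDeriv hac, smul_eq_mul,
      smul_eq_mul, ← div_eq_inv_mul, ← div_eq_inv_mul, le_div_iff₀ hpos] at this
    linarith

theorem mul_klFun_div {s t : ℝ} (h : t = 0 → s = 0) :
    t * klFun (s / t) = factorialRate s - s * Real.log t + t := by
  unfold klFun factorialRate
  rcases eq_or_ne t 0 with rfl | ht
  · simp [h rfl]
  · rcases eq_or_ne s 0 with rfl | hs
    · simp
    · rw [Real.log_div hs ht]
      field_simp
      ring

section Limit

variable {V : Type*} [MetricSpace V] [CompactSpace V] [MeasurableSpace V] [BorelSpace V]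
variable {μ : FiniteMeasure V} {x : ℕ → V} {n : ℝ≥0 → ℕ} {kmax : ℕ} {Ψ : Setting V kmax}

theorem toReal_add_lt_of_rate_lt (hΨ : IsAdmissible μ Ψ) {b : ℝ} (hb : rate μ Ψ < b) :
    (∀ k : Fin kmax, klDiv (Ψ.1 k : Measure (Fin (k + 1) → V)) (referenceMeasure μ Ψ k) ≠ ⊤) ∧
    ∑' m : ℕ, klDiv (Ψ.2 m : Measure V)
      (ENNReal.ofReal (poissonWeight (μ.mass : ℝ) m) • (μ : Measure V)) ≠ ⊤ ∧
    ∑ k : Fin kmax, (klDiv (Ψ.1 k : Measure (Fin (k + 1) → V)) (referenceMeasure μ Ψ k)).toReal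
      + (∑' m : ℕ, klDiv (Ψ.2 m : Measure V)
        (ENNReal.ofReal (poissonWeight (μ.mass : ℝ) m) • (μ : Measure V))).toReal
      + ((μ.mass : ℝ) * (1 - ∑ k : Fin kmax, (relayMeasure Ψ).real Set.univ ^ (k : ℕ))
        - 1 / Real.exp 1) + μ.mass * Real.log kmax < b := by
  rw [rate, if_pos hΨ, entropy] at hb
  set S₁ := ∑ k : Fin kmax, klDiv (Ψ.1 k : Measure (Fin (k + 1) → V)) (referenceMeasure μ Ψ k)
    with hS₁
  set S₂ := ∑' m : ℕ, klDiv (Ψ.2 m : Measure V)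
        (ENNReal.ofReal (poissonWeight (μ.mass : ℝ) m) • (μ : Measure V))
  have h1 : S₁ ≠ ⊤ := by
    intro h
    rw [h, EReal.coe_ennreal_top, EReal.top_add_of_ne_bot (by simp), EReal.top_add_coe,
      EReal.top_add_coe] at hb
    exact not_top_lt hb
  have h2 : S₂ ≠ ⊤ := by
    intro h
    rw [h, EReal.coe_ennreal_top, EReal.add_top_of_ne_bot (by simp), EReal.top_add_coe,
      EReal.top_add_coe] at hb
    exact not_top_lt hb
  have h3 : ∀ k ∈ (Finset.univ : Finset (Fin kmax)), klDiv (Ψ.1 k : Measure (Fin (k + 1) → V))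
      (referenceMeasure μ Ψ k) ≠ ⊤ := fun k hk => by
    rw [hS₁] at h1
    exact (ENNReal.sum_ne_top.1 h1) k hk
  refine ⟨fun k => h3 k (Finset.mem_univ k), h2, ?_⟩
  rw [← ENNReal.toReal_sum h3, ← hS₁]
  rw [← EReal.coe_ennreal_toReal h1, ← EReal.coe_ennreal_toReal h2, ← EReal.coe_add,
    ← EReal.coe_add, ← EReal.coe_add, EReal.coe_lt_coe_iff] at hb
  exact hb

/-- The mass that `Ψ` gives to the trajectories with labels `y`. -/
def cellTraj {N : ℕ} (Ψ : Setting V kmax) (c : V → Fin N)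
    (y : Fin N × LabelPath (Fin N) kmax) : ℝ :=
  (Ψ.1 y.2.1 : Measure (Fin (y.2.1 + 1) → V)).real
    ((fun z => c ∘ z) ⁻¹' {(Fin.cons y.1 y.2.2 : Fin (y.2.1 + 1) → Fin N)})

theorem sum_mul_cellTraj (Ψ : Setting V kmax) {N : ℕ} {c : V → Fin N} (hc : Measurable c)
    (F : Fin N → LabelPath (Fin N) kmax → ℝ) :
    ∑ y, F y.1 y.2 * cellTraj Ψ c y = ∑ k : Fin kmax, ∫ y, F (c (y 0)) ⟨k, fun l => c (y l.succ)⟩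
      ∂(Ψ.1 k : Measure (Fin (k + 1) → V)) := by
  rw [Fintype.sum_prod_type]
  exact sum_cells_eq (fun k : Fin kmax => (Ψ.1 k : Measure (Fin (k + 1) → V))) hc F

theorem cellTraj_empirical (lam : ℝ≥0) {n : ℕ} (s : Config n kmax) {N : ℕ} {c : V → Fin N}
    (hc : Measurable c) (y : Fin N × LabelPath (Fin N) kmax) [DecidableEq (LabelPath (Fin N) kmax)] :
    cellTraj (empirical lam x s) c y = (lam : ℝ)⁻¹ *
      (Finset.univ.filter fun j : Fin n =>
        (c (x j), relabel (fun i : Fin n => c (x i)) (s j)) = y).card := by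
  have h := sum_mul_cellTraj (empirical lam x s) hc fun a t => if (a, t) = y then 1 else 0
  have h2 := sum_integral_trajMeasure lam x s fun k z =>
    if (c (z 0), (⟨k, fun l => c (z l.succ)⟩ : LabelPath (Fin N) kmax)) = y then (1 : ℝ) else 0
  have h3 := h.trans h2
  simp only [ite_mul, one_mul, zero_mul, Prod.mk.eta, Finset.sum_ite_eq', Finset.mem_univ,
    if_true] at h3
  rw [h3, Finset.card_filter]
  push_cast
  rfl

theorem sum_cellTraj_eq (hΨ : IsAdmissible μ Ψ) {N : ℕ} {c : V → Fin N} (hc : Measurable c)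
    (a : Fin N) : ∑ t, cellTraj Ψ c (a, t) = (μ : Measure V).real (c ⁻¹' {a}) := by
  have h := sum_mul_cellTraj Ψ hc fun b _ => if b = a then 1 else 0
  have hm : MeasurableSet (c ⁻¹' {a}) := hc (measurableSet_singleton a)
  have e : ∀ k : Fin kmax, ∫ y, (if c (y 0) = a then (1 : ℝ) else 0)
      ∂(Ψ.1 k : Measure (Fin (k + 1) → V)) =
      ((Ψ.1 k : Measure (Fin (k + 1) → V)).map fun y => y 0).real (c ⁻¹' {a}) := by
    intro k
    rw [← integral_indicator_one hm, integral_map (measurable_pi_apply 0).aemeasurable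
      (measurable_indicator_one hm).aestronglyMeasurable]
    exact integral_congr_ae (ae_of_all _ fun y => by simp [Set.indicator])
  rw [Finset.sum_congr rfl fun k _ => e k, Fintype.sum_prod_type] at h
  rw [← hΨ.start, finsetSum_measureReal_apply, ← h, Finset.sum_eq_single a]
  · simp
  · intro b _ hb; simp [hb]
  · simp

theorem sum_cellTraj_mul_occ (Ψ : Setting V kmax) {N : ℕ} {c : V → Fin N} (hc : Measurable c)
    (a : Fin N) : ∑ y, cellTraj Ψ c y * occ y.2 a = (relayMarginal Ψ).real (c ⁻¹' {a}) := by
  have h := sum_mul_cellTraj Ψ hc fun _ t => (occ t a : ℝ)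
  have hm : MeasurableSet (c ⁻¹' {a}) := hc (measurableSet_singleton a)
  simp only [mul_comm] at h ⊢
  rw [h, relayMarginal, finsetSum_measureReal_apply]
  refine Finset.sum_congr rfl fun k _ => ?_
  rw [finsetSum_measureReal_apply]
  simp only [occ_eq_sum, Nat.cast_sum, Nat.cast_ite, Nat.cast_one, Nat.cast_zero]
  change ∫ y, ∑ l : Fin k, (if c (y l.succ) = a then (1 : ℝ) else 0)
    ∂(Ψ.1 k : Measure (Fin (k + 1) → V)) = _
  rw [integral_finsetSum]
  · refine Finset.sum_congr rfl fun l _ => ?_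
    rw [← integral_indicator_one hm, integral_map (measurable_pi_apply _).aemeasurable
      (measurable_indicator_one hm).aestronglyMeasurable]
    exact integral_congr_ae (ae_of_all _ fun y => by simp [Set.indicator])
  · intro l _
    have hme : Measurable fun y : Fin (k + 1) → V =>
        (c ⁻¹' {a}).indicator (fun _ => (1 : ℝ)) (y l.succ) :=
      (measurable_indicator_one hm).comp (measurable_pi_apply l.succ)
    refine Integrable.of_bound (C := 1) (hme.aestronglyMeasurable.congr
      (ae_of_all _ fun y => by simp [Set.indicator])) (ae_of_all _ fun y => ?_)
    split_ifs <;> simp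

theorem hopMeasure_real_cell (lam : ℝ≥0) (hx : Function.Injective x) {n : ℕ} (s : Config n kmax)
    {N : ℕ} {c : V → Fin N} (hc : Measurable c) (a : Fin N) (m : ℕ) :
    (hopMeasure lam x s m : Measure V).real (c ⁻¹' {a}) = (lam : ℝ)⁻¹ *
      (Finset.univ.filter fun u : Fin n => c (x u) = a ∧ hits s u = m).card := by
  have hm : MeasurableSet (c ⁻¹' {a}) := hc (measurableSet_singleton a)
  rw [← integral_indicator_one hm, integral_hopMeasure lam hx, Finset.card_filter]
  push_cast
  congr 1
  refine Finset.sum_congr rfl fun i _ => ?_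
  by_cases h1 : c (x i) = a <;> by_cases h2 : hits s i = m <;> simp [h1, h2, Set.indicator]

theorem tendsto_card_cell
    (hL : Tendsto (fun lam => userMeasure lam x (n lam)) atTop (𝓝 μ))
    {N : ℕ} {c : V → Fin N} (hc : Measurable c)
    (hcl : ∀ a, (μ : Measure V) (closure (c ⁻¹' {a})) = (μ : Measure V) (c ⁻¹' {a})) (a : Fin N) :
    Tendsto (fun lam : ℝ≥0 => ((Finset.univ.filter fun j : Fin (n lam) => c (x j) = a).card : ℝ) /
      lam) atTop (𝓝 ((μ : Measure V).real (c ⁻¹' {a}))) := by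
  rw [Metric.tendsto_nhds]
  intro ε hε
  have hw : ∑ b, (μ : Measure V).real (c ⁻¹' {b}) = μ.mass := sum_measureReal_preimage _ hc
  obtain ⟨δ, hδ, hδε⟩ : ∃ δ > 0, (N : ℝ) * δ + δ < ε := by
    refine ⟨ε / (N + 2), by positivity, ?_⟩
    rw [← add_one_mul, ← mul_div_assoc, div_lt_iff₀ (by positivity)]
    nlinarith
  filter_upwards [eventually_sum_cell_le hL hc hcl hδ,
    (tendsto_card_div hL).eventually_const_lt (show (μ.mass : ℝ) - δ < μ.mass by linarith),
    tendsto_coe_atTop_real.eventually_gt_atTop 0] with lam h1 h2 hl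
  have h3 := h1 (fun b => if b = a then 1 else 0) (fun b => by split_ifs <;> norm_num)
  have h4 := h1 (fun b => if b = a then 0 else 1) (fun b => by split_ifs <;> norm_num)
  have e1 : ∑ j : Fin (n lam), (if c (x j) = a then (1 : ℝ) else 0) =
      (Finset.univ.filter fun j : Fin (n lam) => c (x j) = a).card := by
    rw [Finset.card_filter]; push_cast; rfl
  have e2 : ∑ j : Fin (n lam), (if c (x j) = a then (0 : ℝ) else 1) =
      n lam - (Finset.univ.filter fun j : Fin (n lam) => c (x j) = a).card := by
    rw [← e1, eq_sub_iff_add_eq, ← Finset.sum_add_distrib]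
    rw [Finset.sum_congr rfl (g := fun _ => (1 : ℝ)) fun j _ => by split_ifs <;> norm_num]
    simp
  have e3 : ∑ b, ((μ : Measure V).real (c ⁻¹' {b}) + δ) * (if b = a then (0 : ℝ) else 1) =
      μ.mass + N * δ - ((μ : Measure V).real (c ⁻¹' {a}) + δ) := by
    have : ∀ b, ((μ : Measure V).real (c ⁻¹' {b}) + δ) * (if b = a then (0 : ℝ) else 1) =
        ((μ : Measure V).real (c ⁻¹' {b}) + δ) -
        if b = a then (μ : Measure V).real (c ⁻¹' {b}) + δ else 0 := fun b => by
      split_ifs <;> ring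
    simp only [this, Finset.sum_sub_distrib, Finset.sum_add_distrib, hw, Finset.sum_ite_eq',
      Finset.mem_univ, if_true]
    simp
  rw [e1] at h3
  rw [e2, e3] at h4
  simp only [mul_ite, mul_one, mul_zero, Finset.sum_ite_eq', Finset.mem_univ, if_true] at h3
  rw [lt_div_iff₀ hl] at h2
  rw [Real.dist_eq, abs_lt]
  have h5 : (Finset.univ.filter fun j : Fin (n lam) => c (x j) = a).card / (lam : ℝ) ≤
      (μ : Measure V).real (c ⁻¹' {a}) + δ := by
    rw [div_le_iff₀ hl]; linarith
  have h6 : (μ : Measure V).real (c ⁻¹' {a}) - N * δ ≤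
      (Finset.univ.filter fun j : Fin (n lam) => c (x j) = a).card / (lam : ℝ) := by
    rw [le_div_iff₀ hl]; nlinarith
  have h7 : 0 ≤ (N : ℝ) * δ := by positivity
  constructor <;> linarith

end Limit

end

end MultihopGibbs

namespace MultihopGibbs

noncomputable section

open InformationTheory

theorem hasSum_toReal_tsum {ι : Type*} {f : ι → ℝ≥0∞} (h : ∑' i, f i ≠ ⊤) :
    HasSum (fun i => (f i).toReal) (∑' i, f i).toReal := by
  rw [ENNReal.tsum_toReal_eq fun i => ENNReal.ne_top_of_tsum_ne_top h i]
  exact ENNReal.hasSum_toReal h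

section Limit

variable {V : Type*} [MetricSpace V] [CompactSpace V] [MeasurableSpace V] [BorelSpace V]
variable {μ : FiniteMeasure V} {x : ℕ → V} {n : ℝ≥0 → ℕ} {kmax : ℕ} {Ψ : Setting V kmax}

theorem IsAdmissible.hasSum_cell (hΨ : IsAdmissible μ Ψ) {S : Set V} (hS : MeasurableSet S) :
    HasSum (fun m => (Ψ.2 m : Measure V).real S) ((μ : Measure V).real S) := by
  have h1 : (μ : Measure V) S = ∑' m : ℕ, (Ψ.2 m : Measure V) S := by
    rw [← hΨ.users, Measure.sum_apply _ hS]
  have h2 := measure_ne_top (μ : Measure V) S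
  rw [h1] at h2
  have h3 := hasSum_toReal_tsum h2
  rwa [← h1] at h3

theorem IsAdmissible.hasSum_mul_cell (hΨ : IsAdmissible μ Ψ) {S : Set V} (hS : MeasurableSet S) :
    HasSum (fun m : ℕ => (m : ℝ) * (Ψ.2 m : Measure V).real S) ((relayMeasure Ψ).real S) := by
  have hfin := hΨ.isFiniteMeasure
  have h1 : relayMeasure Ψ S = ∑' m : ℕ, (m : ℝ≥0∞) * (Ψ.2 m : Measure V) S := by
    rw [relayMeasure, Measure.sum_apply _ hS]
    rfl
  have h2 := measure_ne_top (relayMeasure Ψ) S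
  rw [h1] at h2
  have h3 := hasSum_toReal_tsum h2
  rw [← h1] at h3
  simp only [ENNReal.toReal_mul, ENNReal.toReal_natCast] at h3
  exact h3

/-- The discretized hop numbers have finite entropy. -/
theorem exists_hasSum_hop_rate (hμ : 0 < (μ.mass : ℝ)) (hΨ : IsAdmissible μ Ψ) {N : ℕ}
    {c : V → Fin N} (hc : Measurable c)
    (hfin : ∑' m : ℕ, klDiv (Ψ.2 m : Measure V)
      (ENNReal.ofReal (poissonWeight (μ.mass : ℝ) m) • (μ : Measure V)) ≠ ⊤) :
    ∃ σ : Fin N → ℝ, (∀ a, HasSum (fun m : ℕ =>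
        factorialRate ((Ψ.2 m : Measure V).real (c ⁻¹' {a})) +
          (Ψ.2 m : Measure V).real (c ⁻¹' {a}) * Real.log m.factorial) (σ a)) ∧
      ∑ a, σ a ≤ (∑' m : ℕ, klDiv (Ψ.2 m : Measure V)
        (ENNReal.ofReal (poissonWeight (μ.mass : ℝ) m) • (μ : Measure V))).toReal
        - μ.mass - 1 / Real.exp 1
        - (∑ a, (relayMeasure Ψ).real (c ⁻¹' {a})) * (1 + Real.log μ.mass)
        + ∑ a, (μ : Measure V).real (c ⁻¹' {a}) * Real.log ((μ : Measure V).real (c ⁻¹' {a})) := by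
  set w : ℝ := (μ.mass : ℝ) with hw
  set u : Fin N → ℝ := fun a => (μ : Measure V).real (c ⁻¹' {a}) with hu
  set p : Fin N → ℕ → ℝ := fun a m => (Ψ.2 m : Measure V).real (c ⁻¹' {a}) with hp
  have hm : ∀ a, MeasurableSet (c ⁻¹' {a}) := fun a => hc (measurableSet_singleton a)
  have hu0 : ∀ a, 0 ≤ u a := fun a => measureReal_nonneg
  have hp0 : ∀ a m, 0 ≤ p a m := fun a m => measureReal_nonneg
  have hpu : ∀ a, HasSum (p a) (u a) := fun a => hΨ.hasSum_cell (hm a)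
  have hpM : ∀ a, HasSum (fun m : ℕ => (m : ℝ) * p a m) ((relayMeasure Ψ).real (c ⁻¹' {a})) :=
    fun a => hΨ.hasSum_mul_cell (hm a)
  have hle : ∀ a m, p a m ≤ u a := fun a m => le_hasSum (hpu a) m fun j _ => hp0 a j
  let E : Fin N → ℕ → ℝ := fun a m =>
    poissonWeight w m * u a * klFun (p a m / (poissonWeight w m * u a))
  have hE0 : ∀ a m, 0 ≤ E a m := fun a m =>
    mul_nonneg (mul_nonneg (poissonWeight_pos hμ m).le (hu0 a))
      (klFun_nonneg (div_nonneg (hp0 a m) (mul_nonneg (poissonWeight_pos hμ m).le (hu0 a))))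
  have hEsum : ∀ m, ∑ a, E a m ≤ (klDiv (Ψ.2 m : Measure V)
      (ENNReal.ofReal (poissonWeight w m) • (μ : Measure V))).toReal := by
    intro m
    have : IsFiniteMeasure (ENNReal.ofReal (poissonWeight w m) • (μ : Measure V)) :=
      Measure.smul_finite _ ENNReal.ofReal_ne_top
    refine le_trans (le_of_eq ?_) (sum_cells_le_klDiv (Ψ.2 m : Measure V)
      (ENNReal.ofReal (poissonWeight w m) • (μ : Measure V)) hc (ENNReal.ne_top_of_tsum_ne_top hfin m))
    refine Finset.sum_congr rfl fun a _ => ?_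
    rw [measureReal_ennreal_smul_apply, ENNReal.toReal_ofReal (poissonWeight_pos hμ m).le]
  have hkl := hasSum_toReal_tsum hfin
  have hEs : ∀ a, Summable (E a) := fun a =>
    Summable.of_nonneg_of_le (hE0 a) (fun m => (Finset.single_le_sum (f := fun a => E a m)
      (fun a _ => hE0 a m) (Finset.mem_univ a)).trans (hEsum m)) hkl.summable
  have hexp : Real.log (Real.exp 1 * w) = 1 + Real.log w := by
    rw [Real.log_mul (Real.exp_pos 1).ne' hμ.ne', Real.log_exp]
  have hterm : ∀ a (m : ℕ), factorialRate (p a m) + p a m * Real.log m.factorial =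
      E a m - poissonWeight w m * u a + p a m * (Real.log (u a) - 1 / (Real.exp 1 * w))
        - (m : ℝ) * p a m * (1 + Real.log w) := by
    intro a m
    have h0 : poissonWeight w m * u a = 0 → p a m = 0 := by
      intro h
      have : u a = 0 := (mul_eq_zero.1 h).resolve_left (poissonWeight_pos hμ m).ne'
      exact le_antisymm ((hle a m).trans_eq this) (hp0 a m)
    simp only [E]
    rw [mul_klFun_div h0]
    rcases eq_or_ne (p a m) 0 with h | h
    · rw [h]; ring
    · have hua : u a ≠ 0 := fun h' => h (le_antisymm ((hle a m).trans_eq h') (hp0 a m))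
      have h1 := congrArg Real.log (poissonWeight_mul_factorial hμ m)
      rw [Real.log_exp, Real.log_mul (poissonWeight_pos hμ m).ne' (by positivity), hexp] at h1
      rw [Real.log_mul (poissonWeight_pos hμ m).ne' hua]
      have h2 : Real.log m.factorial = -(1 / (Real.exp 1 * w)) - m * (1 + Real.log w) -
        Real.log (poissonWeight w m) := by linarith
      rw [h2]
      ring
  refine ⟨fun a => ∑' m, E a m - u a + u a * (Real.log (u a) - 1 / (Real.exp 1 * w))
    - (relayMeasure Ψ).real (c ⁻¹' {a}) * (1 + Real.log w), fun a => ?_, ?_⟩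
  · change HasSum (fun m : ℕ => factorialRate (p a m) + p a m * Real.log m.factorial) _
    simp only [hterm]
    have h1 := (hasSum_poissonWeight w).mul_right (u a)
    rw [one_mul] at h1
    exact (((hEs a).hasSum.sub h1).add ((hpu a).mul_right _)).sub ((hpM a).mul_right _)
  · have hw' : ∑ a, u a = w := sum_measureReal_preimage _ hc
    have h1 : ∑ a, ∑' m, E a m ≤ (∑' m : ℕ, klDiv (Ψ.2 m : Measure V)
        (ENNReal.ofReal (poissonWeight w m) • (μ : Measure V))).toReal := by
      rw [← Summable.tsum_finsetSum fun a _ => hEs a]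
      exact hasSum_le hEsum (summable_sum fun a _ => hEs a).hasSum hkl
    simp only [mul_sub, Finset.sum_sub_distrib, Finset.sum_add_distrib, ← Finset.sum_mul, hw']
    have h2 : w * (1 / (Real.exp 1 * w)) = 1 / Real.exp 1 := by field_simp
    rw [h2]
    linarith

theorem sum_factorialRate_cellTraj_le (hΨ : IsAdmissible μ Ψ) {N : ℕ}
    {c : V → Fin N} (hc : Measurable c)
    (hfin : ∀ k : Fin kmax,
      klDiv (Ψ.1 k : Measure (Fin (k + 1) → V)) (referenceMeasure μ Ψ k) ≠ ⊤) :
    ∑ y, factorialRate (cellTraj Ψ c y) ≤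
      ∑ k : Fin kmax, (klDiv (Ψ.1 k : Measure (Fin (k + 1) → V)) (referenceMeasure μ Ψ k)).toReal
        - ∑ k : Fin kmax, μ.mass * (relayMeasure Ψ).real Set.univ ^ (k : ℕ)
        + ∑ a, (μ : Measure V).real (c ⁻¹' {a}) * Real.log ((μ : Measure V).real (c ⁻¹' {a}))
        + ∑ a, (relayMeasure Ψ).real (c ⁻¹' {a}) *
          Real.log ((relayMeasure Ψ).real (c ⁻¹' {a})) := by
  have hf := fun k : Fin kmax => isFiniteMeasure_referenceMeasure hΨ k
  set u : Fin N → ℝ := fun a => (μ : Measure V).real (c ⁻¹' {a}) with hu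
  set M : Fin N → ℝ := fun a => (relayMeasure Ψ).real (c ⁻¹' {a}) with hM
  let ρ : Fin N × LabelPath (Fin N) kmax → ℝ := fun y => u y.1 * ∏ l, M (y.2.2 l)
  have hρ : ∀ y : Fin N × LabelPath (Fin N) kmax, (referenceMeasure μ Ψ y.2.1).real
      ((fun z => c ∘ z) ⁻¹' {(Fin.cons y.1 y.2.2 : Fin (y.2.1 + 1) → Fin N)}) = ρ y := fun y =>
    referenceMeasure_real_cell hΨ c _ _ _
  have hac : ∀ y, ρ y = 0 → cellTraj Ψ c y = 0 := by
    intro y hy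
    rw [← hρ, measureReal_eq_zero_iff] at hy
    rw [cellTraj, measureReal_eq_zero_iff]
    exact (klDiv_ne_top_iff.1 (hfin y.2.1)).1 hy
  have h1 : ∀ k : Fin kmax, ∑ a, ∑ α : Fin k → Fin N,
      ρ (a, ⟨k, α⟩) * klFun (cellTraj Ψ c (a, ⟨k, α⟩) / ρ (a, ⟨k, α⟩)) ≤
      (klDiv (Ψ.1 k : Measure (Fin (k + 1) → V)) (referenceMeasure μ Ψ k)).toReal := by
    intro k
    refine le_trans (le_of_eq ?_) (sum_cells_le_klDiv _ _ (measurable_cells hc (k + 1)) (hfin k))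
    rw [← (Fin.consEquiv fun _ : Fin (k + 1) => Fin N).sum_comp, Fintype.sum_prod_type]
    refine Finset.sum_congr rfl fun a _ => Finset.sum_congr rfl fun α _ => ?_
    rw [← hρ]
    rfl
  have h2 : ∑ y, ρ y * klFun (cellTraj Ψ c y / ρ y) ≤
      ∑ k : Fin kmax, (klDiv (Ψ.1 k : Measure (Fin (k + 1) → V)) (referenceMeasure μ Ψ k)).toReal := by
    refine le_trans (le_of_eq ?_) (Finset.sum_le_sum fun k _ => h1 k)
    rw [Fintype.sum_prod_type, Finset.sum_comm, Fintype.sum_sigma]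
    refine Finset.sum_congr rfl fun k _ => ?_
    rw [Finset.sum_comm]
  have h3 : ∑ y, ρ y = ∑ k : Fin kmax, μ.mass * (relayMeasure Ψ).real Set.univ ^ (k : ℕ) := by
    have := sum_cells_eq_sum_integral hΨ hc (fun _ _ => (1 : ℝ))
    simp only [one_mul, integral_const, smul_eq_mul, mul_one, referenceMeasure_real_univ hΨ] at this
    rw [← this, Fintype.sum_prod_type]
    refine Finset.sum_congr rfl fun a _ => ?_
    rw [Finset.mul_sum]
  have h4 : ∀ y, cellTraj Ψ c y * Real.log (ρ y) = cellTraj Ψ c y * Real.log (u y.1) +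
      ∑ b, cellTraj Ψ c y * occ y.2 b * Real.log (M b) := by
    intro y
    rcases eq_or_ne (cellTraj Ψ c y) 0 with h | h
    · simp [h]
    · have hy : ρ y ≠ 0 := fun h' => h (hac y h')
      simp only [ρ] at hy ⊢
      rw [Real.log_mul (left_ne_zero_of_mul hy) (right_ne_zero_of_mul hy), Real.log_prod, mul_add]
      · congr 1
        simp only [mul_assoc, ← Finset.mul_sum]
        rw [sum_occ_mul y.2 fun b => Real.log (M b)]
      · intro l _ h0
        exact right_ne_zero_of_mul hy (Finset.prod_eq_zero (Finset.mem_univ l) h0)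
  have h5 : ∑ y, cellTraj Ψ c y * Real.log (ρ y) = ∑ a, u a * Real.log (u a) +
      ∑ b, M b * Real.log (M b) := by
    simp only [h4, Finset.sum_add_distrib]
    congr 1
    · rw [Fintype.sum_prod_type]
      refine Finset.sum_congr rfl fun a _ => ?_
      change ∑ t, cellTraj Ψ c (a, t) * Real.log (u a) = _
      rw [← Finset.sum_mul, sum_cellTraj_eq hΨ hc]
    · rw [Finset.sum_comm]
      refine Finset.sum_congr rfl fun b _ => ?_
      rw [← Finset.sum_mul, sum_cellTraj_mul_occ Ψ hc, ← hΨ.relayMeasure_eq]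
  have h6 : ∀ y, factorialRate (cellTraj Ψ c y) = ρ y * klFun (cellTraj Ψ c y / ρ y) +
      cellTraj Ψ c y * Real.log (ρ y) - ρ y := by
    intro y
    rw [mul_klFun_div (hac y)]
    ring
  simp only [h6, Finset.sum_sub_distrib, Finset.sum_add_distrib]
  rw [h3, h5]
  linarith

/-- The local lower bound, with control on the congestion. -/
theorem eventually_exp_le_prior (hk : 1 ≤ kmax) (hμ : 0 < (μ.mass : ℝ))
    (hx : Function.Injective x)
    (hL : Tendsto (fun lam => userMeasure lam x (n lam)) atTop (𝓝 μ))
    (hΨ : IsAdmissible μ Ψ) {b : ℝ} (hb : rate μ Ψ < b) {η : ℕ → ℝ}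
    (hη : Summable fun m => η m * (Ψ.2 m : Measure V).real Set.univ)
    {G : Set (Setting V kmax)} (hG : G ∈ 𝓝 Ψ) {δ : ℝ} (hδ : 0 < δ) :
    ∀ᶠ lam : ℝ≥0 in atTop, Real.exp (-(lam * b)) ≤
      prior {s : Config (n lam) kmax | empirical lam x s ∈ G ∧
        congestion η x s ≤ lam * (∑' m, η m * (Ψ.2 m : Measure V).real Set.univ + δ)} := by
  classical
  have hlam := tendsto_coe_atTop_real
  obtain ⟨N, c, δ₀, K0, hc, hcl, hδ₀, hGc⟩ := exists_cells_subset_of_mem_nhds (μ : Measure V) Ψ hG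
  obtain ⟨hfin1, hfin2, hlt⟩ := toReal_add_lt_of_rate_lt hΨ hb
  obtain ⟨σ, hσ, hσle⟩ := exists_hasSum_hop_rate hμ hΨ hc hfin2
  have hrle := sum_factorialRate_cellTraj_le hΨ hc hfin1
  have hm : ∀ a, MeasurableSet (c ⁻¹' {a}) := fun a => hc (measurableSet_singleton a)
  set w : ℝ := (μ.mass : ℝ) with hw
  set u : Fin N → ℝ := fun a => (μ : Measure V).real (c ⁻¹' {a}) with hu
  have hT : ∀ a, ∑ y, cellTraj Ψ c y * occ y.2 a = (relayMeasure Ψ).real (c ⁻¹' {a}) := fun a => by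
    rw [sum_cellTraj_mul_occ Ψ hc, ← hΨ.relayMeasure_eq]
  have hηs : ∀ a, Summable fun m => η m * (Ψ.2 m : Measure V).real (c ⁻¹' {a}) := by
    intro a
    refine Summable.of_norm_bounded hη.abs fun m => ?_
    rw [Real.norm_eq_abs, abs_mul, abs_mul, abs_of_nonneg measureReal_nonneg,
      abs_of_nonneg measureReal_nonneg]
    exact mul_le_mul_of_nonneg_left (measureReal_mono (Set.subset_univ _)) (abs_nonneg _)
  set t0 : LabelPath (Fin N) kmax := ⟨⟨0, hk⟩, fun l => l.elim0⟩ with ht0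
  have hb' : ∑ y, factorialRate (cellTraj Ψ c y) + ∑ a, σ a - 2 * ∑ a, factorialRate (u a)
      - ∑ a, factorialRate (∑ y, cellTraj Ψ c y * occ y.2 a)
      + (∑ a, ∑ y, cellTraj Ψ c y * occ y.2 a) * Real.log w + w * Real.log kmax < b := by
    simp only [hT]
    have hw' : ∑ a, u a = w := sum_measureReal_preimage _ hc
    simp only [factorialRate, Finset.sum_sub_distrib, hw'] at hrle ⊢
    rw [← Finset.mul_sum] at hrle
    linarith
  obtain ⟨K, r, p, hK, hr0, hp0, hr, hp, hrp, hrpos, hppos, hrc, hpc, hrate, hηlt⟩ :=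
    exists_approximation (w := w) (u := u) (cellTraj Ψ c)
      (fun a m => (Ψ.2 m : Measure V).real (c ⁻¹' {a})) (fun y => measureReal_nonneg)
      (fun a m => measureReal_nonneg) (fun a => sum_cellTraj_eq hΨ hc a)
      (fun a => hΨ.hasSum_cell (hm a)) (fun a => by rw [hT]; exact hΨ.hasSum_mul_cell (hm a))
      t0 (fun a => by simp [occ, t0]) hσ hb' (fun a => (hηs a).hasSum)
      (δ := min δ δ₀ / 2) (half_pos (lt_min hδ hδ₀)) K0
  have hcell := fun a => tendsto_card_cell (n := n) hL hc hcl a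
  obtain ⟨R, Q, hR, hQ, hRQ⟩ := exists_tendsto_counts hlam
    (N := fun lam a => (Finset.univ.filter fun j : Fin (n lam) => c (x j) = a).card) hcell r p
    hr0 hp0 hr hp hrp t0 (fun a => by simp [occ, t0]) hrpos hppos
  have hprior := eventually_exp_le_prior_typeClass hk hμ (tendsto_card_div hL)
    (fun lam (j : Fin (n lam)) => c (x j)) (u := u) (fun a => by convert hcell a) hR hQ
    (by convert hRQ) hrate
  have ev1 : ∀ᶠ lam : ℝ≥0 in atTop, ∀ y, |(R lam y : ℝ) / lam - r y| < δ₀ / 2 := by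
    rw [eventually_all]
    intro y
    exact (((hR y).sub_const (r y)).abs).eventually_lt_const (by simpa using half_pos hδ₀)
  have ev2 : ∀ᶠ lam : ℝ≥0 in atTop, ∀ a m, |(Q lam (a, m) : ℝ) / lam - p a m| < δ₀ / 2 := by
    simp only [eventually_all]
    intro a m
    exact (((hQ a m).sub_const (p a m)).abs).eventually_lt_const (by simpa using half_pos hδ₀)
  have hτ : ∑ a, ∑' m, η m * (Ψ.2 m : Measure V).real (c ⁻¹' {a}) =
      ∑' m, η m * (Ψ.2 m : Measure V).real Set.univ := by
    rw [← Summable.tsum_finsetSum fun a _ => hηs a]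
    refine tsum_congr fun m => ?_
    rw [← Finset.mul_sum, sum_measureReal_preimage _ hc]
  have ev3 : ∀ᶠ lam : ℝ≥0 in atTop, ∑ a, ∑ m : Fin (K + 2), η m * ((Q lam (a, m) : ℝ) / lam) <
      ∑' m, η m * (Ψ.2 m : Measure V).real Set.univ + δ := by
    refine Tendsto.eventually_lt_const ?_ (tendsto_finsetSum _ fun a _ => tendsto_finsetSum _
      fun m _ => (hQ a m).const_mul (η m))
    rw [hτ] at hηlt
    have := min_le_left δ δ₀
    linarith
  filter_upwards [hprior, ev1, ev2, ev3, hlam.eventually_gt_atTop 0] with lam h1 h2 h3 h4 hl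
  refine h1.trans (prior_mono fun s hs => ?_)
  have hs' := hs
  simp only [Finset.mem_coe, typeClass, Finset.mem_filter, Finset.mem_univ, true_and] at hs'
  obtain ⟨hs1, hs2, hs3⟩ := hs'
  have hmin : min δ δ₀ ≤ δ₀ := min_le_right δ δ₀
  refine ⟨hGc _ (fun k α => ?_) (fun m hm a => ?_), ?_⟩
  · have e : ∀ Φ : Setting V kmax, (Φ.1 k : Measure (Fin (k + 1) → V)).real
        ((fun y => c ∘ y) ⁻¹' {α}) = cellTraj Φ c (α 0, ⟨k, fun l => α l.succ⟩) := by
      intro Φ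
      have : (Fin.cons (α 0) (fun l => α l.succ) : Fin (k + 1) → Fin N) = α := Fin.cons_self_tail α
      simp only [cellTraj, this]
    rw [e, e, cellTraj_empirical lam s hc]
    set y : Fin N × LabelPath (Fin N) kmax := (α 0, ⟨k, fun l => α l.succ⟩)
    have h5 := h2 y
    have h6 := hrc y
    have h7 : (lam : ℝ)⁻¹ * (Finset.univ.filter fun j : Fin (n lam) =>
        (c (x j), relabel (fun i : Fin (n lam) => c (x i)) (s j)) = y).card = (R lam y : ℝ) / lam := by
      rw [← hs1 y, div_eq_inv_mul]
    rw [h7]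
    rw [abs_lt] at h5 h6
    rw [abs_le]
    constructor <;> linarith [h5.1, h5.2, h6.1, h6.2]
  · change |(hopMeasure lam x s m : Measure V).real (c ⁻¹' {a}) - _| ≤ _
    rw [hopMeasure_real_cell lam hx s hc]
    have hmK : m < K + 2 := by omega
    have h5 := h3 a ⟨m, hmK⟩
    have h6 := hpc m hm a
    rw [dif_pos hmK] at h6
    have h7 : (lam : ℝ)⁻¹ * (Finset.univ.filter fun u : Fin (n lam) =>
        c (x u) = a ∧ hits s u = m).card = (Q lam (a, ⟨m, hmK⟩) : ℝ) / lam := by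
      rw [← hs2 (a, ⟨m, hmK⟩), div_eq_inv_mul]
    rw [h7]
    rw [abs_lt] at h5 h6
    rw [abs_le]
    constructor <;> linarith [h5.1, h5.2, h6.1, h6.2]
  · have e1 : congestion η x s = ∑ y, (Q lam y : ℝ) * η y.2 := by
      have h5 := sum_comp_of_card_fiber (fun u : Fin (n lam) =>
        (c (x u), (⟨hits s u, Nat.lt_succ_of_le (hs3 u)⟩ : Fin (K + 2)))) (Q lam) (fun y => by
          rw [← hs2 y]
          congr 1
          ext u
          simp [Prod.ext_iff, Fin.ext_iff]) fun y => η y.2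
      simp only [nsmul_eq_mul] at h5
      rw [← h5, congestion]
      exact Finset.sum_congr rfl fun i _ => by rw [incoming_eq_hits hx]
    have e2 : congestion η x s = lam * ∑ a, ∑ m : Fin (K + 2), η m * ((Q lam (a, m) : ℝ) / lam) := by
      rw [e1, Fintype.sum_prod_type, Finset.mul_sum]
      refine Finset.sum_congr rfl fun a _ => ?_
      rw [Finset.mul_sum]
      refine Finset.sum_congr rfl fun m _ => ?_
      field_simp
    rw [e2]
    exact mul_le_mul_of_nonneg_left h4.le hl.le

end Limit

end

end MultihopGibbs

namespace MultihopGibbs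

noncomputable section

/-! ### From local estimates to the large deviation principle -/

theorem inv_mul_log_le {lam : ℝ≥0} (hl : 0 < (lam : ℝ)) {q : ℝ≥0∞} {a : ℝ}
    (h : q ≤ ENNReal.ofReal (Real.exp (-(lam * a)))) :
    ((1 / (lam : ℝ) : ℝ) : EReal) * ENNReal.log q ≤ ((-a : ℝ) : EReal) := by
  have h1 : ENNReal.log q ≤ ((-(lam * a) : ℝ) : EReal) := by
    refine (ENNReal.log_monotone h).trans_eq ?_
    rw [ENNReal.log_ofReal_of_pos (Real.exp_pos _), Real.log_exp]
  have h2 := mul_le_mul_of_nonneg_left h1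
    (show (0 : EReal) ≤ ((1 / (lam : ℝ) : ℝ) : EReal) from EReal.coe_nonneg.2 (by positivity))
  refine h2.trans_eq ?_
  rw [← EReal.coe_mul]
  congr 1
  field_simp

theorem le_inv_mul_log {lam : ℝ≥0} (hl : 0 < (lam : ℝ)) {q : ℝ≥0∞} {b : ℝ}
    (h : ENNReal.ofReal (Real.exp (-(lam * b))) ≤ q) :
    ((-b : ℝ) : EReal) ≤ ((1 / (lam : ℝ) : ℝ) : EReal) * ENNReal.log q := by
  have h1 : ((-(lam * b) : ℝ) : EReal) ≤ ENNReal.log q := by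
    refine le_of_eq_of_le ?_ (ENNReal.log_monotone h)
    rw [ENNReal.log_ofReal_of_pos (Real.exp_pos _), Real.log_exp]
  have h2 := mul_le_mul_of_nonneg_left h1
    (show (0 : EReal) ≤ ((1 / (lam : ℝ) : ℝ) : EReal) from EReal.coe_nonneg.2 (by positivity))
  refine le_of_eq_of_le ?_ h2
  rw [← EReal.coe_mul]
  congr 1
  field_simp

/-- A finite cover of a closed set, up to a set that the distributions do not charge. -/
theorem exists_finite_cover_le {E : Type*} [TopologicalSpace E] {Q : ℝ≥0 → Set E → ℝ≥0∞}
    (hmono : ∀ lam B B', B ⊆ B' → Q lam B ≤ Q lam B')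
    (hunion : ∀ lam B B', Q lam (B ∪ B') ≤ Q lam B + Q lam B') (hempty : ∀ lam, Q lam ∅ = 0)
    {K : Set E} (hK : IsCompact K) (hQK : ∀ᶠ lam : ℝ≥0 in atTop, Q lam Kᶜ = 0)
    {F : Set E} (hF : IsClosed F) (U : E → Set E) (hU : ∀ Ψ ∈ F, U Ψ ∈ 𝓝 Ψ) :
    ∃ t : Finset E, (∀ Ψ ∈ t, Ψ ∈ F) ∧
      ∀ᶠ lam : ℝ≥0 in atTop, Q lam F ≤ ∑ Ψ ∈ t, Q lam (U Ψ) := by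
  classical
  obtain ⟨t, ht, hcov⟩ := (hK.inter_right hF).elim_nhds_subcover U fun Ψ hΨ => hU Ψ hΨ.2
  refine ⟨t, fun Ψ hΨ => (ht Ψ hΨ).2, ?_⟩
  have hbi : ∀ lam (t : Finset E), Q lam (⋃ Ψ ∈ t, U Ψ) ≤ ∑ Ψ ∈ t, Q lam (U Ψ) := by
    intro lam t
    induction t using Finset.induction_on with
    | empty => simp [hempty]
    | insert Ψ t hΨ ih =>
      rw [Finset.set_biUnion_insert, Finset.sum_insert hΨ]
      exact (hunion _ _ _).trans (add_le_add_right ih _)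
  filter_upwards [hQK] with lam hlam
  have hsub : F ⊆ Kᶜ ∪ ⋃ Ψ ∈ t, U Ψ := by
    intro Ψ hΨ
    by_cases h : Ψ ∈ K
    · exact Or.inr (hcov ⟨h, hΨ⟩)
    · exact Or.inl h
  refine (hmono _ _ _ hsub).trans ((hunion _ _ _).trans ?_)
  rw [hlam, zero_add]
  exact hbi lam t

theorem SatisfiesLDP.of_local {E : Type*} [TopologicalSpace E] {Q : ℝ≥0 → Set E → ℝ≥0∞}
    {J : E → EReal} (hmono : ∀ lam B B', B ⊆ B' → Q lam B ≤ Q lam B')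
    (hunion : ∀ lam B B', Q lam (B ∪ B') ≤ Q lam B + Q lam B') (hempty : ∀ lam, Q lam ∅ = 0)
    (hone : ∀ lam, Q lam Set.univ ≤ 1)
    {K : Set E} (hK : IsCompact K) (hQK : ∀ᶠ lam : ℝ≥0 in atTop, Q lam Kᶜ = 0)
    (hup : ∀ Ψ (a : ℝ), (a : EReal) < J Ψ → ∃ U ∈ 𝓝 Ψ, ∀ᶠ lam : ℝ≥0 in atTop,
      Q lam U ≤ ENNReal.ofReal (Real.exp (-(lam * a))))
    (hlow : ∀ Ψ (b : ℝ), J Ψ < b → ∀ G ∈ 𝓝 Ψ, ∀ᶠ lam : ℝ≥0 in atTop,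
      ENNReal.ofReal (Real.exp (-(lam * b))) ≤ Q lam G) :
    SatisfiesLDP Q J := by
  have hlam := tendsto_coe_atTop_real
  refine ⟨fun Ψ => ?_, fun Ψ y hy => ?_, fun F hF => ?_, fun G hG => ?_⟩
  · by_contra! h
    obtain ⟨b, hb1, hb2⟩ := EReal.lt_iff_exists_real_btwn.1 h
    have hb : b < 0 := by exact_mod_cast hb2
    obtain ⟨lam, h1, h2⟩ := ((hlow Ψ b hb1 Set.univ univ_mem).and
      (hlam.eventually_gt_atTop 0)).exists
    have h3 := h1.trans (hone lam)
    rw [← ENNReal.ofReal_one, ENNReal.ofReal_le_ofReal_iff zero_le_one] at h3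
    have : 0 < -(lam * b) := by nlinarith
    have := Real.one_lt_exp_iff.2 this
    linarith
  · obtain ⟨a2, h1, h2⟩ := EReal.lt_iff_exists_real_btwn.1 hy
    obtain ⟨a1, h3, h4⟩ := EReal.lt_iff_exists_real_btwn.1 h1
    obtain ⟨U, hU, hQU⟩ := hup Ψ a2 h2
    filter_upwards [eventually_mem_nhds_iff.2 hU] with Φ hΦ
    by_contra! hcon
    obtain ⟨lam, h5, h6, h7⟩ := ((hlow Φ a1 (hcon.trans_lt h3) U hΦ).and (hQU.and
      (hlam.eventually_gt_atTop 0))).exists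
    have h8 := h5.trans h6
    rw [ENNReal.ofReal_le_ofReal_iff (Real.exp_pos _).le, Real.exp_le_exp] at h8
    have h9 : a1 < a2 := by exact_mod_cast h4
    nlinarith
  · refine le_of_forall_gt_imp_ge_of_dense fun y hy => ?_
    obtain ⟨a, h1, h2⟩ := EReal.lt_iff_exists_real_btwn.1 (EReal.neg_lt_comm.1 hy)
    obtain ⟨a', h3, h4⟩ := EReal.lt_iff_exists_real_btwn.1 h2
    have haa : a < a' := by exact_mod_cast h3
    have hU : ∀ Ψ, ∃ U, Ψ ∈ F → U ∈ 𝓝 Ψ ∧ ∀ᶠ lam : ℝ≥0 in atTop,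
        Q lam U ≤ ENNReal.ofReal (Real.exp (-(lam * a'))) := by
      intro Ψ
      by_cases hΨ : Ψ ∈ F
      · obtain ⟨U, h5, h6⟩ := hup Ψ a' (h4.trans_le (iInf₂_le Ψ hΨ))
        exact ⟨U, fun _ => ⟨h5, h6⟩⟩
      · exact ⟨∅, fun h => absurd h hΨ⟩
    choose U hU using hU
    obtain ⟨t, ht, hcov⟩ := exists_finite_cover_le hmono hunion hempty hK hQK hF U
      fun Ψ hΨ => (hU Ψ hΨ).1
    have hall := (Finset.eventually_all t).2 fun Ψ hΨ => (hU Ψ (ht Ψ hΨ)).2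
    have hbig : ∀ᶠ lam : ℝ≥0 in atTop, (t.card : ℝ) ≤ Real.exp (lam * (a' - a)) :=
      (Real.tendsto_exp_atTop.comp (hlam.atTop_mul_const (sub_pos.2 haa))).eventually_ge_atTop _
    have hle : limsup (fun lam : ℝ≥0 => ((1 / (lam : ℝ) : ℝ) : EReal) * ENNReal.log (Q lam F)) atTop
        ≤ ((-a : ℝ) : EReal) := by
      refine limsup_le_of_le (by isBoundedDefault) ?_
      filter_upwards [hcov, hall, hbig, hlam.eventually_gt_atTop 0] with lam h5 h6 h7 hl
      refine inv_mul_log_le hl (h5.trans ((Finset.sum_le_sum h6).trans ?_))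
      rw [Finset.sum_const, nsmul_eq_mul, ← ENNReal.ofReal_natCast, ← ENNReal.ofReal_mul
        (Nat.cast_nonneg _)]
      refine ENNReal.ofReal_le_ofReal ?_
      refine (mul_le_mul_of_nonneg_right h7 (Real.exp_pos _).le).trans_eq ?_
      rw [← Real.exp_add]
      congr 1; ring
    refine hle.trans ?_
    rw [EReal.coe_neg]
    exact (EReal.neg_lt_comm.1 h1).le
  · refine le_of_forall_lt_imp_le_of_dense fun y hy => ?_
    obtain ⟨Ψ, h0⟩ := iInf_lt_iff.1 (EReal.lt_neg_comm.1 hy)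
    obtain ⟨hΨ, h1⟩ := iInf_lt_iff.1 h0
    obtain ⟨b, h2, h3⟩ := EReal.lt_iff_exists_real_btwn.1 h1
    refine le_liminf_of_le (by isBoundedDefault) ?_
    filter_upwards [hlow Ψ b h2 G (hG.mem_nhds hΨ), hlam.eventually_gt_atTop 0] with lam h4 hl
    refine le_trans ?_ (le_inv_mul_log hl h4)
    rw [EReal.coe_neg]
    exact (EReal.lt_neg_comm.1 h3).le

theorem ConvergesToSet.of_local {E : Type*} [TopologicalSpace E] {Q : ℝ≥0 → Set E → ℝ≥0∞}
    {A : Set E} (hmono : ∀ lam B B', B ⊆ B' → Q lam B ≤ Q lam B')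
    (hunion : ∀ lam B B', Q lam (B ∪ B') ≤ Q lam B + Q lam B') (hempty : ∀ lam, Q lam ∅ = 0)
    {K : Set E} (hK : IsCompact K) (hQK : ∀ᶠ lam : ℝ≥0 in atTop, Q lam Kᶜ = 0)
    (hloc : ∀ Ψ ∉ A, ∃ U ∈ 𝓝 Ψ, Tendsto (fun lam => Q lam U) atTop (𝓝 0)) :
    ConvergesToSet Q A := by
  intro O hO hAO
  have hU : ∀ Ψ, ∃ U, Ψ ∈ Oᶜ → U ∈ 𝓝 Ψ ∧ Tendsto (fun lam => Q lam U) atTop (𝓝 0) := by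
    intro Ψ
    by_cases hΨ : Ψ ∈ Oᶜ
    · obtain ⟨U, h5, h6⟩ := hloc Ψ fun h => hΨ (hAO h)
      exact ⟨U, fun _ => ⟨h5, h6⟩⟩
    · exact ⟨∅, fun h => absurd h hΨ⟩
  choose U hU using hU
  obtain ⟨t, ht, hcov⟩ := exists_finite_cover_le hmono hunion hempty hK hQK hO.isClosed_compl U
    fun Ψ hΨ => (hU Ψ hΨ).1
  have h := tendsto_finsetSum t fun Ψ hΨ => (hU Ψ (ht Ψ hΨ)).2
  rw [Finset.sum_const_zero] at h
  exact tendsto_of_tendsto_of_tendsto_of_le_of_le' tendsto_const_nhds h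
    (Eventually.of_forall fun _ => zero_le) hcov

/-! ### Compactness -/

section Compact

variable {V : Type*} [MetricSpace V] [CompactSpace V] [MeasurableSpace V] [BorelSpace V]

theorem isCompact_setting_mass_le (kmax : ℕ) (C : ℝ≥0) :
    IsCompact {Ψ : Setting V kmax | (∀ k, (Ψ.1 k).mass ≤ C) ∧ ∀ m, (Ψ.2 m).mass ≤ C} := by
  have h1 := isCompact_univ_pi fun k : Fin kmax =>
    isCompact_setOfPred_finiteMeasure_le_of_compactSpace (Fin (k + 1) → V) C
  have h2 := isCompact_univ_pi fun _ : ℕ =>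
    isCompact_setOfPred_finiteMeasure_le_of_compactSpace V C
  convert h1.prod h2 using 1
  ext Ψ
  simp [Set.mem_pi]

theorem mass_eq_integral {E : Type*} [MeasurableSpace E] (ν : FiniteMeasure E) :
    (ν.mass : ℝ) = ∫ _, (1 : ℝ) ∂(ν : Measure E) := by
  rw [integral_const, smul_eq_mul, mul_one]
  rfl

theorem mass_trajMeasure_le (lam : ℝ≥0) (x : ℕ → V) {n kmax : ℕ} (s : Config n kmax)
    (k : Fin kmax) : ((trajMeasure lam x s k).mass : ℝ) ≤ n / lam := by
  have h := sum_integral_trajMeasure lam x s fun _ _ => (1 : ℝ)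
  simp only [← mass_eq_integral, Finset.sum_const, Finset.card_univ, Fintype.card_fin,
    nsmul_eq_mul, mul_one] at h
  rw [div_eq_inv_mul, ← h]
  exact Finset.single_le_sum (f := fun k => ((trajMeasure lam x s k).mass : ℝ))
    (fun _ _ => NNReal.coe_nonneg _) (Finset.mem_univ k)

theorem mass_hopMeasure_le (lam : ℝ≥0) {x : ℕ → V} (hx : Function.Injective x) {n kmax : ℕ}
    (s : Config n kmax) (m : ℕ) : ((hopMeasure lam x s m).mass : ℝ) ≤ n / lam := by
  rw [mass_eq_integral, integral_hopMeasure lam hx, div_eq_inv_mul]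
  refine mul_le_mul_of_nonneg_left ?_ (by positivity)
  refine (Finset.sum_le_sum (g := fun _ => (1 : ℝ)) fun i _ => ?_).trans_eq (by simp)
  split_ifs <;> norm_num

/-- The empirical measures stay in a compact set. -/
theorem exists_isCompact_empirical_mem {μ : FiniteMeasure V} {x : ℕ → V} {n : ℝ≥0 → ℕ}
    (hx : Function.Injective x)
    (hL : Tendsto (fun lam => userMeasure lam x (n lam)) atTop (𝓝 μ)) (kmax : ℕ) :
    ∃ K : Set (Setting V kmax), IsCompact K ∧
      ∀ᶠ lam : ℝ≥0 in atTop, ∀ s : Config (n lam) kmax, empirical lam x s ∈ K := by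
  refine ⟨_, isCompact_setting_mass_le kmax (μ.mass + 1), ?_⟩
  filter_upwards [(tendsto_card_div hL).eventually_lt_const
    (show (μ.mass : ℝ) < μ.mass + 1 by linarith)] with lam hlam s
  refine ⟨fun k => ?_, fun m => ?_⟩
  · have := (mass_trajMeasure_le lam x s k).trans hlam.le
    exact_mod_cast this
  · have := (mass_hopMeasure_le lam hx s m).trans hlam.le
    exact_mod_cast this

end Compact

end

end MultihopGibbs

namespace MultihopGibbs

noncomputable section

open InformationTheory

/-! ### The Gibbs measure as a tilting of the a priori measure -/

open Classical in
/-- The a priori measure with density `exp (-E)`. -/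
def tilted {n kmax : ℕ} (E : Config n kmax → ℝ) (B : Set (Config n kmax)) : ℝ :=
  ∑ s : Config n kmax with s ∈ B, (∏ i, 1 / ((kmax : ℝ) * (n : ℝ) ^ ((s i).1 : ℕ))) * Real.exp (-E s)

theorem prior_weight_nonneg {n kmax : ℕ} (s : Config n kmax) :
    0 ≤ ∏ i, 1 / ((kmax : ℝ) * (n : ℝ) ^ ((s i).1 : ℕ)) :=
  Finset.prod_nonneg fun i _ => by positivity

theorem prior_weight_pos {n kmax : ℕ} (hk : 1 ≤ kmax) (s : Config n kmax) :
    0 < ∏ i, 1 / ((kmax : ℝ) * (n : ℝ) ^ ((s i).1 : ℕ)) := by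
  refine Finset.prod_pos fun i _ => ?_
  have h1 : (0 : ℝ) < kmax := by exact_mod_cast hk
  have h2 : (0 : ℝ) < n := by exact_mod_cast i.pos
  positivity

theorem tilted_zero {n kmax : ℕ} (B : Set (Config n kmax)) : tilted (fun _ => 0) B = prior B := by
  simp only [tilted, prior, neg_zero, Real.exp_zero, mul_one]

theorem tilted_nonneg {n kmax : ℕ} (E : Config n kmax → ℝ) (B : Set (Config n kmax)) :
    0 ≤ tilted E B :=
  Finset.sum_nonneg fun s _ => mul_nonneg (prior_weight_nonneg s) (Real.exp_pos _).le

theorem tilted_mono {n kmax : ℕ} (E : Config n kmax → ℝ) {B B' : Set (Config n kmax)}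
    (h : B ⊆ B') : tilted E B ≤ tilted E B' := by
  refine Finset.sum_le_sum_of_subset_of_nonneg ?_ fun s _ _ =>
    mul_nonneg (prior_weight_nonneg s) (Real.exp_pos _).le
  intro s hs
  simp only [Finset.mem_filter, Finset.mem_univ, true_and] at hs ⊢
  exact h hs

theorem tilted_union_le {n kmax : ℕ} (E : Config n kmax → ℝ) (B B' : Set (Config n kmax)) :
    tilted E (B ∪ B') ≤ tilted E B + tilted E B' := by
  classical
  unfold tilted
  rw [← Finset.sum_union_inter]
  refine le_add_of_le_of_nonneg (le_of_eq (Finset.sum_congr ?_ fun _ _ => rfl)) ?_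
  · ext s; simp
  · exact Finset.sum_nonneg fun s _ => mul_nonneg (prior_weight_nonneg s) (Real.exp_pos _).le

theorem tilted_le {n kmax : ℕ} {E : Config n kmax → ℝ} {B : Set (Config n kmax)} {e : ℝ}
    (h : ∀ s ∈ B, e ≤ E s) : tilted E B ≤ prior B * Real.exp (-e) := by
  classical
  unfold tilted prior
  rw [Finset.sum_mul]
  refine Finset.sum_le_sum fun s hs => ?_
  exact mul_le_mul_of_nonneg_left (Real.exp_le_exp.2 (neg_le_neg (h s (Finset.mem_filter.1 hs).2)))
    (prior_weight_nonneg s)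

theorem le_tilted {n kmax : ℕ} {E : Config n kmax → ℝ} {B : Set (Config n kmax)} {e : ℝ}
    (h : ∀ s ∈ B, E s ≤ e) : prior B * Real.exp (-e) ≤ tilted E B := by
  classical
  unfold tilted prior
  rw [Finset.sum_mul]
  refine Finset.sum_le_sum fun s hs => ?_
  exact mul_le_mul_of_nonneg_left (Real.exp_le_exp.2 (neg_le_neg (h s (Finset.mem_filter.1 hs).2)))
    (prior_weight_nonneg s)

theorem prior_univ {n kmax : ℕ} (hk : 1 ≤ kmax) : prior (Set.univ : Set (Config n kmax)) = 1 := by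
  classical
  have h1 : prior (Set.univ : Set (Config n kmax)) =
      ∑ s : Config n kmax, ∏ i, 1 / ((kmax : ℝ) * (n : ℝ) ^ ((s i).1 : ℕ)) := by
    simp [prior]
  rw [h1, ← Fintype.prod_sum fun (_ : Fin n) (t : Trajectory n kmax) =>
    1 / ((kmax : ℝ) * (n : ℝ) ^ (t.1 : ℕ))]
  refine Finset.prod_eq_one fun i _ => ?_
  have hk' : (0 : ℝ) < kmax := by exact_mod_cast hk
  have hn' : (0 : ℝ) < n := by exact_mod_cast i.pos
  rw [Fintype.sum_sigma]
  have h2 : ∀ k : Fin kmax, ∑ _α : Fin k → Fin n, 1 / ((kmax : ℝ) * (n : ℝ) ^ (k : ℕ)) =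
      1 / kmax := by
    intro k
    rw [Finset.sum_const, Finset.card_univ, Fintype.card_fun, Fintype.card_fin, Fintype.card_fin,
      nsmul_eq_mul, Nat.cast_pow]
    field_simp
  rw [Finset.sum_congr rfl fun k _ => h2 k]
  simp [hk'.ne']

section Law

variable {V : Type*} [TopologicalSpace V] [SecondCountableTopology V] [MeasurableSpace V]
  [BorelSpace V] {kmax : ℕ} {f : ∀ k : Fin kmax, FiniteMeasure V × (Fin (k + 1) → V) → ℝ}
  {η : ℕ → ℝ} {γ β : ℝ} {x : ℕ → V}

/-- The exponent of the Gibbs measure. -/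
def energy (f : ∀ k : Fin kmax, FiniteMeasure V × (Fin (k + 1) → V) → ℝ) (η : ℕ → ℝ) (γ β : ℝ)
    (lam : ℝ≥0) (x : ℕ → V) {n : ℕ} (s : Config n kmax) : ℝ :=
  γ * interference f lam x s + β * congestion η x s

theorem tilted_univ_pos (hk : 1 ≤ kmax) {n : ℕ} (E : Config n kmax → ℝ) :
    0 < tilted E Set.univ := by
  refine Finset.sum_pos (fun s _ => mul_pos (prior_weight_pos hk s) (Real.exp_pos _)) ?_
  exact ⟨fun _ => ⟨⟨0, hk⟩, fun l => l.elim0⟩, by simp⟩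

theorem empiricalLaw_eq (hk : 1 ≤ kmax) (lam : ℝ≥0) (n : ℕ) (B : Set (Setting V kmax)) :
    empiricalLaw f η γ β lam x n B = ENNReal.ofReal
      (tilted (energy f η γ β lam x) {s : Config n kmax | empirical lam x s ∈ B} /
        tilted (energy f η γ β lam x) (Set.univ : Set (Config n kmax))) := by
  classical
  have hk' : (kmax : ℝ) ≠ 0 := by exact_mod_cast (by omega : kmax ≠ 0)
  have h1 : ∀ s : Config n kmax, gibbsWeight f η γ β lam x s = (kmax : ℝ) ^ n *
      ((∏ i, 1 / ((kmax : ℝ) * (n : ℝ) ^ ((s i).1 : ℕ))) *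
        Real.exp (-energy f η γ β lam x s)) := by
    intro s
    rw [gibbsWeight, energy, ← mul_assoc]
    congr 1
    · have : ∀ i : Fin n, 1 / (n : ℝ) ^ ((s i).1 : ℕ) =
          kmax * (1 / ((kmax : ℝ) * (n : ℝ) ^ ((s i).1 : ℕ))) := by
        intro i
        have : (n : ℝ) ≠ 0 := by exact_mod_cast i.pos.ne'
        field_simp
      rw [Finset.prod_congr rfl fun i _ => this i, Finset.prod_mul_distrib]
      simp
    · congr 1; ring
  have h2 : ∀ B' : Set (Config n kmax), ∑ s : Config n kmax with s ∈ B',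
      gibbsWeight f η γ β lam x s = (kmax : ℝ) ^ n * tilted (energy f η γ β lam x) B' := by
    intro B'
    rw [tilted, Finset.mul_sum]
    refine Finset.sum_congr ?_ fun s _ => h1 s
    ext s; simp
  have h3 : partitionFunction f η γ β lam x n =
      (kmax : ℝ) ^ n * tilted (energy f η γ β lam x) (Set.univ : Set (Config n kmax)) := by
    rw [← h2, partitionFunction]
    simp
  rw [empiricalLaw, h3]
  congr 1
  have h4 := h2 {s : Config n kmax | empirical lam x s ∈ B}
  rw [Finset.sum_filter] at h4
  have h5 : (kmax : ℝ) ^ n ≠ 0 := pow_ne_zero _ hk'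
  rw [← mul_div_mul_left _ _ h5, ← h4, Finset.sum_div]
  refine Finset.sum_congr rfl fun s _ => ?_
  by_cases hs : empirical lam x s ∈ B
  · simp [hs]
  · simp [hs]

theorem empiricalLaw_zero (hk : 1 ≤ kmax) (lam : ℝ≥0) (n : ℕ) (B : Set (Setting V kmax)) :
    empiricalLaw f η 0 0 lam x n B =
      ENNReal.ofReal (prior {s : Config n kmax | empirical lam x s ∈ B}) := by
  have : energy f η 0 0 lam x = fun _ : Config n kmax => 0 := by
    ext s; simp [energy]
  rw [empiricalLaw_eq hk, this, tilted_zero, tilted_zero, prior_univ hk, div_one]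

theorem empiricalLaw_mono (hk : 1 ≤ kmax) (lam : ℝ≥0) (n : ℕ) {B B' : Set (Setting V kmax)}
    (h : B ⊆ B') : empiricalLaw f η γ β lam x n B ≤ empiricalLaw f η γ β lam x n B' := by
  rw [empiricalLaw_eq hk, empiricalLaw_eq hk]
  refine ENNReal.ofReal_le_ofReal (div_le_div_of_nonneg_right ?_ (tilted_nonneg _ _))
  exact tilted_mono _ fun s hs => h hs

theorem empiricalLaw_union_le (hk : 1 ≤ kmax) (lam : ℝ≥0) (n : ℕ) (B B' : Set (Setting V kmax)) :
    empiricalLaw f η γ β lam x n (B ∪ B') ≤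
      empiricalLaw f η γ β lam x n B + empiricalLaw f η γ β lam x n B' := by
  rw [empiricalLaw_eq hk, empiricalLaw_eq hk, empiricalLaw_eq hk, ← ENNReal.ofReal_add
    (div_nonneg (tilted_nonneg _ _) (tilted_nonneg _ _))
    (div_nonneg (tilted_nonneg _ _) (tilted_nonneg _ _)), ← add_div]
  refine ENNReal.ofReal_le_ofReal (div_le_div_of_nonneg_right ?_ (tilted_nonneg _ _))
  exact tilted_union_le _ _ _

theorem empiricalLaw_eq_zero (lam : ℝ≥0) (n : ℕ) {B : Set (Setting V kmax)}
    (h : ∀ s : Config n kmax, empirical lam x s ∉ B) : empiricalLaw f η γ β lam x n B = 0 := by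
  rw [empiricalLaw]
  simp [h]

end Law

section Limit

variable {V : Type*} [MetricSpace V] [CompactSpace V] [MeasurableSpace V] [BorelSpace V]
variable {μ : FiniteMeasure V} {x : ℕ → V} {n : ℝ≥0 → ℕ} {kmax : ℕ} {Ψ : Setting V kmax}
variable {f : ∀ k : Fin kmax, FiniteMeasure V × (Fin (k + 1) → V) → ℝ} {η : ℕ → ℝ} {γ β : ℝ}

theorem satisfiesLDP_empiricalLaw (hk : 1 ≤ kmax) (hμ : 0 < (μ.mass : ℝ))
    (hx : Function.Injective x)
    (hL : Tendsto (fun lam => userMeasure lam x (n lam)) atTop (𝓝 μ)) :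
    SatisfiesLDP (fun lam => empiricalLaw f η 0 0 lam x (n lam)) (rate μ : Setting V kmax → EReal) := by
  obtain ⟨K, hK, hQK⟩ := exists_isCompact_empirical_mem hx hL kmax
  refine SatisfiesLDP.of_local (fun lam B B' => empiricalLaw_mono hk lam _)
    (fun lam B B' => empiricalLaw_union_le hk lam _ B B')
    (fun lam => empiricalLaw_eq_zero lam _ fun s => by simp) (fun lam => ?_) hK ?_
    (fun Ψ a ha => ?_) (fun Ψ b hb G hG => ?_)
  · rw [empiricalLaw_zero hk]
    simp [prior_univ hk]
  · filter_upwards [hQK] with lam hlam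
    exact empiricalLaw_eq_zero lam _ fun s hs => hs (hlam s)
  · have : ∃ U ∈ 𝓝 Ψ, ∀ᶠ lam : ℝ≥0 in atTop,
        prior {s : Config (n lam) kmax | empirical lam x s ∈ U} ≤ Real.exp (-(lam * a)) := by
      by_cases hΨ : IsAdmissible μ Ψ
      · exact exists_prior_le_of_isAdmissible hk hμ hx hL hΨ ha
      · exact exists_prior_le_of_not_isAdmissible hk hμ hx hL hΨ a
    obtain ⟨U, hU, h⟩ := this
    refine ⟨U, hU, ?_⟩
    filter_upwards [h] with lam hlam
    rw [empiricalLaw_zero hk]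
    exact ENNReal.ofReal_le_ofReal hlam
  · have hΨ : IsAdmissible μ Ψ := by
      by_contra h
      rw [rate, if_neg h] at hb
      exact not_top_lt hb
    filter_upwards [eventually_exp_le_prior hk hμ hx hL hΨ hb (η := fun _ => 0)
      (by simp [summable_zero]) hG one_pos] with lam hlam
    rw [empiricalLaw_zero hk]
    refine ENNReal.ofReal_le_ofReal (hlam.trans (prior_mono fun s hs => hs.1))

end Limit

end

end MultihopGibbs

namespace MultihopGibbs

noncomputable section

open InformationTheory BoundedContinuousFunction

section Limit

variable {V : Type*} [MetricSpace V] [CompactSpace V] [MeasurableSpace V] [BorelSpace V]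
variable {μ : FiniteMeasure V} {x : ℕ → V} {n : ℝ≥0 → ℕ} {kmax : ℕ} {Ψ : Setting V kmax}
variable {f : ∀ k : Fin kmax, FiniteMeasure V × (Fin (k + 1) → V) → ℝ} {η : ℕ → ℝ} {γ β : ℝ}

/-! ### The interference -/

/-- Convergence of the test function `f_k(L_λ, ·)`, uniformly in the trajectory. -/
theorem eventually_abs_sub_lt {Y : Type*} [TopologicalSpace Y] [CompactSpace Y]
    {g : FiniteMeasure V × Y → ℝ} (hg : Continuous g)
    (hL : Tendsto (fun lam => userMeasure lam x (n lam)) atTop (𝓝 μ)) {ε : ℝ} (hε : 0 < ε) :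
    ∀ᶠ lam : ℝ≥0 in atTop, ∀ y, |g (userMeasure lam x (n lam), y) - g (μ, y)| < ε := by
  let F : C(FiniteMeasure V, C(Y, ℝ)) := ContinuousMap.curry ⟨g, hg⟩
  have h := (F.continuous.tendsto μ).comp hL
  rw [Metric.tendsto_nhds] at h
  filter_upwards [h ε hε] with lam hlam y
  have := (ContinuousMap.dist_lt_iff hε).1 hlam y
  rwa [Real.dist_eq] at this

/-- Near `Ψ`, the exponent `𝔖` is close to its limit. -/
theorem exists_nhds_interference (hf : ∀ k, Continuous (f k))
    (hL : Tendsto (fun lam => userMeasure lam x (n lam)) atTop (𝓝 μ)) (Ψ : Setting V kmax)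
    {δ : ℝ} (hδ : 0 < δ) :
    ∃ U ∈ 𝓝 Ψ, ∀ᶠ lam : ℝ≥0 in atTop, ∀ s : Config (n lam) kmax, empirical lam x s ∈ U →
      |interference f lam x s - lam * limitInterference f μ Ψ| ≤ lam * δ := by
  let g : ∀ k : Fin kmax, (Fin (k + 1) → V) →ᵇ ℝ := fun k =>
    BoundedContinuousFunction.mkOfCompact ⟨fun y => f k (μ, y), by
      have := hf k
      fun_prop⟩
  have hg : ∀ k y, g k y = f k (μ, y) := fun k y => rfl
  have hc : Continuous fun Φ : Setting V kmax =>
      ∑ k : Fin kmax, ∫ y, g k y ∂(Φ.1 k : Measure (Fin (k + 1) → V)) :=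
    continuous_finsetSum _ fun k _ => continuous_integral_traj k (g k)
  have hev : ∀ᶠ Φ : Setting V kmax in 𝓝 Ψ,
      |∑ k : Fin kmax, ∫ y, g k y ∂(Φ.1 k : Measure (Fin (k + 1) → V)) -
        limitInterference f μ Ψ| < δ / 2 := by
    have := ((hc.tendsto Ψ).sub_const (limitInterference f μ Ψ)).abs
    refine this.eventually_lt_const ?_
    simp only [limitInterference, hg, sub_self, abs_zero]
    exact half_pos hδ
  refine ⟨_, hev, ?_⟩
  set w : ℝ := (μ.mass : ℝ) with hw
  have hw0 : 0 ≤ w := NNReal.coe_nonneg _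
  filter_upwards [eventually_all.2 fun k => eventually_abs_sub_lt (hf k) hL
      (show 0 < δ / (2 * (w + 1)) by positivity),
    (tendsto_card_div hL).eventually_lt_const (show w < w + 1 by linarith),
    tendsto_coe_atTop_real.eventually_gt_atTop 0] with lam h1 h2 hl s hs
  have hs' : |∑ k : Fin kmax, ∫ y, g k y ∂(trajMeasure lam x s k : Measure (Fin (k + 1) → V)) -
        limitInterference f μ Ψ| < δ / 2 := hs
  rw [sum_integral_trajMeasure lam x s fun k y => g k y] at hs'
  have h3 : |interference f lam x s - ∑ i : Fin (n lam), g (s i).1 (path x i (s i))| ≤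
      n lam * (δ / (2 * (w + 1))) := by
    rw [interference, ← Finset.sum_sub_distrib]
    refine (Finset.abs_sum_le_sum_abs _ _).trans ((Finset.sum_le_sum fun i _ =>
      (h1 (s i).1 (path x i (s i))).le).trans_eq ?_)
    simp
  have h4 : n lam * (δ / (2 * (w + 1))) ≤ lam * (δ / 2) := by
    rw [div_lt_iff₀ hl] at h2
    have : lam * (δ / 2) = ((w + 1) * lam) * (δ / (2 * (w + 1))) := by field_simp
    rw [this]
    exact mul_le_mul_of_nonneg_right h2.le (by positivity)
  have h5 : |∑ i : Fin (n lam), g (s i).1 (path x i (s i)) - lam * limitInterference f μ Ψ| ≤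
      lam * (δ / 2) := by
    have : ∑ i : Fin (n lam), g (s i).1 (path x i (s i)) - lam * limitInterference f μ Ψ =
        lam * ((lam : ℝ)⁻¹ * ∑ i : Fin (n lam), g (s i).1 (path x i (s i)) -
          limitInterference f μ Ψ) := by
      field_simp
    rw [this, abs_mul, abs_of_pos hl]
    exact mul_le_mul_of_nonneg_left hs'.le hl.le
  rw [abs_le] at *
  constructor <;> linarith [h3.1, h3.2, h5.1, h5.2]

theorem exists_interference_bounds (hf : ∀ k, Continuous (f k))
    (hL : Tendsto (fun lam => userMeasure lam x (n lam)) atTop (𝓝 μ)) :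
    ∃ C : ℝ, ∀ᶠ lam : ℝ≥0 in atTop, ∀ s : Config (n lam) kmax,
      |interference f lam x s| ≤ lam * C := by
  have hb : ∀ k : Fin kmax, ∃ C, ∀ y, |f k (μ, y)| ≤ C := by
    intro k
    have hc : Continuous fun y => |f k (μ, y)| := by
      have := hf k
      fun_prop
    obtain ⟨C, hC⟩ := (isCompact_range hc).bddAbove
    exact ⟨C, fun y => hC ⟨y, rfl⟩⟩
  choose C hC using hb
  have hCs : ∀ k y, |f k (μ, y)| ≤ ∑ k, |C k| := fun k y =>
    ((hC k y).trans (le_abs_self _)).trans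
      (Finset.single_le_sum (f := fun k => |C k|) (fun _ _ => abs_nonneg _) (Finset.mem_univ k))
  set D := ∑ k, |C k|
  have hD : 0 ≤ D := Finset.sum_nonneg fun _ _ => abs_nonneg _
  refine ⟨(μ.mass + 1) * (D + 1), ?_⟩
  filter_upwards [eventually_all.2 fun k => eventually_abs_sub_lt (hf k) hL one_pos,
    (tendsto_card_div hL).eventually_lt_const (show (μ.mass : ℝ) < μ.mass + 1 by linarith),
    tendsto_coe_atTop_real.eventually_gt_atTop 0] with lam h1 h2 hl s
  rw [div_lt_iff₀ hl] at h2
  have h3 : |interference f lam x s| ≤ n lam * (D + 1) := by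
    refine (Finset.abs_sum_le_sum_abs _ _).trans ((Finset.sum_le_sum (g := fun _ => D + 1)
      fun i _ => ?_).trans_eq (by simp; ring))
    have h4 := abs_lt.1 (h1 (s i).1 (path x i (s i)))
    have h5 := abs_le.1 (hCs (s i).1 (path x i (s i)))
    rw [abs_le]
    constructor <;> linarith [h4.1, h4.2, h5.1, h5.2]
  nlinarith

/-! ### The congestion -/

/-- `∑ₘ (η(m) + C) μₘ(V)`, where `-C` is a lower bound of `η`. -/
def shiftedCongestion (η : ℕ → ℝ) (C : ℝ) (Ψ : Setting V kmax) : ℝ≥0∞ :=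
  ∑' m : ℕ, ENNReal.ofReal (η m + C) * (Ψ.2 m : Measure V) Set.univ

theorem limitCongestion_eq (hΨ : IsAdmissible μ Ψ) {C : ℝ} (hC : 0 ≤ C) (hη : ∀ m, -C ≤ η m) :
    limitCongestion η Ψ = (shiftedCongestion η C Ψ : EReal) - ((C * μ.mass : ℝ) : EReal) := by
  set A := shiftedCongestion η C Ψ with hA
  set P := ∑' m : ℕ, ENNReal.ofReal (η m) * (Ψ.2 m : Measure V) Set.univ with hP
  set M := ∑' m : ℕ, ENNReal.ofReal (-η m) * (Ψ.2 m : Measure V) Set.univ with hM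
  have hsum : ∑' m : ℕ, (Ψ.2 m : Measure V) Set.univ = (μ : Measure V) Set.univ := by
    rw [← hΨ.users, Measure.sum_apply _ MeasurableSet.univ]
  have h1 : A + M = P + ENNReal.ofReal (C * μ.mass) := by
    rw [ENNReal.ofReal_mul hC, ENNReal.ofReal_coe_nnreal, FiniteMeasure.ennreal_mass, ← hsum,
      ← ENNReal.tsum_mul_left, hA, hP, hM, shiftedCongestion, ← ENNReal.tsum_add,
      ← ENNReal.tsum_add]
    refine tsum_congr fun m => ?_
    rw [← add_mul, ← add_mul]
    congr 1
    have := hη m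
    rcases le_total 0 (η m) with h | h
    · rw [ENNReal.ofReal_of_nonpos (neg_nonpos.2 h), add_zero, ENNReal.ofReal_add h hC]
    · rw [ENNReal.ofReal_of_nonpos h, zero_add, ← ENNReal.ofReal_add (by linarith) (by linarith)]
      congr 1; ring
  have hMfin : M ≠ ⊤ := by
    refine ne_top_of_le_ne_top (ENNReal.ofReal_ne_top (r := C * μ.mass)) ?_
    rw [ENNReal.ofReal_mul hC, ENNReal.ofReal_coe_nnreal, FiniteMeasure.ennreal_mass, ← hsum,
      ← ENNReal.tsum_mul_left]
    refine ENNReal.tsum_le_tsum fun m => ?_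
    gcongr
    have := hη m
    linarith
  have hCw : 0 ≤ C * (μ.mass : ℝ) := mul_nonneg hC (NNReal.coe_nonneg _)
  have h2 : (A : EReal) + (M.toReal : EReal) = (P : EReal) + ((C * μ.mass : ℝ) : EReal) := by
    have := congrArg (fun z : ℝ≥0∞ => (z : EReal)) h1
    simp only [EReal.coe_ennreal_add, EReal.coe_ennreal_ofReal, max_eq_left hCw] at this
    rwa [← EReal.coe_ennreal_toReal hMfin] at this
  rw [limitCongestion, ← hP, ← hM, ← EReal.coe_ennreal_toReal hMfin]
  have h3 : (P : EReal) = (A : EReal) + (M.toReal : EReal) - ((C * μ.mass : ℝ) : EReal) := by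
    rw [h2, EReal.add_sub_cancel_right]
  rw [h3, sub_eq_add_neg, sub_eq_add_neg, sub_eq_add_neg, add_assoc, add_assoc]
  congr 1
  rw [← EReal.coe_neg, ← EReal.coe_neg, ← EReal.coe_add, ← EReal.coe_add]
  congr 1; ring

theorem exists_nhds_le_congestion (hβ : 0 ≤ β) {C : ℝ}
    (hη : ∀ m, -C ≤ η m) (hx : Function.Injective x)
    (hL : Tendsto (fun lam => userMeasure lam x (n lam)) atTop (𝓝 μ))
    {z : ℝ} (hz : (z : EReal) < ((ENNReal.ofReal β * shiftedCongestion η C Ψ : ℝ≥0∞) : EReal))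
    {δ : ℝ} (hδ : 0 < δ) :
    ∃ U ∈ 𝓝 Ψ, ∀ᶠ lam : ℝ≥0 in atTop, ∀ s : Config (n lam) kmax, empirical lam x s ∈ U →
      lam * (z - β * C * μ.mass - δ) ≤ β * congestion η x s := by
  have h1 : ∃ K, (z : EReal) < ((ENNReal.ofReal β * ∑ m ∈ Finset.range K,
      ENNReal.ofReal (η m + C) * (Ψ.2 m : Measure V) Set.univ : ℝ≥0∞) : EReal) := by
    have h2 := ENNReal.Tendsto.const_mul (ENNReal.tendsto_nat_tsum fun m : ℕ =>
      ENNReal.ofReal (η m + C) * (Ψ.2 m : Measure V) Set.univ) (Or.inr (ENNReal.ofReal_ne_top (r := β)))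
    exact (((continuous_coe_ennreal_ereal.tendsto _).comp h2).eventually_const_lt hz).exists
  obtain ⟨K, hK⟩ := h1
  have e1 : ENNReal.ofReal β * ∑ m ∈ Finset.range K,
      ENNReal.ofReal (η m + C) * (Ψ.2 m : Measure V) Set.univ =
      ENNReal.ofReal (β * ∑ m ∈ Finset.range K, (η m + C) * (Ψ.2 m : Measure V).real Set.univ) := by
    have hnn : ∀ m, 0 ≤ η m + C := fun m => by linarith [hη m]
    rw [ENNReal.ofReal_mul hβ, ENNReal.ofReal_sum_of_nonneg fun m _ =>
      mul_nonneg (hnn m) measureReal_nonneg]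
    congr 1
    refine Finset.sum_congr rfl fun m _ => ?_
    rw [ENNReal.ofReal_mul (hnn m), ofReal_measureReal]
  have hnn : ∀ m, 0 ≤ η m + C := fun m => by linarith [hη m]
  have h0 : 0 ≤ β * ∑ m ∈ Finset.range K, (η m + C) * (Ψ.2 m : Measure V).real Set.univ :=
    mul_nonneg hβ (Finset.sum_nonneg fun m _ => mul_nonneg (hnn m) measureReal_nonneg)
  rw [e1, EReal.coe_ennreal_ofReal, max_eq_left h0, EReal.coe_lt_coe_iff] at hK
  obtain ⟨φ, hφ⟩ : ∃ φ : V →ᵇ ℝ, ∀ y, φ y = 1 := ⟨BoundedContinuousFunction.const V 1, fun _ => rfl⟩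
  have hc : Continuous fun Φ : Setting V kmax =>
      β * ∑ m ∈ Finset.range K, (η m + C) * ∫ y, φ y ∂(Φ.2 m : Measure V) :=
    (continuous_finsetSum _ fun m _ => (continuous_integral_hop m φ).const_mul _).const_mul _
  have hev := (hc.tendsto Ψ).eventually_const_lt (u := z) (by simpa [hφ] using hK)
  refine ⟨_, hev, ?_⟩
  have hn : ∀ᶠ lam : ℝ≥0 in atTop, β * C * ((n lam : ℝ) / lam) < β * C * μ.mass + δ :=
    ((tendsto_card_div hL).const_mul (β * C)).eventually_lt_const (by linarith)
  filter_upwards [hn, tendsto_coe_atTop_real.eventually_gt_atTop 0] with lam h2 hl s hs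
  have hs' : z < β * ∑ m ∈ Finset.range K, (η m + C) * ∫ y, φ y ∂(hopMeasure lam x s m : Measure V) :=
    hs
  simp only [← integral_const_mul] at hs'
  rw [sum_integral_hopMeasure hx lam s K fun m y => (η m + C) * φ y] at hs'
  have h3 : (∑ i : Fin (n lam), if hits s i < K then (η (hits s i) + C) * φ (x i) else 0) ≤
      congestion η x s + C * n lam := by
    have : congestion η x s + C * n lam = ∑ i : Fin (n lam), (η (hits s i) + C) := by
      rw [Finset.sum_add_distrib, congestion]
      simp [incoming_eq_hits hx, mul_comm]
    rw [this]
    refine Finset.sum_le_sum fun i _ => ?_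
    split_ifs
    · rw [hφ, mul_one]
    · exact hnn _
  have h4 : lam * z ≤ β * (∑ i : Fin (n lam), if hits s i < K then (η (hits s i) + C) * φ (x i) else 0) := by
    have := mul_le_mul_of_nonneg_left hs'.le hl.le
    refine this.trans_eq ?_
    field_simp
  have h5 := mul_le_mul_of_nonneg_left h3 hβ
  have h6 := mul_lt_mul_of_pos_left h2 hl
  have h7 : lam * (β * C * ((n lam : ℝ) / lam)) = β * C * n lam := by field_simp
  nlinarith

theorem hasSum_congestion (hΨ : IsAdmissible μ Ψ) {C : ℝ} (hη : ∀ m, -C ≤ η m)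
    (hfin : shiftedCongestion η C Ψ ≠ ⊤) :
    HasSum (fun m => η m * (Ψ.2 m : Measure V).real Set.univ)
      ((shiftedCongestion η C Ψ).toReal - C * μ.mass) := by
  have hnn : ∀ m, 0 ≤ η m + C := fun m => by linarith [hη m]
  have h1 := hasSum_toReal_tsum hfin
  simp only [ENNReal.toReal_mul, ENNReal.toReal_ofReal (hnn _)] at h1
  have h2 := (hΨ.hasSum_cell MeasurableSet.univ).mul_left C
  have h3 := h1.sub h2
  have e : (fun m => η m * (Ψ.2 m : Measure V).real Set.univ) = fun m =>
      (η m + C) * ((Ψ.2 m : Measure V) Set.univ).toReal - C * (Ψ.2 m : Measure V).real Set.univ := by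
    funext m
    rw [measureReal_def]
    ring
  rw [e]
  exact h3

end Limit

end

end MultihopGibbs

namespace MultihopGibbs

noncomputable section

section Limit

variable {V : Type*} [MetricSpace V] [CompactSpace V] [MeasurableSpace V] [BorelSpace V]
variable {μ : FiniteMeasure V} {x : ℕ → V} {n : ℝ≥0 → ℕ} {kmax : ℕ} {Ψ : Setting V kmax}
variable {f : ∀ k : Fin kmax, FiniteMeasure V × (Fin (k + 1) → V) → ℝ} {η : ℕ → ℝ} {γ β : ℝ}

theorem exists_real_lt_add_of_ne_bot {y z : EReal} (hy : y ≠ ⊥) (hz : z ≠ ⊥) {b : ℝ}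
    (h : (b : EReal) < y + z) :
    ∃ b₁ b₂ : ℝ, (b₁ : EReal) < y ∧ (b₂ : EReal) < z ∧ b ≤ b₁ + b₂ := by
  induction y with
  | bot => exact absurd rfl hy
  | top =>
    obtain ⟨b₂, -, h₂⟩ := EReal.lt_iff_exists_real_btwn.1 (bot_lt_iff_ne_bot.2 hz)
    exact ⟨b - b₂, b₂, EReal.coe_lt_top _, h₂, by linarith⟩
  | coe y =>
    induction z with
    | bot => exact absurd rfl hz
    | top => exact ⟨y - 1, b - (y - 1), by exact_mod_cast sub_one_lt y, EReal.coe_lt_top _, by linarith⟩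
    | coe z =>
      rw [← EReal.coe_add, EReal.coe_lt_coe_iff] at h
      exact ⟨y - (y + z - b) / 2, z - (y + z - b) / 2, by
        rw [EReal.coe_lt_coe_iff]; linarith, by rw [EReal.coe_lt_coe_iff]; linarith, by linarith⟩

theorem rate_ne_bot : rate μ Ψ ≠ ⊥ := by
  rw [rate]
  split_ifs
  · rw [entropy]
    simp only [ne_eq, EReal.add_eq_bot_iff, EReal.coe_ennreal_ne_bot, EReal.coe_ne_bot, or_self,
      not_false_eq_true]
  · simp

theorem coe_mul_coe_sub (hβ : 0 < β) (A : ℝ≥0∞) (c : ℝ) :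
    (β : EReal) * ((A : EReal) - (c : EReal)) =
      ((ENNReal.ofReal β * A : ℝ≥0∞) : EReal) + ((-(β * c) : ℝ) : EReal) := by
  rcases eq_or_ne A ⊤ with rfl | hA
  · rw [ENNReal.mul_top (by simpa using hβ), EReal.coe_ennreal_top, EReal.top_sub_coe,
      EReal.coe_mul_top_of_pos hβ, EReal.top_add_coe]
  · lift A to ℝ≥0 using hA
    rw [EReal.coe_ennreal_mul, EReal.coe_ennreal_ofReal, max_eq_left hβ.le]
    have : ((A : ℝ≥0∞) : EReal) = ((A : ℝ) : EReal) := rfl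
    rw [this]
    norm_cast
    ring

theorem IsAdmissible.freeEnergy_add_eq (hΨ : IsAdmissible μ Ψ) (hβ : 0 < β) {C : ℝ} (hC : 0 ≤ C)
    (hη : ∀ m, -C ≤ η m) :
    freeEnergy f η γ β μ Ψ + ((μ.mass * Real.log kmax : ℝ) : EReal) =
      rate μ Ψ + ((ENNReal.ofReal β * shiftedCongestion η C Ψ : ℝ≥0∞) : EReal) +
        ((γ * limitInterference f μ Ψ - β * C * μ.mass : ℝ) : EReal) := by
  rw [freeEnergy, limitCongestion_eq hΨ hC hη, coe_mul_coe_sub hβ, rate, if_pos hΨ,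
    sub_eq_add_neg (γ * limitInterference f μ Ψ), EReal.coe_add, mul_assoc β]
  simp only [add_assoc, add_left_comm, add_comm]

theorem exists_forall_neg_le (h : BddBelow (Set.range η)) : ∃ C : ℝ, 0 ≤ C ∧ ∀ m, -C ≤ η m := by
  obtain ⟨c, hc⟩ := h
  exact ⟨|c|, abs_nonneg c, fun m => (neg_abs_le c).trans (hc ⟨m, rfl⟩)⟩

/-- Upper bound for the unnormalized Gibbs measure near an admissible setting. -/
theorem exists_tilted_le (hk : 1 ≤ kmax) (hμ : 0 < (μ.mass : ℝ)) (hx : Function.Injective x)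
    (hL : Tendsto (fun lam => userMeasure lam x (n lam)) atTop (𝓝 μ))
    (hf : ∀ k, Continuous (f k)) (hηb : BddBelow (Set.range η)) (hγ : 0 < γ) (hβ : 0 < β)
    (hΨ : IsAdmissible μ Ψ) {a : ℝ}
    (ha : (a : EReal) < freeEnergy f η γ β μ Ψ + ((μ.mass * Real.log kmax : ℝ) : EReal)) :
    ∃ U ∈ 𝓝 Ψ, ∀ᶠ lam : ℝ≥0 in atTop,
      tilted (energy f η γ β lam x) {s : Config (n lam) kmax | empirical lam x s ∈ U} ≤
        Real.exp (-(lam * a)) := by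
  obtain ⟨C, hC, hη⟩ := exists_forall_neg_le hηb
  obtain ⟨a', haa', ha'⟩ := EReal.lt_iff_exists_real_btwn.1 ha
  rw [EReal.coe_lt_coe_iff] at haa'
  rw [hΨ.freeEnergy_add_eq hβ hC hη] at ha'
  obtain ⟨b, c, hb, hc, hbc⟩ := exists_real_lt_add_of_ne_bot
    (by simp only [ne_eq, EReal.add_eq_bot_iff, EReal.coe_ennreal_ne_bot, rate_ne_bot, or_self,
      not_false_eq_true]) (EReal.coe_ne_bot _) ha'
  rw [EReal.coe_lt_coe_iff] at hc
  obtain ⟨b₁, b₂, hb₁, hb₂, hbb⟩ := exists_real_lt_add_of_ne_bot rate_ne_bot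
    (EReal.coe_ennreal_ne_bot _) hb
  set δ := (a' - a) / (γ + 1) with hδ
  have hδ0 : 0 < δ := div_pos (by linarith) (by linarith)
  have hδ1 : γ * δ + δ = a' - a := by rw [hδ]; field_simp
  obtain ⟨U₁, hU₁, h₁⟩ := exists_prior_le_of_isAdmissible hk hμ hx hL hΨ hb₁
  obtain ⟨U₂, hU₂, h₂⟩ := exists_nhds_interference hf hL Ψ hδ0
  obtain ⟨U₃, hU₃, h₃⟩ := exists_nhds_le_congestion hβ.le hη hx hL hb₂ hδ0
  refine ⟨U₁ ∩ (U₂ ∩ U₃), inter_mem hU₁ (inter_mem hU₂ hU₃), ?_⟩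
  filter_upwards [h₁, h₂, h₃] with lam h₁ h₂ h₃
  have hl : (0 : ℝ) ≤ lam := NNReal.coe_nonneg _
  refine (tilted_le (e := lam * (γ * (limitInterference f μ Ψ - δ) + (b₂ - β * C * μ.mass - δ)))
    fun s hs => ?_).trans ?_
  · have h4 := (abs_le.1 (h₂ s hs.2.1)).1
    have h5 := h₃ s hs.2.2
    rw [energy, mul_add]
    refine add_le_add ?_ h5
    have := mul_le_mul_of_nonneg_left (by linarith : lam * (limitInterference f μ Ψ - δ) ≤
      interference f lam x s) hγ.le
    linarith
  · refine (mul_le_mul_of_nonneg_right ((prior_mono fun s hs => hs.1).trans h₁)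
      (Real.exp_pos _).le).trans ?_
    rw [← Real.exp_add]
    refine Real.exp_le_exp.2 ?_
    have : lam * a ≤ lam * (b₁ + (γ * (limitInterference f μ Ψ - δ) +
      (b₂ - β * C * μ.mass - δ))) := mul_le_mul_of_nonneg_left (by nlinarith) hl
    linarith

/-- Lower bound for the partition function. -/
theorem eventually_exp_le_tilted_univ (hk : 1 ≤ kmax) (hμ : 0 < (μ.mass : ℝ))
    (hx : Function.Injective x)
    (hL : Tendsto (fun lam => userMeasure lam x (n lam)) atTop (𝓝 μ))
    (hf : ∀ k, Continuous (f k)) (hηb : BddBelow (Set.range η)) (hγ : 0 < γ) (hβ : 0 < β)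
    (hΨ : IsAdmissible μ Ψ) {a : ℝ}
    (ha : freeEnergy f η γ β μ Ψ + ((μ.mass * Real.log kmax : ℝ) : EReal) < (a : EReal)) :
    ∀ᶠ lam : ℝ≥0 in atTop, Real.exp (-(lam * a)) ≤
      tilted (energy f η γ β lam x) (Set.univ : Set (Config (n lam) kmax)) := by
  obtain ⟨C, hC, hη⟩ := exists_forall_neg_le hηb
  rw [hΨ.freeEnergy_add_eq hβ hC hη] at ha
  have hr := rate_ne_bot (μ := μ) (Ψ := Ψ)
  have hA : shiftedCongestion η C Ψ ≠ ⊤ := by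
    intro h
    rw [h, ENNReal.mul_top (by simpa using hβ), EReal.coe_ennreal_top, EReal.add_top_of_ne_bot hr,
      EReal.top_add_coe] at ha
    exact absurd ha (by simp)
  have hrt : rate μ Ψ ≠ ⊤ := by
    intro h
    rw [h, EReal.top_add_of_ne_bot (EReal.coe_ennreal_ne_bot _), EReal.top_add_coe] at ha
    exact absurd ha (by simp)
  have hA' : ((ENNReal.ofReal β * shiftedCongestion η C Ψ : ℝ≥0∞) : EReal) =
      ((β * (shiftedCongestion η C Ψ).toReal : ℝ) : EReal) := by
    rw [← EReal.coe_ennreal_toReal (ENNReal.mul_ne_top ENNReal.ofReal_ne_top hA),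
      ENNReal.toReal_mul, ENNReal.toReal_ofReal hβ.le]
  have hsum := hasSum_congestion hΨ hη hA
  set A := (shiftedCongestion η C Ψ).toReal
  set r := (rate μ Ψ).toReal with hrdef
  have hre : rate μ Ψ = (r : EReal) := (EReal.coe_toReal hrt hr).symm
  rw [hA', hre, ← EReal.coe_add, ← EReal.coe_add, EReal.coe_lt_coe_iff] at ha
  set ε := a - (r + β * A + (γ * limitInterference f μ Ψ - β * C * μ.mass)) with hε
  have hε0 : 0 < ε := by linarith
  set δ := ε / (γ + β + 1) with hδ
  have hδ0 : 0 < δ := by positivity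
  have hδ1 : γ * δ + β * δ + δ = ε := by rw [hδ]; field_simp
  obtain ⟨U, hU, h₁⟩ := exists_nhds_interference hf hL Ψ hδ0
  have h₂ := eventually_exp_le_prior hk hμ hx hL hΨ (b := r + δ)
    (by rw [hre, EReal.coe_lt_coe_iff]; linarith) hsum.summable hU hδ0
  rw [hsum.tsum_eq] at h₂
  filter_upwards [h₁, h₂] with lam h₁ h₂
  have hl : (0 : ℝ) ≤ lam := NNReal.coe_nonneg _
  refine le_trans ?_ ((le_tilted (e := lam * (γ * (limitInterference f μ Ψ + δ) +
    β * (A - C * μ.mass + δ))) fun s hs => ?_).trans (tilted_mono _ (Set.subset_univ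
    {s : Config (n lam) kmax | empirical lam x s ∈ U ∧
      congestion η x s ≤ lam * (A - C * μ.mass + δ)})))
  · refine le_trans (le_of_eq ?_) (mul_le_mul_of_nonneg_right h₂ (Real.exp_pos _).le)
    rw [← Real.exp_add]
    congr 1
    have : a = r + δ + (γ * (limitInterference f μ Ψ + δ) + β * (A - C * μ.mass + δ)) := by
      linarith
    rw [this]; ring
  · have h4 := (abs_le.1 (h₁ s hs.1)).2
    have h5 := mul_le_mul_of_nonneg_left hs.2 hβ.le
    have h6 := mul_le_mul_of_nonneg_left (by linarith : interference f lam x s ≤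
      lam * (limitInterference f μ Ψ + δ)) hγ.le
    rw [energy]
    linarith

/-- A lower bound for the partition function that comes from the configuration in which all
users hop directly to the base station. -/
theorem exists_exp_le_tilted_univ (hk : 1 ≤ kmax)
    (hL : Tendsto (fun lam => userMeasure lam x (n lam)) atTop (𝓝 μ))
    (hf : ∀ k, Continuous (f k)) (hγ : 0 < γ) (hβ : 0 < β) :
    ∃ b : ℝ, ∀ᶠ lam : ℝ≥0 in atTop, Real.exp (-(lam * b)) ≤
      tilted (energy f η γ β lam x) (Set.univ : Set (Config (n lam) kmax)) := by
  obtain ⟨C, hC⟩ := exists_interference_bounds hf hL (x := x) (n := n)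
  have hk' : (1 : ℝ) ≤ kmax := by exact_mod_cast hk
  set D := Real.log kmax + β * |η 0| with hD
  have hD0 : 0 ≤ D := add_nonneg (Real.log_nonneg hk') (by positivity)
  refine ⟨(μ.mass + 1) * D + γ * C, ?_⟩
  filter_upwards [hC, (tendsto_card_div hL).eventually_lt_const
    (show (μ.mass : ℝ) < μ.mass + 1 by linarith),
    tendsto_coe_atTop_real.eventually_gt_atTop 0] with lam h1 h2 hl
  rw [div_lt_iff₀ hl] at h2
  let s : Config (n lam) kmax := fun _ => ⟨⟨0, hk⟩, fun l => l.elim0⟩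
  have h3 : prior ({s} : Set (Config (n lam) kmax)) = Real.exp (-(n lam * Real.log kmax)) := by
    classical
    rw [prior, Finset.sum_eq_single s (fun t ht hts => absurd (by simpa using ht) hts)
      (fun h => absurd (by simp) h)]
    simp only [s, pow_zero, mul_one, Finset.prod_const, Finset.card_univ, Fintype.card_fin]
    rw [one_div, ← mul_neg, Real.exp_nat_mul, Real.exp_neg, Real.exp_log (by linarith)]
  have h4 : congestion η x s = n lam * η 0 := by
    have h5 : ∀ i, incoming x s i = 0 := by
      intro i
      rw [incoming]
      refine Finset.sum_eq_zero fun j _ => ?_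
      exact Finset.sum_eq_zero fun l _ => l.elim0
    simp [congestion, h5]
  have h6 : energy f η γ β lam x s ≤ γ * (lam * C) + β * (n lam * |η 0|) := by
    rw [energy, h4]
    refine add_le_add (mul_le_mul_of_nonneg_left ((le_abs_self _).trans (h1 s)) hγ.le)
      (mul_le_mul_of_nonneg_left (mul_le_mul_of_nonneg_left (le_abs_self _) ?_) hβ.le)
    positivity
  refine le_trans ?_ ((le_tilted (B := {s})
    (e := γ * (lam * C) + β * (n lam * |η 0|)) fun t ht => ?_).trans
    (tilted_mono _ (Set.subset_univ {s})))
  rotate_left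
  · rw [Set.mem_singleton_iff.1 ht]; exact h6
  · rw [h3, ← Real.exp_add]
    refine Real.exp_le_exp.2 ?_
    have := mul_le_mul_of_nonneg_right h2.le hD0
    rw [hD] at this
    rw [hD]
    linarith

theorem exists_tilted_le_of_not_isAdmissible (hk : 1 ≤ kmax) (hμ : 0 < (μ.mass : ℝ))
    (hx : Function.Injective x)
    (hL : Tendsto (fun lam => userMeasure lam x (n lam)) atTop (𝓝 μ))
    (hf : ∀ k, Continuous (f k)) (hηb : BddBelow (Set.range η)) (hγ : 0 < γ) (hβ : 0 < β)
    (hΨ : ¬ IsAdmissible μ Ψ) (a : ℝ) :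
    ∃ U ∈ 𝓝 Ψ, ∀ᶠ lam : ℝ≥0 in atTop,
      tilted (energy f η γ β lam x) {s : Config (n lam) kmax | empirical lam x s ∈ U} ≤
        Real.exp (-(lam * a)) := by
  obtain ⟨C, hC, hη⟩ := exists_forall_neg_le hηb
  obtain ⟨D, hD⟩ := exists_interference_bounds hf hL (x := x) (n := n)
  obtain ⟨U, hU, h⟩ := exists_prior_le_of_not_isAdmissible hk hμ hx hL hΨ
    (a + γ * D + β * ((μ.mass + 1) * C))
  refine ⟨U, hU, ?_⟩
  filter_upwards [h, hD, (tendsto_card_div hL).eventually_lt_const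
    (show (μ.mass : ℝ) < μ.mass + 1 by linarith),
    tendsto_coe_atTop_real.eventually_gt_atTop 0] with lam h h1 h2 hl
  rw [div_lt_iff₀ hl] at h2
  refine (tilted_le (e := -(lam * (γ * D + β * ((μ.mass + 1) * C)))) fun s _ => ?_).trans
    ((mul_le_mul_of_nonneg_right h (Real.exp_pos _).le).trans_eq ?_)
  · have h3 : -(n lam * C) ≤ congestion η x s := by
      have : ∑ i : Fin (n lam), -C ≤ congestion η x s := Finset.sum_le_sum fun i _ => hη _
      simpa using this
    have h4 := mul_le_mul_of_nonneg_right h2.le hC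
    have h5 := mul_le_mul_of_nonneg_left (by linarith : -((μ.mass + 1) * lam * C) ≤
      congestion η x s) hβ.le
    have h6 := mul_le_mul_of_nonneg_left (abs_le.1 (h1 s)).1 hγ.le
    rw [energy]
    linarith
  · rw [← Real.exp_add]
    congr 1
    ring

theorem tendsto_empiricalLaw_zero (hk : 1 ≤ kmax) {U : Set (Setting V kmax)} {a b : ℝ} (hab : b < a)
    (h₁ : ∀ᶠ lam : ℝ≥0 in atTop,
      tilted (energy f η γ β lam x) {s : Config (n lam) kmax | empirical lam x s ∈ U} ≤
        Real.exp (-(lam * a)))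
    (h₂ : ∀ᶠ lam : ℝ≥0 in atTop, Real.exp (-(lam * b)) ≤
      tilted (energy f η γ β lam x) (Set.univ : Set (Config (n lam) kmax))) :
    Tendsto (fun lam => empiricalLaw f η γ β lam x (n lam) U) atTop (𝓝 0) := by
  have h3 : Tendsto (fun lam : ℝ≥0 => ENNReal.ofReal (Real.exp (-((lam : ℝ) * (a - b))))) atTop
      (𝓝 0) := by
    have h4 : Tendsto (fun lam : ℝ≥0 => (lam : ℝ) * (a - b)) atTop atTop :=
      tendsto_coe_atTop_real.atTop_mul_const (by linarith)
    have h5 := ENNReal.tendsto_ofReal (Real.tendsto_exp_neg_atTop_nhds_zero.comp h4)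
    rwa [ENNReal.ofReal_zero] at h5
  refine tendsto_of_tendsto_of_tendsto_of_le_of_le' tendsto_const_nhds h3
    (Eventually.of_forall fun _ => zero_le) ?_
  filter_upwards [h₁, h₂] with lam h₁ h₂
  rw [empiricalLaw_eq hk]
  refine ENNReal.ofReal_le_ofReal ?_
  rw [div_le_iff₀ (tilted_univ_pos hk _)]
  refine h₁.trans (le_trans (le_of_eq ?_) (mul_le_mul_of_nonneg_left h₂ (Real.exp_pos _).le))
  rw [← Real.exp_add]
  congr 1
  ring

/-- The Gibbs measures concentrate on the minimizers of the free energy. -/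
theorem convergesToSet_empiricalLaw (hk : 1 ≤ kmax) (hμ : 0 < (μ.mass : ℝ))
    (hx : Function.Injective x)
    (hL : Tendsto (fun lam => userMeasure lam x (n lam)) atTop (𝓝 μ))
    (hf : ∀ k, Continuous (f k)) (hηb : BddBelow (Set.range η)) (hγ : 0 < γ) (hβ : 0 < β) :
    ConvergesToSet (fun lam => empiricalLaw f η γ β lam x (n lam)) (minimizers f η γ β μ) := by
  obtain ⟨K, hK, hQK⟩ := exists_isCompact_empirical_mem hx hL kmax
  refine ConvergesToSet.of_local (fun lam B B' => empiricalLaw_mono hk lam _)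
    (fun lam B B' => empiricalLaw_union_le hk lam _ B B')
    (fun lam => empiricalLaw_eq_zero lam _ fun s => by simp) hK ?_ fun Ψ hΨ => ?_
  · filter_upwards [hQK] with lam h
    exact empiricalLaw_eq_zero lam _ fun s => by simpa using h s
  by_cases had : IsAdmissible μ Ψ
  · have h1 : ∃ Φ, IsAdmissible μ Φ ∧ freeEnergy f η γ β μ Φ < freeEnergy f η γ β μ Ψ := by
      by_contra! h
      exact hΨ ⟨had, h⟩
    obtain ⟨Φ, hΦ, hlt⟩ := h1
    have h2 := EReal.add_lt_add_of_lt_of_le hlt (le_refl ((μ.mass * Real.log kmax : ℝ) : EReal))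
      (EReal.coe_ne_bot _) (EReal.coe_ne_top _)
    obtain ⟨b, hb, h3⟩ := EReal.lt_iff_exists_real_btwn.1 h2
    obtain ⟨a, hab, ha⟩ := EReal.lt_iff_exists_real_btwn.1 h3
    obtain ⟨U, hU, h⟩ := exists_tilted_le hk hμ hx hL hf hηb hγ hβ had ha
    exact ⟨U, hU, tendsto_empiricalLaw_zero hk (EReal.coe_lt_coe_iff.1 hab) h
      (eventually_exp_le_tilted_univ hk hμ hx hL hf hηb hγ hβ hΦ hb)⟩
  · obtain ⟨b, hb⟩ := exists_exp_le_tilted_univ (η := η) hk hL hf hγ hβ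
    obtain ⟨U, hU, h⟩ := exists_tilted_le_of_not_isAdmissible hk hμ hx hL hf hηb hγ hβ had (b + 1)
    exact ⟨U, hU, tendsto_empiricalLaw_zero hk (lt_add_one b) h hb⟩

end Limit

end

end MultihopGibbs

namespace MultihopGibbs

noncomputable section

section Probability

variable {Ω : Type*} [MeasurableSpace Ω] {P : Measure Ω} {N : ℝ≥0 → Ω → ℕ} {r : ℝ≥0}

theorem hasSum_mul_poisson (r : ℝ≥0) :
    HasSum (fun n : ℕ => (Real.exp (-r) * r ^ n / n.factorial) * (n : ℝ)) (r : ℝ) := by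
  have h := (hasSum_one_poissonMeasure r).mul_left (r : ℝ)
  rw [mul_one] at h
  refine (hasSum_nat_add_iff' (f := fun n : ℕ =>
    (Real.exp (-r) * r ^ n / n.factorial) * (n : ℝ)) 1).1 ?_
  simp only [Finset.range_one, Finset.sum_singleton, Nat.cast_zero, mul_zero, sub_zero]
  have e : (fun n : ℕ => (Real.exp (-r) * r ^ (n + 1) / (n + 1).factorial) * ((n + 1 : ℕ) : ℝ)) =
      fun n : ℕ => (r : ℝ) * (Real.exp (-r) * r ^ n / n.factorial) := by
    funext n
    rw [Nat.factorial_succ]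
    push_cast
    field_simp
    ring
  rw [e]
  exact h

theorem integrable_poissonMeasure (r : ℝ≥0) : Integrable (fun n : ℕ => (n : ℝ)) (poissonMeasure r) := by
  rw [integrable_poissonMeasure_iff]
  simpa using (hasSum_mul_poisson r).summable

theorem integral_id_poissonMeasure (r : ℝ≥0) : ∫ n : ℕ, (n : ℝ) ∂(poissonMeasure r) = r := by
  rw [integral_poissonMeasure]
  simpa using (hasSum_mul_poisson r).tsum_eq

/-- The law of large numbers for the Poisson process, along the integers. -/
theorem IsPoissonProcess.tendsto_nat_div [IsProbabilityMeasure P] (hN : IsPoissonProcess P r N) :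
    ∀ᵐ ω ∂P, Tendsto (fun m : ℕ => (N m ω : ℝ) / m) atTop (𝓝 r) := by
  let Y : ℕ → Ω → ℕ := fun i ω => N ((i + 1 : ℕ) : ℝ≥0) ω - N (i : ℝ≥0) ω
  have hYm : ∀ i, Measurable (Y i) := fun i => (hN.measurable _).sub (hN.measurable _)
  have hlaw : ∀ i, P.map (Y i) = poissonMeasure r := by
    intro i
    have := hN.law i (i + 1 : ℕ) (by simp)
    rw [this]
    congr 1
    simp
  have hind : iIndepFun Y P := hN.indep.nat (t := fun i : ℕ => (i : ℝ≥0)) Nat.mono_cast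
  have hcast : Measurable fun m : ℕ => (m : ℝ) := measurable_from_top
  have hint : Integrable (fun ω => (Y 0 ω : ℝ)) P := by
    have := integrable_poissonMeasure r
    rw [← hlaw 0] at this
    exact this.comp_measurable (hYm 0)
  have hmean : ∫ ω, (Y 0 ω : ℝ) ∂P = r := by
    rw [← integral_id_poissonMeasure r, ← hlaw 0, integral_map (hYm 0).aemeasurable
      hcast.aestronglyMeasurable]
  have h := strong_law_ae_real (fun i ω => (Y i ω : ℝ)) hint
    (fun i j hij => (hind.indepFun hij).comp hcast hcast)
    (fun i => (IdentDistrib.mk (hYm i).aemeasurable (hYm 0).aemeasurable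
      (by rw [hlaw, hlaw])).comp hcast)
  rw [hmean] at h
  filter_upwards [h, hN.zero, hN.paths] with ω h h0 hmono
  refine h.congr fun m => ?_
  congr 1
  have : ∀ m : ℕ, ∑ i ∈ Finset.range m, Y i ω = N m ω := by
    intro m
    induction m with
    | zero => simp [h0]
    | succ m ih =>
      rw [Finset.sum_range_succ, ih]
      have : N (m : ℝ≥0) ω ≤ N ((m + 1 : ℕ) : ℝ≥0) ω := hmono.1 (by simp)
      simp only [Y]
      omega
  rw [← this m]
  push_cast
  rfl

/-- The law of large numbers for the Poisson process. -/
theorem IsPoissonProcess.tendsto_div [IsProbabilityMeasure P] (hN : IsPoissonProcess P r N) :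
    ∀ᵐ ω ∂P, Tendsto (fun lam : ℝ≥0 => (N lam ω : ℝ) / lam) atTop (𝓝 r) := by
  filter_upwards [hN.tendsto_nat_div, hN.paths] with ω h hmono
  have hfl : Tendsto (fun lam : ℝ≥0 => ⌊lam⌋₊) atTop atTop := tendsto_nat_floor_atTop
  have hr1 : Tendsto (fun lam : ℝ≥0 => ((⌊lam⌋₊ : ℕ) : ℝ) / lam) atTop (𝓝 1) :=
    (tendsto_nat_floor_div_atTop (R := ℝ)).comp tendsto_coe_atTop_real |>.congr fun lam => by
      have : ⌊(lam : ℝ)⌋₊ = ⌊lam⌋₊ := by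
        rw [Nat.floor_eq_iff lam.coe_nonneg]
        exact ⟨by exact_mod_cast Nat.floor_le zero_le, by exact_mod_cast Nat.lt_floor_add_one lam⟩
      simp [this]
  have hinv : Tendsto (fun lam : ℝ≥0 => (1 : ℝ) / lam) atTop (𝓝 0) := by
    simp only [one_div]
    exact tendsto_inv_atTop_zero.comp tendsto_coe_atTop_real
  have hlow : Tendsto (fun lam : ℝ≥0 => ((N (⌊lam⌋₊ : ℝ≥0) ω : ℝ) / (⌊lam⌋₊ : ℕ)) *
      (((⌊lam⌋₊ : ℕ) : ℝ) / lam)) atTop (𝓝 (r * 1)) := (h.comp hfl).mul hr1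
  have hup : Tendsto (fun lam : ℝ≥0 => ((N ((⌊lam⌋₊ + 1 : ℕ) : ℝ≥0) ω : ℝ) / (⌊lam⌋₊ + 1 : ℕ)) *
      (((⌊lam⌋₊ : ℕ) : ℝ) / lam + 1 / lam)) atTop (𝓝 (r * (1 + 0))) :=
    (h.comp ((tendsto_add_atTop_nat 1).comp hfl)).mul (hr1.add hinv)
  rw [mul_one] at hlow
  rw [add_zero, mul_one] at hup
  refine tendsto_of_tendsto_of_tendsto_of_le_of_le' hlow hup ?_ ?_
  · filter_upwards [eventually_ge_atTop 1] with lam hl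
    have hl0 : (0 : ℝ) < lam := lt_of_lt_of_le one_pos (by exact_mod_cast hl)
    have h1 : (0 : ℝ) < (⌊lam⌋₊ : ℕ) := by exact_mod_cast Nat.floor_pos.2 hl
    rw [div_mul_div_cancel₀ h1.ne']
    have : N (⌊lam⌋₊ : ℝ≥0) ω ≤ N lam ω := hmono.1 (Nat.floor_le (zero_le))
    gcongr
  · filter_upwards [eventually_ge_atTop 1] with lam hl
    have hl0 : (0 : ℝ) < lam := lt_of_lt_of_le one_pos (by exact_mod_cast hl)
    have h1 : (0 : ℝ) < ((⌊lam⌋₊ + 1 : ℕ) : ℝ) := by positivity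
    rw [← add_div, ← Nat.cast_add_one, div_mul_div_cancel₀ h1.ne']
    have : N lam ω ≤ N ((⌊lam⌋₊ + 1 : ℕ) : ℝ≥0) ω := hmono.1 (by
      push_cast; exact (Nat.lt_floor_add_one lam).le)
    gcongr

/-- Almost surely, the members of an i.i.d. sequence with a diffuse law are distinct. -/
theorem ae_injective {V : Type*} [MeasurableSpace V] [MeasurableEq V] [IsProbabilityMeasure P]
    {X : ℕ → Ω → V}
    (hX : ∀ i, Measurable (X i)) (hind : iIndepFun X P) (hat : ∀ i, ∀ v, P.map (X i) {v} = 0) :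
    ∀ᵐ ω ∂P, Function.Injective fun i => X i ω := by
  have h : ∀ i j, i ≠ j → ∀ᵐ ω ∂P, X i ω ≠ X j ω := by
    intro i j hij
    have h1 := (indepFun_iff_map_prod_eq_prod_map_map (hX i).aemeasurable
      (hX j).aemeasurable).1 (hind.indepFun hij)
    have hi := Measure.isProbabilityMeasure_map (μ := P) (hX i).aemeasurable
    have hj := Measure.isProbabilityMeasure_map (μ := P) (hX j).aemeasurable
    have h2 : ((P.map (X i)).prod (P.map (X j))) (Set.diagonal V) = 0 := by
      rw [Measure.measure_prod_null measurableSet_diagonal]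
      refine Eventually.of_forall fun v => ?_
      have : Prod.mk v ⁻¹' Set.diagonal V = {v} := by
        ext w; simp [eq_comm]
      simp only [this]
      exact hat j v
    rw [← h1, Measure.map_apply ((hX i).prodMk (hX j)) measurableSet_diagonal] at h2
    rw [ae_iff]
    simpa [Set.preimage, Set.diagonal] using h2
  have h' : ∀ᵐ ω ∂P, ∀ i j, i ≠ j → X i ω ≠ X j ω := by
    rw [ae_all_iff]; intro i
    rw [ae_all_iff]; intro j
    by_cases hij : i = j
    · exact Eventually.of_forall fun ω hne => absurd hij hne
    · filter_upwards [h i j hij] with ω hω _ using hω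
  filter_upwards [h'] with ω hω i j hij
  by_contra hne
  exact hω i j hne hij

section Users

variable {V : Type*} [MetricSpace V] [CompactSpace V] [MeasurableSpace V] [BorelSpace V]
variable {μ : FiniteMeasure V} {X : ℕ → Ω → V}

/-- A criterion for the convergence of the empirical measures by a dense sequence of test
functions. -/
theorem tendsto_userMeasure {x : ℕ → V} {n : ℝ≥0 → ℕ} (hμ : 0 < μ.mass)
    (hn : Tendsto (fun lam : ℝ≥0 => (n lam : ℝ) / lam) atTop (𝓝 μ.mass))
    (h : ∀ k, Tendsto (fun m : ℕ => (∑ i ∈ Finset.range m, TopologicalSpace.denseSeq C(V, ℝ) k (x i)) / m) atTop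
      (𝓝 ((μ.mass : ℝ)⁻¹ * ∫ y, TopologicalSpace.denseSeq C(V, ℝ) k y ∂(μ : Measure V)))) :
    Tendsto (fun lam => userMeasure lam x (n lam)) atTop (𝓝 μ) := by
  have hμ' : (0 : ℝ) < μ.mass := hμ
  have hninf : Tendsto n atTop atTop := by
    have h1 : Tendsto (fun lam : ℝ≥0 => ((n lam : ℝ) / lam) * lam) atTop atTop :=
      hn.pos_mul_atTop hμ' tendsto_coe_atTop_real
    rw [← tendsto_natCast_atTop_iff (R := ℝ)]
    refine h1.congr' ?_
    filter_upwards [eventually_gt_atTop 0] with lam hl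
    have : (lam : ℝ) ≠ 0 := by exact_mod_cast hl.ne'
    field_simp
  have hmean : ∀ φ : C(V, ℝ), Tendsto (fun m : ℕ => (∑ i ∈ Finset.range m, φ (x i)) / m) atTop
      (𝓝 ((μ.mass : ℝ)⁻¹ * ∫ y, φ y ∂(μ : Measure V))) := by
    intro φ
    rw [Metric.tendsto_atTop]
    intro ε hε
    obtain ⟨_, hk, ⟨k, rfl⟩⟩ := Metric.dense_iff.1 (TopologicalSpace.denseRange_denseSeq C(V, ℝ)) φ
      (ε / 3) (by positivity)
    set g := TopologicalSpace.denseSeq C(V, ℝ) k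
    have hgφ : ∀ y, |g y - φ y| ≤ ε / 3 := fun y => by
      have := ContinuousMap.dist_apply_le_dist (f := g) (g := φ) y
      rw [Real.dist_eq] at this
      exact this.trans (Metric.mem_ball.1 hk).le
    obtain ⟨M, hM⟩ := Metric.tendsto_atTop.1 (h k) (ε / 3) (by positivity)
    refine ⟨max M 1, fun m hm => ?_⟩
    have hm1 : (0 : ℝ) < m := by exact_mod_cast lt_of_lt_of_le one_pos ((le_max_right _ _).trans hm)
    have h1 := hM m ((le_max_left _ _).trans hm)
    rw [Real.dist_eq] at h1 ⊢
    have h2 : |(∑ i ∈ Finset.range m, g (x i)) / m - (∑ i ∈ Finset.range m, φ (x i)) / m| ≤ ε / 3 := by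
      rw [← sub_div, ← Finset.sum_sub_distrib, abs_div, abs_of_pos hm1, div_le_iff₀ hm1]
      refine (Finset.abs_sum_le_sum_abs _ _).trans ((Finset.sum_le_sum fun i _ =>
        hgφ (x i)).trans_eq ?_)
      simp [mul_comm]
    have hgi : Integrable (fun y => g y) (μ : Measure V) :=
      (BoundedContinuousFunction.mkOfCompact g).integrable (μ : Measure V)
    have hφi : Integrable (fun y => φ y) (μ : Measure V) :=
      (BoundedContinuousFunction.mkOfCompact φ).integrable (μ : Measure V)
    have h3 : |(μ.mass : ℝ)⁻¹ * ∫ y, g y ∂(μ : Measure V) -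
        (μ.mass : ℝ)⁻¹ * ∫ y, φ y ∂(μ : Measure V)| ≤ ε / 3 := by
      rw [← mul_sub, ← integral_sub hgi hφi, abs_mul, abs_of_pos (inv_pos.2 hμ'),
        inv_mul_le_iff₀ hμ']
      have := norm_integral_le_of_norm_le_const (μ := (μ : Measure V)) (f := fun y => g y - φ y)
        (C := ε / 3) (Eventually.of_forall hgφ)
      rw [Real.norm_eq_abs, mul_comm] at this
      exact this
    rw [abs_le] at h2 h3
    rw [abs_lt] at h1 ⊢
    constructor <;> linarith [h1.1, h1.2, h2.1, h2.2, h3.1, h3.2]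
  rw [FiniteMeasure.tendsto_iff_forall_integral_tendsto]
  intro φ
  have h1 := hn.mul ((hmean φ.toContinuousMap).comp hninf)
  rw [mul_inv_cancel_left₀ hμ'.ne'] at h1
  refine h1.congr' ?_
  filter_upwards [hninf.eventually_gt_atTop 0] with lam hl
  rw [integral_userMeasure]
  have : (n lam : ℝ) ≠ 0 := by exact_mod_cast hl.ne'
  simp only [Function.comp_apply, Finset.sum_range]
  field_simp
  rfl

theorem IsUserProcess.ae_tendsto [IsProbabilityMeasure P] (hX : IsUserProcess P μ N X)
    (hμ : 0 < μ.mass) :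
    ∀ᵐ ω ∂P, Tendsto (fun lam => userMeasure lam (fun i => X i ω) (N lam ω)) atTop (𝓝 μ) := by
  have h : ∀ φ : C(V, ℝ), ∀ᵐ ω ∂P,
      Tendsto (fun m : ℕ => (∑ i ∈ Finset.range m, φ (X i ω)) / m) atTop
        (𝓝 ((μ.mass : ℝ)⁻¹ * ∫ y, φ y ∂(μ : Measure V))) := by
    intro φ
    have hφ : Measurable fun y => φ y := φ.continuous.measurable
    have hmean : ∫ ω, φ (X 0 ω) ∂P = (μ.mass : ℝ)⁻¹ * ∫ y, φ y ∂(μ : Measure V) := by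
      rw [← integral_map (f := fun y => φ y) (hX.measurable 0).aemeasurable
        hφ.aestronglyMeasurable, hX.law,
        integral_smul_measure, ENNReal.toReal_inv, smul_eq_mul]
      rfl
    have hint : Integrable (fun ω => φ (X 0 ω)) P := by
      refine Integrable.comp_measurable (g := fun y => φ y) ?_ (hX.measurable 0)
      have := Measure.isProbabilityMeasure_map (μ := P) (hX.measurable 0).aemeasurable
      exact (BoundedContinuousFunction.mkOfCompact φ).integrable _
    rw [← hmean]
    exact strong_law_ae_real (fun i ω => φ (X i ω)) hint
      (fun i j hij => (hX.indep.indepFun hij).comp hφ hφ)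
      (fun i => (IdentDistrib.mk (hX.measurable i).aemeasurable (hX.measurable 0).aemeasurable
        (by rw [hX.law, hX.law])).comp hφ)
  have h' := ae_all_iff.2 fun k => h (TopologicalSpace.denseSeq C(V, ℝ) k)
  filter_upwards [h', hX.poisson.tendsto_div] with ω h1 h2
  exact tendsto_userMeasure hμ h2 h1

theorem IsUserProcess.ae_injective [IsProbabilityMeasure P] (hX : IsUserProcess P μ N X)
    (hat : ∀ v, (μ : Measure V) {v} = 0) : ∀ᵐ ω ∂P, Function.Injective fun i => X i ω :=
  MultihopGibbs.ae_injective hX.measurable hX.indep fun i v => by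
    rw [hX.law, Measure.smul_apply, hat, smul_zero]

end Users

end Probability

end

end MultihopGibbs

theorem theorem1p4 {d : ℕ} (hd : 0 < d)
    -- the compact territory, which contains the base station at the origin
    (W : Set (EuclideanSpace ℝ (Fin d))) (hW : IsCompact W) (h0 : 0 ∈ W)
    -- the intensity measure of the users
    (μ : FiniteMeasure W) (hμ : μ ≠ 0)
    (hac : (μ : Measure W).map Subtype.val ≪ volume)
    -- the maximal number of hops, and the two exponents of the Gibbs measure
    (kmax : ℕ) (hk : 1 ≤ kmax)
    (f : ∀ k : Fin kmax, FiniteMeasure W × (Fin (k + 1) → W) → ℝ)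
    (hf : ∀ k, Continuous (f k)) (hfb : ∀ k, BddBelow (Set.range (f k)))
    (η : ℕ → ℝ) (hηb : BddBelow (Set.range η))
    (hη : Tendsto (fun m : ℕ => η m / (m : ℝ)) atTop atTop)
    -- the users
    {Ω : Type*} [MeasurableSpace Ω] (P : Measure Ω) [IsProbabilityMeasure P]
    (N : ℝ≥0 → Ω → ℕ) (X : ℕ → Ω → W) (hX : MultihopGibbs.IsUserProcess P μ N X) :
    ∀ᵐ ω ∂P,
      MultihopGibbs.SatisfiesLDP
        (fun lam => MultihopGibbs.empiricalLaw f η 0 0 lam (fun i => X i ω) (N lam ω))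
        (MultihopGibbs.rate μ) ∧
      ∀ γ β : ℝ, 0 < γ → 0 < β →
        MultihopGibbs.ConvergesToSet
          (fun lam => MultihopGibbs.empiricalLaw f η γ β lam (fun i => X i ω) (N lam ω))
          (MultihopGibbs.minimizers f η γ β μ) := by
  have : CompactSpace W := isCompact_iff_compactSpace.1 hW
  have : Nonempty (Fin d) := ⟨⟨0, hd⟩⟩
  have hmass : 0 < μ.mass := pos_iff_ne_zero.2 ((FiniteMeasure.mass_nonzero_iff μ).2 hμ)
  have hat : ∀ v : W, (μ : Measure W) {v} = 0 := by
    intro v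
    have h := hac (measure_singleton (μ := volume) (v : EuclideanSpace ℝ (Fin d)))
    rw [Measure.map_apply measurable_subtype_coe (measurableSet_singleton _)] at h
    refine measure_mono_null ?_ h
    rintro _ rfl
    rfl
  filter_upwards [hX.ae_tendsto hmass, hX.ae_injective hat] with ω hL hx
  exact ⟨MultihopGibbs.satisfiesLDP_empiricalLaw hk hmass hx hL, fun γ β hγ hβ =>
    MultihopGibbs.convergesToSet_empiricalLaw hk hmass hx hL hf hηb hγ hβ⟩
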